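/- **Conventions.** Everything is $C^\infty$; $\mathbb{RP}^1=\mathbb R\cup\{\infty\}$, where $s_1:s_2$ corresponds to $s_1/s_2$ and $1:0$ to $\infty$. A foliation is identified with its tangent distribution. A *Kronecker web* on a manifold $M$ is a family of foliations $\{\mathcal F_s\}_{s\in\mathbb{RP}^1}$ for which there are a vector bundle $\Phi\to M$ and bundle morphisms $\phi_1,\phi_2:T^*M\to\Phi$ such that $\ker(s_1\phi_1+s_2\phi_2)=(T\mathcal F_{s_1:s_2})^\bot$ for all real $(s_1,s_2)\neq(0,0)$, and such that $z_1\phi_1+z_2\phi_2:T^*M\otimes\mathbb C\to\Phi\otimes\mathbb C$ is fibrewise surjective for all complex $(z_1,z_2)\ne(0,0)$. It is *of 3-web type* if $\dim M=4$, all $\mathcal F_s$ have rank $2$, and $\mathcal F_\infty,\mathcal F_0,\mathcal F_1$ are pairwise transversal. Let $\lambda_1\neq\lambda_3$ be real numbers. For a pair $f=(f^1,f^2)$ of functions of $x=(x_1,x_2,x_3,x_4)$ put $\bar 1=2$, $\bar 2=1$, and consider the system, for $i=1,2$, $$f^i_{x_1x_3}(f^i_{x_2}f^{\bar i}_{x_4}-f^{\bar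 i}_{x_2}f^i_{x_4})-f^i_{x_1x_4}(f^i_{x_2}f^{\bar i}_{x_3}-f^{\bar i}_{x_2}f^i_{x_3})-f^i_{x_2x_3}(f^i_{x_1}f^{\bar i}_{x_4}-f^{\bar i}_{x_1}f^i_{x_4})+f^i_{x_2x_4}(f^i_{x_1}f^{\bar i}_{x_3}-f^{\bar i}_{x_1}f^i_{x_3})=0,\tag{H}$$ the conditions $$\left|\frac{D(f^1,f^2)}{D(x_1,x_2)}\right|\neq0,\qquad \left|\frac{D(f^1,f^2)}{D(x_3,x_4)}\right|\neq0,\tag{J}$$ and the forms $$\omega^\lambda_{i}=(\lambda-\lambda_3)(f^{i}_{x_1}dx_1+f^{i}_{x_2}dx_2)+(\lambda-\lambda_1)(f^{i}_{x_3}dx_3+f^{i}_{x_4}dx_4),\qquad i=1,2,\tag{W}$$ where for $\lambda=\infty$ the leading coefficient $df^i$ is taken. Consider also, for a family $\{\mathcal F_\lambda\}$ of foliations, the conditions $$\mathcal F_{\lambda_1}=\{x_1=\mathrm{const},x_2=\mathrm{const}\},\quad \mathcal F_{\lambda_3}=\{x_3=\mathrm{const},x_4=\mathrm{const}\},\quad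 \mathcal F_\infty=\{f^1=\mathrm{const},f^2=\mathrm{const}\}.\tag{F}$$ **Theorem.** 1. Let $U\subset\mathbb R^4$ be open and let $f^{1},f^2$ be smooth functions on $U$ satisfying (H) and (J). Then $T\mathcal F_\lambda=\langle\omega^\lambda_1,\omega^\lambda_2\rangle^\bot$ defines a Kronecker web of 3-web type on $U$, and it satisfies (F). 2. Let $\{\mathcal F_\lambda\}$ be a Kronecker web of 3-web type on a smooth 4-manifold $M$. Then near any point of $M$ there are local coordinates $(x_1,x_2,x_3,x_4)$ in which $\mathcal F_{\lambda_1}$ and $\mathcal F_{\lambda_3}$ are as in (F) and such that any two independent smooth first integrals $f^1,f^2$ of $\mathcal F_\infty$, defined on any open subset of the coordinate domain, satisfy (H) and (J). 3. Conversely to 1, if a Kronecker web of 3-web type on an open set $U\subset\mathbb R^4$ satisfies (F) with smooth $f^1,f^2$ on $U$, then $f^1,f^2$ satisfy (H) and (J), and the web is the one defined by the forms (W). 4. For $f$ smooth near $p\in\mathbb R^4$ and $g$ smooth near $p'\in\mathbb R^4$, write $(f,p)\sim(g,p')$ if there are local diffeomorphisms $\psi,\varphi,\zeta$ of $\mathbb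 R^2$, defined near $g(p')$, $(p_1,p_2)$ and $(p_3,p_4)$ respectively, with $p'=(\varphi(p_1,p_2),\zeta(p_3,p_4))$ and $$f(x)=\psi\bigl(g(\varphi(x_1,x_2),\zeta(x_3,x_4))\bigr)\quad\text{for } x \text{ near } p.$$ If $(f,p)\sim(g,p')$ and $f$ satisfies (H) near $p$, then $g$ satisfies (H) near $p'$; likewise for (J). The relation $\sim$ is an equivalence relation on local solutions of (H) and (J) (smooth solutions on open sets of $\mathbb R^4$ with a chosen base point). Call two local Kronecker webs of 3-web type on $\mathbb R^4$ (webs on open sets with a chosen base point) that satisfy (F) for some smooth $f^1,f^2$ isomorphic if a local diffeomorphism matching the base points carries, near them, $\mathcal F_\lambda$ to $\mathcal F'_\lambda$ for every $\lambda\in\mathbb{RP}^1$; this is also an equivalence relation. Then assigning to a solution the web defined by (W) induces a well-defined bijection from the $\sim$-classes of local solutions of (H) and (J) onto the isomorphism classes of such local webs. -/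

import Mathlib

open scoped Manifold ContDiff Topology

noncomputable section

namespace KroneckerWeb

section Webs

variable {E : Type*} [NormedAddCommGroup E] [NormedSpace ℝ E]
  {M : Type*} [TopologicalSpace M] [ChartedSpace E M]

/-- `D` is, on `U`, the tangent distribution of a smooth foliation of codimension `q`: every point
of `U` has an open neighbourhood on which the foliation is given by the level sets of a smooth
submersion to `ℝ^q`. A foliation is identified with its tangent distribution. -/
def IsFoliationOn (q : ℕ) (D : ∀ x : M, Submodule ℝ (TangentSpace 𝓘(ℝ, E) x)) (U : Set M) : Prop :=
  ∀ p ∈ U, ∃ V : Set M, IsOpen V ∧ p ∈ V ∧ V ⊆ U ∧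
    ∃ h : M → EuclideanSpace ℝ (Fin q),
      ContMDiffOn 𝓘(ℝ, E) 𝓘(ℝ, EuclideanSpace ℝ (Fin q)) ∞ h V ∧
      ∀ x ∈ V, Function.Surjective (mfderiv 𝓘(ℝ, E) 𝓘(ℝ, EuclideanSpace ℝ (Fin q)) h x) ∧
        ∀ v : TangentSpace 𝓘(ℝ, E) x,
          v ∈ D x ↔ mfderiv 𝓘(ℝ, E) 𝓘(ℝ, EuclideanSpace ℝ (Fin q)) h x v = 0

/-- The point `s₁ : s₂` of the real projective line `ℝ ∪ {∞}`, with `1 : 0 = ∞`. -/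
def ratio (s₁ s₂ : ℝ) : OnePoint ℝ :=
  if s₂ = 0 then OnePoint.infty else ((s₁ / s₂ : ℝ) : OnePoint ℝ)

/-- Smoothness of a vector field on a set. -/
def IsSmoothFieldOn [IsManifold 𝓘(ℝ, E) ∞ M] (X : ∀ x : M, TangentSpace 𝓘(ℝ, E) x)
    (V : Set M) : Prop :=
  ContMDiffOn 𝓘(ℝ, E) 𝓘(ℝ, E).tangent ∞ (fun x => (⟨x, X x⟩ : TangentBundle 𝓘(ℝ, E) M)) V

/-- A Kronecker web of codimension `q` on `U`: a family of foliations indexed by `ℝ ∪ {∞}`, for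
which there are a vector bundle `Φ` and bundle morphisms `φ₁, φ₂ : T*M → Φ` with
`ker (s₁ φ₁ + s₂ φ₂) = (T F_{s₁ : s₂})^⊥` for all real `(s₁, s₂) ≠ 0`, such that
`z₁ φ₁ + z₂ φ₂` is fibrewise surjective on `T*M ⊗ ℂ` for all complex `(z₁, z₂) ≠ 0`.

The bundle is written in a local trivialisation `Φ = V × ℝ^k`: a smooth morphism `T*V → V × ℝ^k`
is the same as a `k`-tuple of smooth vector fields `X` on `V`, through `α ↦ (α (X₁), …, α (X_k))`,
and `T*_x ⊗ ℂ` is the space of real-linear maps `T_x → ℂ`. (Local data determine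
`Φ = T*M / (T F_∞)^⊥`, `φ₁ = ` the projection, and `φ₂` uniquely, so they always glue.) -/
structure IsKroneckerWebOn [IsManifold 𝓘(ℝ, E) ∞ M] (q : ℕ)
    (F : OnePoint ℝ → ∀ x : M, Submodule ℝ (TangentSpace 𝓘(ℝ, E) x)) (U : Set M) : Prop where
  foliation : ∀ s, IsFoliationOn q (F s) U
  pencil : ∀ p ∈ U, ∃ V : Set M, IsOpen V ∧ p ∈ V ∧ V ⊆ U ∧
    ∃ (k : ℕ) (X₁ X₂ : Fin k → ∀ x : M, TangentSpace 𝓘(ℝ, E) x),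
      (∀ a, IsSmoothFieldOn (X₁ a) V) ∧ (∀ a, IsSmoothFieldOn (X₂ a) V) ∧
      ∀ x ∈ V,
        (∀ s₁ s₂ : ℝ, (s₁, s₂) ≠ (0, 0) → ∀ α : TangentSpace 𝓘(ℝ, E) x →L[ℝ] ℝ,
          (∀ a, s₁ * α (X₁ a x) + s₂ * α (X₂ a x) = 0) ↔ ∀ v ∈ F (ratio s₁ s₂) x, α v = 0) ∧
        (∀ z₁ z₂ : ℂ, (z₁, z₂) ≠ (0, 0) → ∀ c : Fin k → ℂ,
          ∃ β : TangentSpace 𝓘(ℝ, E) x →L[ℝ] ℂ, ∀ a, z₁ * β (X₁ a x) + z₂ * β (X₂ a x) = c a)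

end Webs

/-- `ℝ⁴`; the coordinates `x₁, x₂, x₃, x₄` have the indices `0, 1, 2, 3`. -/
abbrev R4 := EuclideanSpace ℝ (Fin 4)

/-- `ℝ²`. -/
abbrev R2 := EuclideanSpace ℝ (Fin 2)

/-- A Kronecker web of 3-web type on a subset `U` of a 4-manifold: a Kronecker web consisting of
foliations of rank two (codimension two) in which `F_∞, F_0, F_1` form a 3-web, that is, are
pairwise transversal. -/
structure IsThreeWebTypeOn {M : Type*} [TopologicalSpace M] [ChartedSpace R4 M]
    [IsManifold 𝓘(ℝ, R4) ∞ M]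
    (F : OnePoint ℝ → ∀ x : M, Submodule ℝ (TangentSpace 𝓘(ℝ, R4) x)) (U : Set M) : Prop where
  kronecker : IsKroneckerWebOn 2 F U
  compl_infty_zero : ∀ x ∈ U, IsCompl (F OnePoint.infty x) (F ((0 : ℝ) : OnePoint ℝ) x)
  compl_infty_one : ∀ x ∈ U, IsCompl (F OnePoint.infty x) (F ((1 : ℝ) : OnePoint ℝ) x)
  compl_zero_one :
    ∀ x ∈ U, IsCompl (F ((0 : ℝ) : OnePoint ℝ) x) (F ((1 : ℝ) : OnePoint ℝ) x)

/-- The coordinate form `dx_j`. -/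
def dx (j : Fin 4) : R4 →L[ℝ] ℝ := EuclideanSpace.proj j

/-- The partial derivative `g_{x_j}`. -/
def pd (j : Fin 4) (g : R4 → ℝ) (x : R4) : ℝ := fderiv ℝ g x (EuclideanSpace.single j 1)

/-- `f^i_{x_j} f^{i'}_{x_k} - f^{i'}_{x_j} f^i_{x_k}`, where `i' = 1 - i` is the other index. -/
def minor (f : Fin 2 → R4 → ℝ) (i : Fin 2) (j k : Fin 4) (x : R4) : ℝ :=
  pd j (f i) x * pd k (f (1 - i)) x - pd j (f (1 - i)) x * pd k (f i) x

/-- The system of second order equations on the pair `f`, at the point `x`. -/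
def SolvesAt (f : Fin 2 → R4 → ℝ) (x : R4) : Prop :=
  ∀ i : Fin 2,
    pd 2 (pd 0 (f i)) x * minor f i 1 3 x - pd 3 (pd 0 (f i)) x * minor f i 1 2 x
      - pd 2 (pd 1 (f i)) x * minor f i 0 3 x + pd 3 (pd 1 (f i)) x * minor f i 0 2 x = 0

/-- The Jacobians `D(f¹, f²)/D(x₁, x₂)` and `D(f¹, f²)/D(x₃, x₄)` do not vanish at `x`. -/
def JacobiansAt (f : Fin 2 → R4 → ℝ) (x : R4) : Prop :=
  minor f 0 0 1 x ≠ 0 ∧ minor f 0 2 3 x ≠ 0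

/-- The form `ω^s_i = (s - lam₃)(f^i_{x₁} dx₁ + f^i_{x₂} dx₂) + (s - lam₁)(f^i_{x₃} dx₃ +
f^i_{x₄} dx₄)`; for `s = ∞` its leading coefficient in `s`. -/
def webForm (lam₁ lam₃ : ℝ) (f : Fin 2 → R4 → ℝ) (i : Fin 2) (s : OnePoint ℝ) (x : R4) :
    R4 →L[ℝ] ℝ :=
  match s with
  | OnePoint.infty =>
      (pd 0 (f i) x • dx 0 + pd 1 (f i) x • dx 1) + (pd 2 (f i) x • dx 2 + pd 3 (f i) x • dx 3)
  | OnePoint.some s =>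
      (s - lam₃) • (pd 0 (f i) x • dx 0 + pd 1 (f i) x • dx 1)
        + (s - lam₁) • (pd 2 (f i) x • dx 2 + pd 3 (f i) x • dx 3)

/-- The family of distributions `⟨ω^s_1, ω^s_2⟩^⊥`. -/
def formWeb (lam₁ lam₃ : ℝ) (f : Fin 2 → R4 → ℝ) (s : OnePoint ℝ) (x : R4) :
    Submodule ℝ (TangentSpace 𝓘(ℝ, R4) x) where
  carrier := {v | ∀ i, webForm lam₁ lam₃ f i s x v = 0}
  zero_mem' := fun i => map_zero (webForm lam₁ lam₃ f i s x)
  add_mem' := fun {v w} hv hw i =>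
    (map_add (webForm lam₁ lam₃ f i s x) v w).trans
      ((congrArg₂ (· + ·) (hv i) (hw i)).trans (add_zero 0))
  smul_mem' := fun c v hv i =>
    (map_smul (webForm lam₁ lam₃ f i s x) c v).trans
      ((congrArg (c • ·) (hv i)).trans (smul_zero c))

/-- At `x`: `F_{lam₁}` is `{x₁ = const, x₂ = const}` and `F_{lam₃}` is
`{x₃ = const, x₄ = const}`, for a family of distributions on `ℝ⁴`. -/
def StraightAt (lam₁ lam₃ : ℝ)
    (F : OnePoint ℝ → ∀ x : R4, Submodule ℝ (TangentSpace 𝓘(ℝ, R4) x)) (x : R4) : Prop :=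
  (∀ v : R4, v ∈ F (lam₁ : OnePoint ℝ) x ↔ dx 0 v = 0 ∧ dx 1 v = 0) ∧
  (∀ v : R4, v ∈ F (lam₃ : OnePoint ℝ) x ↔ dx 2 v = 0 ∧ dx 3 v = 0)

/-- At `x`: the foliation `F_∞` is `{f¹ = const, f² = const}`. -/
def InftyLevelAt (f : Fin 2 → R4 → ℝ)
    (F : OnePoint ℝ → ∀ x : R4, Submodule ℝ (TangentSpace 𝓘(ℝ, R4) x)) (x : R4) : Prop :=
  ∀ v : R4, v ∈ F OnePoint.infty x ↔ ∀ i, fderiv ℝ (f i) x v = 0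

/-- The differential of a function on a 4-manifold at a point, as a covector. -/
def covector {M : Type*} [TopologicalSpace M] [ChartedSpace R4 M] (g : M → ℝ) (x : M) :
    TangentSpace 𝓘(ℝ, R4) x →L[ℝ] ℝ :=
  mfderiv 𝓘(ℝ, R4) 𝓘(ℝ, ℝ) g x

/-- `f¹, f²` are independent smooth first integrals, on the open set `V`, of the foliation with
tangent distribution `D` (of codimension two). -/
def AreFirstIntegralsOn {M : Type*} [TopologicalSpace M] [ChartedSpace R4 M]
    (f : Fin 2 → M → ℝ) (D : ∀ x : M, Submodule ℝ (TangentSpace 𝓘(ℝ, R4) x)) (V : Set M) : Prop :=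
  (∀ i, ContMDiffOn 𝓘(ℝ, R4) 𝓘(ℝ, ℝ) ∞ (f i) V) ∧
  ∀ x ∈ V, (∀ i, ∀ v ∈ D x, covector (f i) x v = 0) ∧
    LinearIndependent ℝ (fun i => covector (f i) x)

/-- `(x₁, x₂)`. -/
def firstPair (x : R4) : R2 := !₂[x 0, x 1]

/-- `(x₃, x₄)`. -/
def lastPair (x : R4) : R2 := !₂[x 2, x 3]

/-- `(u₁, u₂, w₁, w₂)`. -/
def join (u w : R2) : R4 := !₂[u 0, u 1, w 0, w 1]

/-- `(f¹(x), f²(x))`. -/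
def values (f : Fin 2 → R4 → ℝ) (x : R4) : R2 := !₂[f 0 x, f 1 x]

/-- Equivalence of the germ of the pair `f` at `p` and the germ of the pair `g` at `p'`:
`f = ψ ∘ g ∘ (φ × ζ)` near `p`, for local diffeomorphisms `ψ, φ, ζ` of `ℝ²` with
`(φ × ζ)(p) = p'`. -/
def GermEquiv (f : Fin 2 → R4 → ℝ) (p : R4) (g : Fin 2 → R4 → ℝ) (p' : R4) : Prop :=
  ∃ ψ φ ζ : R2 → R2,
    IsLocalDiffeomorphAt 𝓘(ℝ, R2) 𝓘(ℝ, R2) ∞ ψ (values g p') ∧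
    IsLocalDiffeomorphAt 𝓘(ℝ, R2) 𝓘(ℝ, R2) ∞ φ (firstPair p) ∧
    IsLocalDiffeomorphAt 𝓘(ℝ, R2) 𝓘(ℝ, R2) ∞ ζ (lastPair p) ∧
    join (φ (firstPair p)) (ζ (lastPair p)) = p' ∧
    ∀ᶠ x in 𝓝 p, values f x = ψ (values g (join (φ (firstPair x)) (ζ (lastPair x))))

/-- A smooth solution of the system with nonvanishing Jacobians, near a point of `ℝ⁴`. -/
structure LocalSolution where
  U : Set R4
  isOpen : IsOpen U
  p : R4
  mem : p ∈ U
  f : Fin 2 → R4 → ℝ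
  smooth : ∀ i, ContDiffOn ℝ ∞ (f i) U
  solves : ∀ x ∈ U, SolvesAt f x
  jacobians : ∀ x ∈ U, JacobiansAt f x

/-- The equivalence relation on local solutions. -/
def LocalSolution.Equiv (σ τ : LocalSolution) : Prop := GermEquiv σ.f σ.p τ.f τ.p

/-- A Kronecker web of 3-web type near a point of `ℝ⁴`, with
`F_{lam₁} = {x₁ = const, x₂ = const}`, `F_{lam₃} = {x₃ = const, x₄ = const}` and
`F_∞ = {f¹ = const, f² = const}` for some smooth `f¹, f²`. -/
structure LocalWeb (lam₁ lam₃ : ℝ) where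
  U : Set R4
  isOpen : IsOpen U
  p : R4
  mem : p ∈ U
  F : OnePoint ℝ → ∀ x : R4, Submodule ℝ (TangentSpace 𝓘(ℝ, R4) x)
  threeWebType : IsThreeWebTypeOn F U
  straight : ∀ x ∈ U, StraightAt lam₁ lam₃ F x
  infty_level : ∃ f : Fin 2 → R4 → ℝ,
    (∀ i, ContDiffOn ℝ ∞ (f i) U) ∧ ∀ x ∈ U, InftyLevelAt f F x

/-- Two local webs are isomorphic if a local diffeomorphism of `ℝ⁴` carries, near the base points,
every foliation `F_s` of the first to the foliation `F_s` of the second. -/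
def LocalWeb.Iso {lam₁ lam₃ : ℝ} (W W' : LocalWeb lam₁ lam₃) : Prop :=
  ∃ Θ : R4 → R4, IsLocalDiffeomorphAt 𝓘(ℝ, R4) 𝓘(ℝ, R4) ∞ Θ W.p ∧ Θ W.p = W'.p ∧
    ∀ᶠ x in 𝓝 W.p, ∀ s, ∀ v : R4, v ∈ W.F s x ↔ fderiv ℝ Θ x v ∈ W'.F s (Θ x)

/-- Near the base point, the local web is the one defined by the forms of the local solution. -/
def LocalWeb.DefinedBy {lam₁ lam₃ : ℝ} (W : LocalWeb lam₁ lam₃) (σ : LocalSolution) : Prop :=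
  W.p = σ.p ∧ ∀ᶠ x in 𝓝 σ.p, ∀ s, W.F s x = formWeb lam₁ lam₃ σ.f s x

end KroneckerWeb

end

open KroneckerWeb

/-! Regard `f` as a map φ : ℝ² × ℝ² → ℝ² of x = (x₁, x₂) and y = (x₃, x₄). The distribution with
parameter s is the kernel of a φ_x dx + b φ_y dy, where a = s - λ₃ and b = s - λ₁, with a = b = 1 at
s = ∞. By (J) the block φ_y is invertible, so for b ≠ 0 the kernel is the graph of N = -(a/b) J with
J = φ_y⁻¹ φ_x. Differentiating the relation a φ_x + b φ_y N = 0 along the graph and antisymmetrising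
gives `dSnd_curvature`: b φ_y applied to the curvature equals (a - b)(φ_xy(ξ, Nη) - φ_xy(η, Nξ)).
Hence symmetry of φ_xy(ξ, Jη) in ξ and η makes every member integrable, and conversely it follows
from the integrability of a single member with a, b nonzero and distinct. The symmetry does not
involve s. Its defect is an alternating form on a plane, hence one vector equation, and Cramer's
rule identifies this equation with (H): `mixedSymmetricAt_pairMap_iff`.

Integrable distributions become foliations by a smooth Frobenius theorem for graphs,
`exists_firstIntegral`. The equation dY = N(x, Y) dx is integrated along rays from the origin; the
implicit function theorem in C([0, 1], F) gives smooth dependence on the end point and the initial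
value, and integrability shows that the radial solution satisfies the equation in all directions.

The rest of the web condition is linear algebra at a point. A form web is spanned by s₁X + s₂Y, with
X a frame at ∞ and Y obtained from X by scaling the two blocks by -λ₁ and -λ₃. Conversely, any
pencil with the Kronecker property has pairwise transversal members (`IsLinearWeb.disjoint`) and
lies in the form web built from its members at λ₁, λ₃ and ∞ (`IsLinearWeb.le_ker`). Combined in
`recognition`, this shows that three foliations determine the web and force (H) and (J).

For the classification, a web isomorphism preserves the foliations at λ₁, λ₃ and ∞, so it descends
to their local leaf spaces; the three induced maps are φ, ζ and ψ (`LocalSolution.equiv_of_iso`). In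
the other direction φ × ζ is itself the isomorphism. -/

noncomputable section

namespace KroneckerWeb

/-! ### Inverse functions and smooth cut-off -/

section InverseFunction

variable {E F : Type*} [NormedAddCommGroup E] [NormedSpace ℝ E] [NormedAddCommGroup F]
  [NormedSpace ℝ F]

/-- The inverse function theorem, with smoothness of the inverse on its whole domain. -/
theorem exists_openPartialHomeomorph_contDiffOn_symm [CompleteSpace E] {f : E → F} {V : Set E}
    (hV : IsOpen V) (hf : ContDiffOn ℝ ∞ f V) {a : E} (ha : a ∈ V) (f' : E ≃L[ℝ] F)
    (hf' : HasFDerivAt f (f' : E →L[ℝ] F) a) :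
    ∃ e : OpenPartialHomeomorph E F, a ∈ e.source ∧ e.source ⊆ V ∧ ⇑e = f ∧
      ContDiffOn ℝ ∞ e.symm e.target ∧
      ∀ x ∈ e.source, ∃ g : E ≃L[ℝ] F, HasFDerivAt f (g : E →L[ℝ] F) x := by
  have hat : ∀ x ∈ V, ContDiffAt ℝ ∞ f x := fun x hx => hf.contDiffAt (hV.mem_nhds hx)
  let e₀ := (hat a ha).toOpenPartialHomeomorph f hf' (by simp)
  -- Invertible operators form an open set, so the local inverse can be restricted to the points
  -- where the derivative stays invertible; there the inverse is smooth at every point of its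
  -- domain.
  let S : Set E := {x ∈ V | fderiv ℝ f x ∈ Set.range ((↑) : (E ≃L[ℝ] F) → E →L[ℝ] F)}
  have hS : IsOpen S :=
    (hf.continuousOn_fderiv_of_isOpen hV (by simp)).isOpen_inter_preimage hV
      (ContinuousLinearEquiv.isOpen (𝕜 := ℝ) (E := E) (F := F))
  have haS : a ∈ S := ⟨ha, f', hf'.fderiv.symm⟩
  have hd : ∀ x ∈ S, ∃ g : E ≃L[ℝ] F, HasFDerivAt f (g : E →L[ℝ] F) x := by
    rintro x ⟨hxV, g, hg⟩
    exact ⟨g, by rw [hg]; exact ((hat x hxV).differentiableAt (by simp)).hasFDerivAt⟩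
  let e := e₀.restrOpen S hS
  have hes : e.source = e₀.source ∩ S := e₀.restrOpen_source S hS
  refine ⟨e, ?_, ?_, rfl, ?_, ?_⟩
  · rw [hes]
    exact ⟨(hat a ha).mem_toOpenPartialHomeomorph_source hf' (by simp), haS⟩
  · rw [hes]
    exact fun x hx => hx.2.1
  · intro y hy
    have hx : e.symm y ∈ S := by
      have := e.map_target hy
      rw [hes] at this
      exact this.2
    obtain ⟨g, hg⟩ := hd _ hx
    exact (e.contDiffAt_symm hy hg (hat _ hx.1)).contDiffWithinAt
  · rw [hes]
    exact fun x hx => hd x hx.2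

/-- A function smooth near a point agrees near the point with a globally smooth function. -/
theorem exists_contDiff_eventuallyEq [FiniteDimensional ℝ E] {f : E → F} {V : Set E}
    (hV : IsOpen V) (hf : ContDiffOn ℝ ∞ f V) {a : E} (ha : a ∈ V) :
    ∃ g : E → F, ContDiff ℝ ∞ g ∧ g =ᶠ[𝓝 a] f := by
  obtain ⟨r, hr, hrV⟩ := Metric.nhds_basis_closedBall.mem_iff.1 (hV.mem_nhds ha)
  let χ : ContDiffBump a := ⟨r / 2, r, by positivity, by linarith⟩
  refine ⟨fun x => χ x • f x, contDiff_iff_contDiffAt.2 fun x => ?_, ?_⟩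
  · by_cases hx : x ∈ Metric.closedBall a r
    · exact χ.contDiffAt.smul (hf.contDiffAt (hV.mem_nhds (hrV hx)))
    · have : (fun x => χ x • f x) =ᶠ[𝓝 x] fun _ => 0 := by
        filter_upwards [Metric.isClosed_closedBall.isOpen_compl.mem_nhds hx] with y hy
        rw [χ.zero_of_le_dist (le_of_lt (by simpa using hy)), zero_smul]
      exact contDiffAt_const.congr_of_eventuallyEq this
  · filter_upwards [χ.eventuallyEq_one] with x hx
    rw [hx, Pi.one_apply, one_smul]

end InverseFunction

/-! ### Superposition operators on spaces of continuous functions -/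

section Nemytskii

variable {K : Type*} [TopologicalSpace K] [CompactSpace K]

/-- The operator `u ↦ g ∘ u` on continuous functions. -/
def superposition {F G : Type*} [TopologicalSpace F] [TopologicalSpace G] (g : C(F, G)) :
    C(K, F) → C(K, G) := fun u => g.comp u

/-- Pointwise application of a continuous family of operators to a continuous function. -/
def pointwiseApply (K F G : Type*) [TopologicalSpace K] [CompactSpace K]
    [NormedAddCommGroup F] [NormedSpace ℝ F] [NormedAddCommGroup G] [NormedSpace ℝ G] :
    C(K, F →L[ℝ] G) →L[ℝ] C(K, F) →L[ℝ] C(K, G) :=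
  LinearMap.mkContinuous₂
    (LinearMap.mk₂ ℝ
      (fun (T : C(K, F →L[ℝ] G)) (u : C(K, F)) => (⟨fun s => T s (u s), by fun_prop⟩ : C(K, G)))
      (fun T T' u => by ext s; simp) (fun c T u => by ext s; simp)
      (fun T u u' => by ext s; simp) (fun c T u => by ext s; simp)) 1
    (fun T u => by
      rw [one_mul]
      refine (ContinuousMap.norm_le _ (by positivity)).2 fun s => ?_
      exact (T s).le_of_opNorm_le_of_le (T.norm_coe_le_norm s) (u.norm_coe_le_norm s))

universe v

/-- The mean value inequality is applied at each point of `K`, with a radius that does not depend on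
the point: compactness makes `u ↦ g' ∘ u` continuous in the supremum norm. -/
theorem hasFDerivAt_superposition {F G : Type*} [NormedAddCommGroup F] [NormedSpace ℝ F]
    [NormedAddCommGroup G] [NormedSpace ℝ G] (g : C(F, G)) (g' : C(F, F →L[ℝ] G))
    (hg : ∀ y, HasFDerivAt g (g' y) y) (u : C(K, F)) :
    HasFDerivAt (superposition (K := K) g) (pointwiseApply K F G (superposition g' u)) u := by
  have hcont : Continuous (superposition (K := K) g') := ContinuousMap.continuous_postcomp g'
  rw [hasFDerivAt_iff_isLittleO, Asymptotics.isLittleO_iff]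
  intro ε hε
  obtain ⟨δ, hδ, hball⟩ := (Metric.continuousAt_iff (f := superposition (K := K) g') (a := u)).1
    hcont.continuousAt ε hε
  filter_upwards [Metric.ball_mem_nhds u hδ] with v hv
  refine (ContinuousMap.norm_le _ (by positivity)).2 fun s => ?_
  have key : ‖g (v s) - g (u s) - g' (u s) (v s - u s)‖ ≤ ε * ‖v s - u s‖ := by
    refine (convex_ball (u s) δ).norm_image_sub_le_of_norm_hasFDerivWithin_le' (f' := g')
      (fun z _ => (hg z).hasFDerivWithinAt) (fun z hz => ?_) (Metric.mem_ball_self hδ) ?_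
    · have hd : dist (u + ContinuousMap.const K (z - u s)) u < δ := by
        rw [dist_eq_norm, add_sub_cancel_left]
        rw [Metric.mem_ball, dist_eq_norm] at hz
        refine lt_of_le_of_lt ((ContinuousMap.norm_le _ (norm_nonneg _)).2 fun _ => ?_) hz
        simp
      have := (ContinuousMap.dist_apply_le_dist s).trans (hball hd).le
      simpa [superposition, dist_eq_norm] using this
    · exact Metric.mem_ball.2 ((ContinuousMap.dist_apply_le_dist s).trans_lt hv)
  refine key.trans ?_
  gcongr
  exact (v - u).norm_coe_le_norm s

/-- The derivative is again a superposition operator, for `fderiv ℝ g`, followed by a continuous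
linear map, so induction on the order works. Both spaces lie in one universe because the induction
replaces `G` by `F →L[ℝ] G`. -/
theorem contDiff_nat_superposition (n : ℕ) : ∀ {F G : Type v} [NormedAddCommGroup F]
    [NormedSpace ℝ F] [NormedAddCommGroup G] [NormedSpace ℝ G] (g : C(F, G)),
    ContDiff ℝ ∞ g → ContDiff ℝ n (superposition (K := K) g) := by
  induction n with
  | zero =>
    intro F G _ _ _ _ g _
    exact contDiff_zero.2 (ContinuousMap.continuous_postcomp g)
  | succ n ih =>
    intro F G _ _ _ _ g hg
    have hg' : ContDiff ℝ ∞ (fderiv ℝ g) := hg.fderiv_right (by simp)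
    let g' : C(F, F →L[ℝ] G) := ⟨fderiv ℝ g, hg'.continuous⟩
    have hd := hasFDerivAt_superposition (K := K) g g'
      (fun y => (hg.differentiable (by simp) y).hasFDerivAt)
    rw [Nat.cast_succ, contDiff_succ_iff_fderiv]
    refine ⟨fun u => (hd u).differentiableAt, by simp, ?_⟩
    have : fderiv ℝ (superposition (K := K) g)
        = fun u => pointwiseApply K F G (superposition g' u) := funext fun u => (hd u).fderiv
    rw [this]
    exact (pointwiseApply K F G).contDiff.comp (ih g' hg')

theorem contDiff_superposition {F G : Type v} [NormedAddCommGroup F]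
    [NormedSpace ℝ F] [NormedAddCommGroup G] [NormedSpace ℝ G] (g : C(F, G))
    (hg : ContDiff ℝ ∞ g) : ContDiff ℝ ∞ (superposition (K := K) g) :=
  contDiff_infty.2 fun n => contDiff_nat_superposition n g hg

end Nemytskii

/-! ### The integration operator on [0, 1] -/

section Volterra

open unitInterval

variable {F : Type*} [NormedAddCommGroup F]

/-- Extension of a function on `[0, 1]` to the real line by its values at the end points. -/
def extend (u : C(I, F)) (t : ℝ) : F := u (Set.projIcc 0 1 zero_le_one t)

theorem continuous_extend (u : C(I, F)) : Continuous (extend u) :=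
  u.continuous.comp continuous_projIcc

theorem extend_coe (u : C(I, F)) (t : I) : extend u t = u t := by
  simp [extend, Set.projIcc_val]

/-- The operator `u ↦ (t ↦ ∫₀ᵗ u)` on continuous functions on `[0, 1]`. -/
def volterra (F : Type*) [NormedAddCommGroup F] [NormedSpace ℝ F] : C(I, F) →L[ℝ] C(I, F) :=
  LinearMap.mkContinuous
    { toFun := fun u => ⟨fun t => ∫ s in (0 : ℝ)..t, extend u s,
        (intervalIntegral.continuous_primitive
          (fun a b => (continuous_extend u).intervalIntegrable a b) 0).comp continuous_subtype_val⟩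
      map_add' := fun u w => by
        ext t
        exact intervalIntegral.integral_add ((continuous_extend u).intervalIntegrable _ _)
          ((continuous_extend w).intervalIntegrable _ _)
      map_smul' := fun c u => by
        ext t
        exact intervalIntegral.integral_smul c (extend u) } 1
    (fun u => by
      rw [one_mul]
      refine (ContinuousMap.norm_le _ (norm_nonneg _)).2 fun t => ?_
      refine (intervalIntegral.norm_integral_le_of_norm_le_const (C := ‖u‖)
        fun s _ => u.norm_coe_le_norm _).trans ?_
      rw [sub_zero, abs_of_nonneg t.2.1]
      exact mul_le_of_le_one_right (norm_nonneg _) t.2.2)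

end Volterra

/-! ### The equation u' = N(tx, u) x along rays -/

section Radial

open unitInterval Filter

universe v

variable {E F : Type v} [NormedAddCommGroup E] [NormedSpace ℝ E] [NormedAddCommGroup F]
  [NormedSpace ℝ F]

/-- Constant functions, as a continuous linear map. -/
def constCLM (F : Type*) [NormedAddCommGroup F] [NormedSpace ℝ F] : F →L[ℝ] C(I, F) :=
  LinearMap.mkContinuous
    { toFun := fun y => ContinuousMap.const I y
      map_add' := fun _ _ => rfl
      map_smul' := fun _ _ => rfl } 1
    (fun y => by
      rw [one_mul]
      exact (ContinuousMap.norm_le _ (norm_nonneg _)).2 fun _ => le_rfl)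

@[simp]
theorem constCLM_apply (y : F) (t : I) : constCLM F y t = y := rfl

/-- The linear map `(x, u) ↦ (s ↦ ((x, s x), u s))`. -/
def rayCLM (E F : Type*) [NormedAddCommGroup E] [NormedSpace ℝ E] [NormedAddCommGroup F]
    [NormedSpace ℝ F] : E × C(I, F) →L[ℝ] C(I, (E × E) × F) :=
  LinearMap.mkContinuous
    { toFun := fun q => ⟨fun s => ((q.1, (s : ℝ) • q.1), q.2 s), by fun_prop⟩
      map_add' := fun q r => by ext s <;> simp
      map_smul' := fun c q => by ext s <;> simp [smul_smul, mul_comm] } 1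
    (fun q => by
      rw [one_mul]
      refine (ContinuousMap.norm_le _ (norm_nonneg _)).2 fun s => ?_
      refine max_le (max_le (norm_fst_le q) ?_) ((q.2.norm_coe_le_norm s).trans (norm_snd_le q))
      refine le_trans ?_ (norm_fst_le q)
      change ‖(s : ℝ) • q.1‖ ≤ ‖q.1‖
      rw [norm_smul, Real.norm_of_nonneg s.2.1]
      exact mul_le_of_le_one_left (norm_nonneg _) s.2.2)

@[simp]
theorem rayCLM_apply (q : E × C(I, F)) (s : I) :
    rayCLM E F q s = ((q.1, (s : ℝ) • q.1), q.2 s) := rfl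

/-- The right-hand side `N (s x, u) x` of the radial equation, as a function of `((x, s x), u)`. -/
def radialField (N : E × F → E →L[ℝ] F) (q : (E × E) × F) : F := N (q.1.2, q.2) q.1.1

theorem contDiff_radialField {N : E × F → E →L[ℝ] F} (hN : ContDiff ℝ ∞ N) :
    ContDiff ℝ ∞ (radialField N) := by
  unfold radialField
  fun_prop

theorem hasFDerivAt_radialField {N : E × F → E →L[ℝ] F} (hN : ContDiff ℝ ∞ N)
    (q : (E × E) × F) (w : (E × E) × F) :
    fderiv ℝ (radialField N) q w
      = N (q.1.2, q.2) w.1.1 + fderiv ℝ N (q.1.2, q.2) (w.1.2, w.2) q.1.1 := by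
  have h1 : HasFDerivAt N (fderiv ℝ N (q.1.2, q.2)) (q.1.2, q.2) :=
    (hN.differentiable (by simp) _).hasFDerivAt
  have h2 : HasFDerivAt (fun q : (E × E) × F => (q.1.2, q.2))
      (((ContinuousLinearMap.snd ℝ E E).comp (ContinuousLinearMap.fst ℝ (E × E) F)).prod
        (ContinuousLinearMap.snd ℝ (E × E) F)) q :=
    (((ContinuousLinearMap.snd ℝ E E).comp (ContinuousLinearMap.fst ℝ (E × E) F)).prod
      (ContinuousLinearMap.snd ℝ (E × E) F)).hasFDerivAt
  have h3 : HasFDerivAt (fun q : (E × E) × F => q.1.1)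
      ((ContinuousLinearMap.fst ℝ E E).comp (ContinuousLinearMap.fst ℝ (E × E) F)) q :=
    ((ContinuousLinearMap.fst ℝ E E).comp (ContinuousLinearMap.fst ℝ (E × E) F)).hasFDerivAt
  have := ((h1.comp q h2).clm_apply h3).fderiv
  unfold radialField
  simp only [Function.comp_def] at this
  rw [this]
  simp

/-- The integral operator of the radial equation. -/
def radialIntegral (N : E × F → E →L[ℝ] F) (hN : ContDiff ℝ ∞ N) (q : E × C(I, F)) : C(I, F) :=
  volterra F (superposition ⟨radialField N, (contDiff_radialField hN).continuous⟩ (rayCLM E F q))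

theorem contDiff_radialIntegral (N : E × F → E →L[ℝ] F) (hN : ContDiff ℝ ∞ N) :
    ContDiff ℝ ∞ (radialIntegral N hN) :=
  (volterra F).contDiff.comp
    ((contDiff_superposition (K := I) (F := (E × E) × F) (G := F)
      ⟨radialField N, (contDiff_radialField hN).continuous⟩
      (contDiff_radialField hN)).comp (rayCLM E F).contDiff)

/-- The right-hand side is linear in the ray direction. This makes the partial derivative of the
integral equation in the unknown function the identity at x = 0. -/
theorem radialIntegral_zero (N : E × F → E →L[ℝ] F) (hN : ContDiff ℝ ∞ N) (u : C(I, F)) :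
    radialIntegral N hN (0, u) = 0 := by
  have : superposition (K := I) ⟨radialField N, (contDiff_radialField hN).continuous⟩
      (rayCLM E F (0, u)) = 0 := by
    ext s
    simp [superposition, radialField]
  rw [radialIntegral, this, map_zero]

/-- At x = 0 the solutions are constant, hence exist on all of [0, 1]; the implicit function theorem
for the integral equation in C([0, 1], F) continues them to small x, smoothly in x and in the
initial value. -/
theorem exists_radial_solution [CompleteSpace E] [CompleteSpace F] (N : E × F → E →L[ℝ] F)
    (hN : ContDiff ℝ ∞ N) (y₀ : F) :
    ∃ (u : E × F → C(I, F)) (S : Set (E × F)), IsOpen S ∧ ((0 : E), y₀) ∈ S ∧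
      ContDiffOn ℝ ∞ u S ∧ u (0, y₀) = constCLM F y₀ ∧
      ∀ p ∈ S, u p = constCLM F p.2 + radialIntegral N hN (p.1, u p) := by
  let f : (E × F) × C(I, F) → C(I, F) :=
    fun q => q.2 - constCLM F q.1.2 - radialIntegral N hN (q.1.1, q.2)
  have hf : ContDiff ℝ ∞ f := by
    have h1 := contDiff_radialIntegral N hN
    have h2 := (constCLM F).contDiff (n := ∞)
    fun_prop
  let q₀ : (E × F) × C(I, F) := ((0, y₀), constCLM F y₀)
  have hq₀ : f q₀ = 0 := by simp [f, q₀, radialIntegral_zero]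
  have h1 : HasFDerivAt f (fderiv ℝ f q₀) q₀ := (hf.differentiable (by simp) q₀).hasFDerivAt
  have hinr : ∀ w : C(I, F), fderiv ℝ f q₀ (0, w) = w := by
    have h2 : HasFDerivAt (fun u : C(I, F) => ((((0 : E), y₀), u) : (E × F) × C(I, F)))
        (.inr ℝ (E × F) C(I, F)) (constCLM F y₀) := hasFDerivAt_prodMk_right _ _
    have h3 := HasFDerivAt.comp (constCLM F y₀) h1 h2
    have h4 : (f ∘ fun u : C(I, F) => ((((0 : E), y₀), u) : (E × F) × C(I, F)))
        = fun u => u - constCLM F y₀ := by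
      funext u
      simp [f, radialIntegral_zero]
    rw [h4] at h3
    exact fun w => DFunLike.congr_fun (h3.unique ((hasFDerivAt_id _).sub_const _)) w
  have hsplit : ∀ q : (E × F) × C(I, F), fderiv ℝ f q₀ q = fderiv ℝ f q₀ (q.1, 0) + q.2 := by
    intro q
    nth_rewrite 1 [← hinr q.2, ← map_add]
    simp
  -- Since the partial derivative in the unknown is the identity, the full derivative is a shear,
  -- inverted explicitly by subtracting the contribution of the parameters.
  let A : ((E × F) × C(I, F)) ≃L[ℝ] (E × F) × C(I, F) :=
    ContinuousLinearEquiv.equivOfInverse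
      ((ContinuousLinearMap.fst ℝ _ _).prod (fderiv ℝ f q₀))
      ((ContinuousLinearMap.fst ℝ _ _).prod (ContinuousLinearMap.snd ℝ _ _ -
        (fderiv ℝ f q₀).comp ((ContinuousLinearMap.inl ℝ _ _).comp (ContinuousLinearMap.fst ℝ _ _))))
      (fun q => by
        refine Prod.ext rfl ?_
        exact sub_eq_of_eq_add' (hsplit q))
      (fun q => by
        refine Prod.ext rfl ?_
        exact (hsplit _).trans (add_sub_cancel _ _))
  obtain ⟨e, he₀, -, he, hsymm, -⟩ := exists_openPartialHomeomorph_contDiffOn_symm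
    (f := fun q : (E × F) × C(I, F) => (q.1, f q)) isOpen_univ
    (contDiff_fst.prodMk hf).contDiffOn (Set.mem_univ q₀) A (hasFDerivAt_fst.prodMk h1)
  have heq₀ : e q₀ = ((0, y₀), 0) := by rw [he]; exact Prod.ext rfl hq₀
  have hcont : ContDiff ℝ ∞ fun p : E × F => (p, (0 : C(I, F))) := contDiff_prodMk_left 0
  refine ⟨fun p => (e.symm (p, 0)).2, (fun p => (p, 0)) ⁻¹' e.target,
    e.open_target.preimage hcont.continuous, ?_, ?_, ?_, ?_⟩
  · change ((0, y₀), (0 : C(I, F))) ∈ e.target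
    rw [← heq₀]
    exact e.map_source he₀
  · exact contDiff_snd.comp_contDiffOn (hsymm.comp hcont.contDiffOn fun p hp => hp)
  · change (e.symm ((0, y₀), 0)).2 = _
    rw [← heq₀, e.left_inv he₀]
  · intro p hp
    have h := e.right_inv hp
    rw [he] at h
    have h₁ : (e.symm (p, 0)).1 = p := congrArg Prod.fst h
    have h₂ : f (e.symm (p, 0)) = 0 := congrArg Prod.snd h
    simp only [f, h₁] at h₂
    rw [sub_sub, sub_eq_zero] at h₂
    exact h₂

theorem hasDerivAt_integral_extend [CompleteSpace F] (k : C(I, F)) (t : ℝ) :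
    HasDerivAt (fun t => ∫ s in (0 : ℝ)..t, extend k s) (extend k t) t :=
  intervalIntegral.integral_hasDerivAt_right ((continuous_extend k).intervalIntegrable _ _)
    ((continuous_extend k).stronglyMeasurableAtFilter _ _) (continuous_extend k).continuousAt

/-- The variation of the radial solution in the direction ξ is the one prescribed by the total
differential equation, with a factor t because the end point of the ray up to time t moves by tξ.
The difference of the two solves a homogeneous linear equation from zero initial data. -/
theorem fderiv_radial_solution [CompleteSpace F] {N : E × F → E →L[ℝ] F}
    (hN : ContDiff ℝ ∞ N) {u : E × F → C(I, F)} {p : E × F} (hu : DifferentiableAt ℝ u p)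
    (heq : ∀ᶠ q in 𝓝 p, u q = constCLM F q.2 + radialIntegral N hN (q.1, u q))
    (hint : ∀ (t : I) (ξ η : E),
      fderiv ℝ N ((t : ℝ) • p.1, u p t) (ξ, N ((t : ℝ) • p.1, u p t) ξ) η
        = fderiv ℝ N ((t : ℝ) • p.1, u p t) (η, N ((t : ℝ) • p.1, u p t) η) ξ)
    (ξ : E) (t : I) :
    fderiv ℝ u p (ξ, 0) t = (t : ℝ) • N ((t : ℝ) • p.1, u p t) ξ := by
  set W : C(I, F) := fderiv ℝ u p (ξ, 0) with hW
  let g : C((E × E) × F, F) := ⟨radialField N, (contDiff_radialField hN).continuous⟩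
  let g' : C((E × E) × F, (E × E) × F →L[ℝ] F) :=
    ⟨fderiv ℝ (radialField N), ((contDiff_radialField hN).continuous_fderiv (by simp))⟩
  let k : C(I, F) := superposition g (rayCLM E F (p.1, u p))
  let l : C(I, F) := pointwiseApply I _ _ (superposition g' (rayCLM E F (p.1, u p)))
    (rayCLM E F (ξ, W))
  have hWeq : W = volterra F l := by
    have h1 : HasFDerivAt u (fderiv ℝ u p) p := hu.hasFDerivAt
    have h2 : HasFDerivAt (fun q : E × F => (q.1, u q))
        ((ContinuousLinearMap.fst ℝ E F).prod (fderiv ℝ u p)) p :=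
      hasFDerivAt_fst.prodMk h1
    have h3 := (rayCLM E F).hasFDerivAt.comp p h2
    have h4 := (hasFDerivAt_superposition (K := I) g g'
      (fun y => ((contDiff_radialField hN).differentiable (by simp) y).hasFDerivAt)
      (rayCLM E F (p.1, u p))).comp p h3
    have h5 := (volterra F).hasFDerivAt.comp p h4
    have h6 := ((constCLM F).hasFDerivAt.comp p hasFDerivAt_snd).add h5
    have h7 := (h1.congr_of_eventuallyEq (EventuallyEq.symm heq)).unique h6
    rw [hW, h7]
    simp [l, hW]
  have hUeq : u p = constCLM F p.2 + volterra F k := heq.self_of_nhds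
  let U : ℝ → F := fun t => p.2 + ∫ s in (0 : ℝ)..t, extend k s
  let V : ℝ → F := fun t => ∫ s in (0 : ℝ)..t, extend l s
  have hU : ∀ t, HasDerivAt U (extend k t) t := fun t =>
    (hasDerivAt_integral_extend k t).const_add _
  have hV : ∀ t, HasDerivAt V (extend l t) t := fun t => hasDerivAt_integral_extend l t
  have hUI : ∀ t : I, U t = u p t := fun t => by rw [hUeq]; rfl
  have hVI : ∀ t : I, V t = W t := fun t => by rw [hWeq]; rfl
  -- `Z` is the defect. The linearised integral equation gives `V'`, and `hint` exchanges ξ with the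
  -- ray direction, so that all terms of `Z'` cancel except the one linear in `Z`.
  let Z : ℝ → F := fun t => V t - t • N (t • p.1, U t) ξ
  let Z' : ℝ → F := fun t => extend l t - (t • fderiv ℝ N (t • p.1, U t) (p.1, extend k t) ξ
    + N (t • p.1, U t) ξ)
  have hZ : ∀ t, HasDerivAt Z (Z' t) t := by
    intro t
    have h1 : HasDerivAt (fun t : ℝ => (t • p.1, U t)) (p.1, extend k t) t := by
      have := (hasDerivAt_id t).smul_const p.1
      rw [one_smul] at this
      exact this.prodMk (hU t)
    have h2 := ((hN.differentiable (by simp) (t • p.1, U t)).hasFDerivAt).comp_hasDerivAt t h1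
    have h3 := h2.clm_apply (hasDerivAt_const t ξ)
    have h4 := (hV t).sub ((hasDerivAt_id t).smul h3)
    convert! h4 using 1
    simp [Z']
  have hZ'I : ∀ t : I, Z' t = fderiv ℝ N ((t : ℝ) • p.1, U t) (0, Z t) p.1 := by
    intro t
    have hl : extend l t = N ((t : ℝ) • p.1, U t) ξ
        + fderiv ℝ N ((t : ℝ) • p.1, U t) ((t : ℝ) • ξ, V t) p.1 := by
      rw [extend_coe, hUI, hVI]
      change fderiv ℝ (radialField N) (rayCLM E F (p.1, u p) t) (rayCLM E F (ξ, W) t) = _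
      rw [hasFDerivAt_radialField hN]
      rfl
    have hk : extend k t = N ((t : ℝ) • p.1, U t) p.1 := by
      rw [extend_coe, hUI]
      rfl
    have hi := hint t ξ p.1
    rw [← hUI] at hi
    have hsplit : ((0 : E), Z t) = ((t : ℝ) • ξ, V t)
        - (t : ℝ) • (ξ, N ((t : ℝ) • p.1, U t) ξ) := by
      simp [Z]
    rw [hsplit, map_sub, map_smul]
    simp only [Z', hl, hk, sub_apply, smul_apply, hi]
    abel
  have hcont : Continuous fun t : ℝ => fderiv ℝ N (t • p.1, U t) := by
    have : Continuous U := continuous_iff_continuousAt.2 fun t => (hU t).continuousAt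
    exact (hN.continuous_fderiv (by simp)).comp (by fun_prop)
  have hnorm : Continuous fun t : ℝ => ‖fderiv ℝ N (t • p.1, U t)‖ :=
    Continuous.norm (E := E × F →L[ℝ] E →L[ℝ] F) hcont
  obtain ⟨C, hC⟩ := isCompact_Icc.exists_bound_of_continuousOn
    (s := Set.Icc (0 : ℝ) 1) hnorm.continuousOn
  -- Grönwall's inequality, where `C` bounds the derivative of `N` along the compact ray and `‖p.1‖`
  -- is the length of the direction in which that derivative is evaluated.
  have hZ0 : ∀ t ∈ Set.Icc (0 : ℝ) 1, Z t = 0 := by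
    refine eq_zero_of_abs_deriv_le_mul_abs_self_of_eq_zero_right (f' := Z') (K := C * ‖p.1‖)
      (fun t _ => (hZ t).continuousAt.continuousWithinAt)
      (fun t _ => (hZ t).hasDerivWithinAt) (by simp [Z, V]) fun t ht => ?_
    rw [hZ'I ⟨t, ht.1, ht.2.le⟩]
    have h1 := (Real.le_norm_self _).trans (hC t ⟨ht.1, ht.2.le⟩)
    have h2 : ‖((0 : E), Z t)‖ = ‖Z t‖ := by simp [Prod.norm_def]
    have h3 := (fderiv ℝ N (t • p.1, U t)).le_of_opNorm_le h1 (0, Z t)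
    rw [h2] at h3
    refine (ContinuousLinearMap.le_of_opNorm_le _ h3 p.1).trans_eq ?_
    ring
  have := hZ0 t t.2
  rw [← hVI, ← hUI]
  exact sub_eq_zero.1 this

end Radial

/-! ### Frobenius' theorem for graph distributions -/

section Frobenius

open unitInterval Filter

universe v

variable {E F : Type v} [NormedAddCommGroup E] [NormedSpace ℝ E] [CompleteSpace E]
  [NormedAddCommGroup F] [NormedSpace ℝ F] [CompleteSpace F]

/-- Integrability at `z` of the distribution `v.2 = N z v.1`. -/
def GraphIntegrableAt (N : E × F → E →L[ℝ] F) (z : E × F) : Prop :=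
  ∀ ξ η : E, fderiv ℝ N z (ξ, N z ξ) η = fderiv ℝ N z (η, N z η) ξ

/-- The total differential equation `∂Y/∂x = N (x, Y)`, `Y (0, y) = y`, has a smooth solution. -/
theorem exists_total_solution {N : E × F → E →L[ℝ] F} (hN : ContDiff ℝ ∞ N) (y₀ : F)
    (hint : ∀ᶠ z in 𝓝 ((0 : E), y₀), GraphIntegrableAt N z) :
    ∃ (Y : E × F → F) (S : Set (E × F)), IsOpen S ∧ ((0 : E), y₀) ∈ S ∧ ContDiffOn ℝ ∞ Y S ∧
      Y (0, y₀) = y₀ ∧ (∀ p ∈ S, ∀ ξ, fderiv ℝ Y p (ξ, 0) = N (p.1, Y p) ξ) ∧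
      ∀ η, fderiv ℝ Y (0, y₀) (0, η) = η := by
  obtain ⟨u, S, hS, h0S, hu, hu0, heq⟩ := exists_radial_solution N hN y₀
  obtain ⟨δ, hδ, hball⟩ := Metric.eventually_nhds_iff.1 hint
  -- Integrability is known only within `δ` of the base point; these conditions keep the entire
  -- curve t ↦ (tx, u(t)) there.
  let T : Set (E × F) := (S ∩ u ⁻¹' Metric.ball (constCLM F y₀) δ) ∩ Prod.fst ⁻¹' Metric.ball 0 δ
  have hT : IsOpen T := (hu.continuousOn.isOpen_inter_preimage hS Metric.isOpen_ball).inter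
    (Metric.isOpen_ball.preimage continuous_fst)
  have h0T : ((0 : E), y₀) ∈ T :=
    ⟨⟨h0S, by rw [Set.mem_preimage, hu0]; exact Metric.mem_ball_self hδ⟩, Metric.mem_ball_self hδ⟩
  have hud : ∀ p ∈ S, DifferentiableAt ℝ u p := fun p hp =>
    (hu.contDiffAt (hS.mem_nhds hp)).differentiableAt (by simp)
  -- The solution at the point x is the value at time 1 of the solution along the ray to x.
  let ev : C(I, F) →L[ℝ] F := ContinuousMap.evalCLM ℝ (1 : I)
  have hYd : ∀ p ∈ S, HasFDerivAt (fun p => ev (u p)) (ev.comp (fderiv ℝ u p)) p := fun p hp =>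
    ev.hasFDerivAt.comp p (hud p hp).hasFDerivAt
  refine ⟨fun p => ev (u p), T, hT, h0T, ?_, ?_, ?_, ?_⟩
  · exact ev.contDiff.comp_contDiffOn (hu.mono fun p hp => hp.1.1)
  · simp only [hu0]
    rfl
  · intro p hp ξ
    rw [(hYd p hp.1.1).fderiv]
    have h := fderiv_radial_solution hN (hud p hp.1.1)
      (Filter.eventually_of_mem (hS.mem_nhds hp.1.1) heq) (fun t => hball ?_) ξ 1
    · change fderiv ℝ u p (ξ, 0) 1 = _
      rw [h]
      simp [ev]
    · have h1 : dist (u p t) y₀ < δ := lt_of_le_of_lt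
        (ContinuousMap.dist_apply_le_dist (f := u p) (g := constCLM F y₀) t) hp.1.2
      have h2 : ‖p.1‖ < δ := by simpa using hp.2
      refine max_lt ?_ h1
      change dist ((t : ℝ) • p.1) 0 < δ
      rw [dist_zero_right, norm_smul, Real.norm_of_nonneg t.2.1]
      exact (mul_le_of_le_one_left (norm_nonneg _) t.2.2).trans_lt h2
  · intro η
    have h1 := (hYd _ h0S).comp y₀ (hasFDerivAt_prodMk_right (𝕜 := ℝ) (0 : E) y₀)
    have h2 : ((fun p => ev (u p)) ∘ fun y : F => ((0 : E), y)) =ᶠ[𝓝 y₀] id := by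
      have hc : Tendsto (fun y : F => ((0 : E), y)) (𝓝 y₀) (𝓝 (0, y₀)) :=
        (Continuous.prodMk_right (0 : E)).tendsto y₀
      filter_upwards [hc (hS.mem_nhds h0S)] with y hy
      have := heq _ hy
      rw [radialIntegral_zero, add_zero] at this
      simp [this, ev]
    rw [(hYd _ h0S).fderiv]
    exact DFunLike.congr_fun (h1.unique ((hasFDerivAt_id y₀).congr_of_eventuallyEq h2)) η

/-- The leaves are the graphs of x ↦ Y(x, y) and y labels them. Inverting (x, y) ↦ (x, Y(x, y))
recovers the label, which is the required first integral. -/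
theorem exists_firstIntegral_of_contDiff {N : E × F → E →L[ℝ] F} (hN : ContDiff ℝ ∞ N) (y₀ : F)
    (hint : ∀ᶠ z in 𝓝 ((0 : E), y₀), GraphIntegrableAt N z) :
    ∃ (h : E × F → F) (S : Set (E × F)), IsOpen S ∧ ((0 : E), y₀) ∈ S ∧ ContDiffOn ℝ ∞ h S ∧
      ∀ z ∈ S, Function.Surjective (fderiv ℝ h z) ∧
        ∀ v, fderiv ℝ h z v = 0 ↔ v.2 = N z v.1 := by
  obtain ⟨Y, S, hS, h0S, hY, hY0, hYx, hYy⟩ := exists_total_solution hN y₀ hint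
  have hYd : ∀ p ∈ S, HasFDerivAt Y (fderiv ℝ Y p) p := fun p hp =>
    ((hY.contDiffAt (hS.mem_nhds hp)).differentiableAt (by simp)).hasFDerivAt
  have hsplit : ∀ p ∈ S, ∀ v : E × F,
      fderiv ℝ Y p v = N (p.1, Y p) v.1 + fderiv ℝ Y p (0, v.2) := by
    intro p hp v
    rw [← hYx p hp, ← map_add]
    simp
  let A : (E × F) ≃L[ℝ] E × F :=
    ContinuousLinearEquiv.equivOfInverse
      ((ContinuousLinearMap.fst ℝ E F).prod (fderiv ℝ Y (0, y₀)))
      ((ContinuousLinearMap.fst ℝ E F).prod (ContinuousLinearMap.snd ℝ E F -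
        (N (0, y₀)).comp (ContinuousLinearMap.fst ℝ E F)))
      (fun v => by
        refine Prod.ext rfl ?_
        simp [hsplit _ h0S v, hYy, hY0])
      (fun v => by
        refine Prod.ext rfl ?_
        change fderiv ℝ Y (0, y₀) (v.1, v.2 - N (0, y₀) v.1) = v.2
        rw [hsplit _ h0S, hYy, hY0]
        exact add_sub_cancel _ _)
  obtain ⟨e, he0, heS, he, hsymm, hinv⟩ := exists_openPartialHomeomorph_contDiffOn_symm
    (f := fun p : E × F => (p.1, Y p)) hS (contDiffOn_fst.prodMk hY) h0S A
    (hasFDerivAt_fst.prodMk (hYd _ h0S))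
  refine ⟨fun z => (e.symm z).2, e.target, e.open_target, ?_, contDiff_snd.comp_contDiffOn hsymm,
    fun z hz => ?_⟩
  · have := e.map_source he0
    rw [he] at this
    simpa [hY0] using this
  obtain ⟨g, hg⟩ := hinv _ (e.map_target hz)
  have hp := heS (e.map_target hz)
  set p := e.symm z with hpdef
  have hzp : (p.1, Y p) = z := by
    have := e.right_inv hz
    rwa [he] at this
  have hgv : ∀ v, g v = (v.1, fderiv ℝ Y p v) := fun v => by
    have hu := hg.unique (hasFDerivAt_fst.prodMk (hYd _ hp))
    exact DFunLike.congr_fun hu v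
  have hes : HasFDerivAt e.symm (g.symm : E × F →L[ℝ] E × F) z := by
    refine e.hasFDerivAt_symm hz ?_
    rw [he]
    exact hg
  have hfd : ∀ v, fderiv ℝ (fun z => (e.symm z).2) z v = (g.symm v).2 := fun v => by
    have := (hasFDerivAt_snd.comp z hes).fderiv
    simp only [Function.comp_def] at this
    rw [this]
    rfl
  refine ⟨fun η => ⟨g (0, η), by rw [hfd]; simp⟩, fun v => ?_⟩
  -- In straightened coordinates the differential of the label reads off `w.2`. The image vector
  -- lies in the graph exactly when ∂Y/∂y kills `w.2`, which by injectivity of `g` means `w.2 = 0`.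
  obtain ⟨w, rfl⟩ := g.surjective v
  rw [hfd, g.symm_apply_apply, hgv, hsplit _ hp, hzp]
  constructor
  · intro hw
    rw [hw, Prod.mk_zero_zero, map_zero, add_zero]
  · intro hw
    have h1 : g (0, w.2) = 0 := by
      rw [hgv]
      exact Prod.ext rfl (add_eq_left.1 hw)
    have h2 := g.map_eq_zero_iff.1 h1
    exact congrArg Prod.snd h2

/-- Frobenius' theorem for the distribution `v.2 = N z v.1` on a product. -/
theorem exists_firstIntegral [FiniteDimensional ℝ E] [FiniteDimensional ℝ F]
    {N : E × F → E →L[ℝ] F} {V : Set (E × F)} (hV : IsOpen V) (hN : ContDiffOn ℝ ∞ N V)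
    (hint : ∀ z ∈ V, GraphIntegrableAt N z) {z₀ : E × F} (hz₀ : z₀ ∈ V) :
    ∃ (h : E × F → F) (S : Set (E × F)), IsOpen S ∧ z₀ ∈ S ∧ S ⊆ V ∧ ContDiffOn ℝ ∞ h S ∧
      ∀ z ∈ S, Function.Surjective (fderiv ℝ h z) ∧
        ∀ v, fderiv ℝ h z v = 0 ↔ v.2 = N z v.1 := by
  obtain ⟨M, hM, hMN⟩ := exists_contDiff_eventuallyEq hV hN hz₀
  have hgood : ∀ᶠ z in 𝓝 z₀, GraphIntegrableAt M z ∧ M z = N z ∧ z ∈ V := by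
    filter_upwards [hMN.eventuallyEq_nhds, hV.mem_nhds hz₀] with z hz hzV
    refine ⟨fun ξ η => ?_, hz.self_of_nhds, hzV⟩
    rw [hz.fderiv_eq, hz.self_of_nhds]
    exact hint z hzV ξ η
  -- Rays must start at 0 in `E`, so only the first component is translated; the initial value
  -- `z₀.2` is already arbitrary.
  let c : E × F := (z₀.1, 0)
  have hc : Tendsto (fun w : E × F => w + c) (𝓝 (0, z₀.2)) (𝓝 z₀) := by
    have : Continuous fun w : E × F => w + c := by fun_prop
    simpa [c] using this.tendsto (0, z₀.2)
  have hc' : Tendsto (fun z : E × F => z - c) (𝓝 z₀) (𝓝 (0, z₀.2)) := by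
    have : Continuous fun z : E × F => z - c := by fun_prop
    simpa [c, Prod.sub_def] using this.tendsto z₀
  have hMc : ContDiff ℝ ∞ fun w => M (w + c) := hM.comp (contDiff_id.add contDiff_const)
  obtain ⟨h, S, hS, h0S, hh, hker⟩ := exists_firstIntegral_of_contDiff hMc z₀.2
    ((hc.eventually hgood).mono fun w hw ξ η => by
      rw [fderiv_comp_add_right]
      exact hw.1 ξ η)
  have hsub : ContDiff ℝ ∞ fun z : E × F => z - c := contDiff_id.sub contDiff_const
  have hmem : ((fun z : E × F => z - c) ⁻¹' S) ∩ {z | M z = N z ∧ z ∈ V} ∈ 𝓝 z₀ :=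
    inter_mem (hc' (hS.mem_nhds h0S)) (hgood.mono fun z hz => hz.2)
  obtain ⟨S', hS', hS'o, hz₀S'⟩ := mem_nhds_iff.1 hmem
  refine ⟨fun z => h (z - c), S', hS'o, hz₀S', fun z hz => (hS' hz).2.2,
    hh.comp hsub.contDiffOn fun z hz => (hS' hz).1, fun z hz => ?_⟩
  obtain ⟨h1, h2⟩ := hker _ (hS' hz).1
  rw [fderiv_comp_sub]
  refine ⟨h1, fun v => (h2 v).trans ?_⟩
  rw [sub_add_cancel, (hS' hz).2.1]

end Frobenius

/-! ### Integrability of the pencil a φ_x dx + b φ_y dy -/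

section Pencil

theorem two_le_infty : (2 : WithTop ℕ∞) ≤ ∞ :=
  WithTop.coe_le_coe.2 (le_top (a := (2 : ℕ∞)))

universe v

variable {E F G : Type v} [NormedAddCommGroup E] [NormedSpace ℝ E] [NormedAddCommGroup F]
  [NormedSpace ℝ F] [NormedAddCommGroup G] [NormedSpace ℝ G]

/-- The partial derivative of `φ` in the first variable. -/
def dFst (φ : E × F → G) (z : E × F) : E →L[ℝ] G := (fderiv ℝ φ z).comp (.inl ℝ E F)

/-- The partial derivative of `φ` in the second variable. -/
def dSnd (φ : E × F → G) (z : E × F) : F →L[ℝ] G := (fderiv ℝ φ z).comp (.inr ℝ E F)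

/-- The invariant form of the second order system: the mixed second derivative of `φ` is symmetric
under the identification of the two factors by `(∂φ/∂y)⁻¹ ∂φ/∂x`. -/
def MixedSymmetricAt (φ : E × F → G) (z : E × F) : Prop :=
  ∀ ξ η w w', dSnd φ z w = dFst φ z η → dSnd φ z w' = dFst φ z ξ →
    fderiv ℝ (fderiv ℝ φ) z (ξ, 0) (0, w) = fderiv ℝ (fderiv ℝ φ) z (η, 0) (0, w')

/-- Differentiate `Dh(ξ, Nξ) = 0` along `(η, Nη)` and antisymmetrise: the second derivative of `h`
drops out, so `(0, curvature)` is in the kernel of `Dh`. That kernel is a graph and contains no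
nonzero vertical vector. -/
theorem GraphIntegrableAt.of_ker {H : Type*} [NormedAddCommGroup H] [NormedSpace ℝ H]
    {N : E × F → E →L[ℝ] F} {h : E × F → H} {z : E × F}
    (hN : DifferentiableAt ℝ N z) (hh : ContDiffAt ℝ ∞ h z)
    (hker : ∀ᶠ y in 𝓝 z, ∀ v, fderiv ℝ h y v = 0 ↔ v.2 = N y v.1) : GraphIntegrableAt N z := by
  have hd : HasFDerivAt (fderiv ℝ h) (fderiv ℝ (fderiv ℝ h) z) z :=
    ((hh.fderiv_right (m := 1) (by norm_cast)).differentiableAt (by simp)).hasFDerivAt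
  have key : ∀ ξ v, fderiv ℝ (fderiv ℝ h) z v (ξ, N z ξ)
      + fderiv ℝ h z (0, fderiv ℝ N z v ξ) = 0 := by
    intro ξ v
    have h1 : HasFDerivAt (fun y => (ξ, N y ξ)) (((0 : E × F →L[ℝ] E)).prod
        ((fderiv ℝ N z).flip ξ)) z :=
      (hasFDerivAt_const ξ z).prodMk (by
        simpa using hN.hasFDerivAt.clm_apply (hasFDerivAt_const ξ z))
    have h2 := hd.clm_apply h1
    have h3 : (fun y => fderiv ℝ h y (ξ, N y ξ)) =ᶠ[𝓝 z] fun _ => 0 :=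
      hker.mono fun y hy => (hy _).2 rfl
    have h4 := h2.unique ((hasFDerivAt_const (0 : H) z).congr_of_eventuallyEq h3)
    have h5 := DFunLike.congr_fun h4 v
    simpa [add_comm] using h5
  have hsymm : ∀ v w, fderiv ℝ (fderiv ℝ h) z v w = fderiv ℝ (fderiv ℝ h) z w v := fun v w =>
    (hh.isSymmSndFDerivAt (by simpa using two_le_infty)).eq v w
  intro ξ η
  have h1 := key η (ξ, N z ξ)
  have h2 := key ξ (η, N z η)
  rw [hsymm] at h1
  have h3 : fderiv ℝ h z (0, fderiv ℝ N z (ξ, N z ξ) η - fderiv ℝ N z (η, N z η) ξ) = 0 := by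
    have : ((0 : E), fderiv ℝ N z (ξ, N z ξ) η - fderiv ℝ N z (η, N z η) ξ)
        = (0, fderiv ℝ N z (ξ, N z ξ) η) - (0, fderiv ℝ N z (η, N z η) ξ) := by simp
    rw [this, map_sub, sub_eq_zero]
    exact add_left_cancel (h1.trans h2.symm)
  have h4 := (hker.self_of_nhds _).1 h3
  rw [map_zero] at h4
  exact sub_eq_zero.1 h4

/-- The commutator identity for the graph distribution annihilated by `a ∂φ/∂x + b ∂φ/∂y`. -/
theorem dSnd_curvature {N : E × F → E →L[ℝ] F} {φ : E × F → G} {z : E × F} {a b : ℝ}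
    (hN : DifferentiableAt ℝ N z) (hφ : ContDiffAt ℝ ∞ φ z)
    (hker : ∀ᶠ y in 𝓝 z, ∀ ξ, a • fderiv ℝ φ y (ξ, 0) + b • fderiv ℝ φ y (0, N y ξ) = 0)
    (ξ η : E) :
    b • dSnd φ z (fderiv ℝ N z (ξ, N z ξ) η - fderiv ℝ N z (η, N z η) ξ)
      = (a - b) • (fderiv ℝ (fderiv ℝ φ) z (ξ, 0) (0, N z η)
        - fderiv ℝ (fderiv ℝ φ) z (η, 0) (0, N z ξ)) := by
  have hd : HasFDerivAt (fderiv ℝ φ) (fderiv ℝ (fderiv ℝ φ) z) z :=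
    ((hφ.fderiv_right (m := 1) (by norm_cast)).differentiableAt (by simp)).hasFDerivAt
  have key : ∀ ξ v, a • fderiv ℝ (fderiv ℝ φ) z v (ξ, 0)
      + b • (fderiv ℝ (fderiv ℝ φ) z v (0, N z ξ) + fderiv ℝ φ z (0, fderiv ℝ N z v ξ)) = 0 := by
    intro ξ v
    have h1 : HasFDerivAt (fun y => ((0 : E), N y ξ)) (((0 : E × F →L[ℝ] E)).prod
        ((fderiv ℝ N z).flip ξ)) z :=
      (hasFDerivAt_const 0 z).prodMk (by
        simpa using hN.hasFDerivAt.clm_apply (hasFDerivAt_const ξ z))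
    have h2 := ((hd.clm_apply (hasFDerivAt_const (ξ, (0 : F)) z)).const_smul a).add
      ((hd.clm_apply h1).const_smul b)
    have h3 : (fun y => a • fderiv ℝ φ y (ξ, 0) + b • fderiv ℝ φ y (0, N y ξ)) =ᶠ[𝓝 z]
        fun _ => 0 := hker.mono fun y hy => hy ξ
    have h4 := h2.unique ((hasFDerivAt_const (0 : G) z).congr_of_eventuallyEq h3)
    have h5 := DFunLike.congr_fun h4 v
    simp only [ContinuousLinearMap.comp_zero, zero_add, add_apply,
      smul_apply, ContinuousLinearMap.flip_apply,
      ContinuousLinearMap.comp_apply, ContinuousLinearMap.prod_apply,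
      zero_apply] at h5
    rw [← h5, add_comm (fderiv ℝ φ z _)]
  have hsymm : ∀ v w, fderiv ℝ (fderiv ℝ φ) z v w = fderiv ℝ (fderiv ℝ φ) z w v := fun v w =>
    (hφ.isSymmSndFDerivAt (by simpa using two_le_infty)).eq v w
  have hs : ∀ (x : E) (y : F), ((x, y) : E × F) = (x, 0) + (0, y) := by simp
  have h1 := key η (ξ, N z ξ)
  have h2 := key ξ (η, N z η)
  have hsnd : ∀ w, dSnd φ z w = fderiv ℝ φ z (0, w) := fun _ => rfl
  rw [map_sub, hsnd, hsnd]
  generalize fderiv ℝ N z (ξ, N z ξ) η = A at h1 ⊢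
  generalize fderiv ℝ N z (η, N z η) ξ = B at h2 ⊢
  rw [hs ξ (N z ξ)] at h1
  rw [hs η (N z η)] at h2
  simp only [map_add, add_apply] at h1 h2
  rw [hsymm (0, N z ξ) (η, 0)] at h1
  rw [hsymm (0, N z η) (ξ, 0), hsymm (η, 0) (ξ, 0), hsymm (0, N z η) (0, N z ξ)] at h2
  rw [← sub_eq_zero]
  -- In the difference the second derivatives of pure type xx and yy cancel by symmetry. The mixed
  -- ones occur once with weight a and once, with the opposite sign, with weight b, whence the
  -- factor a - b.
  have h3 := congrArg₂ (· - ·) h1 h2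
  rw [sub_self] at h3
  refine Eq.trans ?_ h3
  module

/-- The slope `-(a/b) (∂φ/∂y)⁻¹ ∂φ/∂x` of the distribution annihilated by
`a ∂φ/∂x + b ∂φ/∂y`. -/
def slope (φ : E × F → G) (a b : ℝ) (z : E × F) : E →L[ℝ] F :=
  (-(a / b)) • (dSnd φ z).inverse.comp (dFst φ z)

theorem contDiffOn_slope [CompleteSpace F] {φ : E × F → G} {V : Set (E × F)} (hV : IsOpen V)
    (hφ : ContDiffOn ℝ ∞ φ V) (hinv : ∀ z ∈ V, (dSnd φ z).IsInvertible) (a b : ℝ) :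
    ContDiffOn ℝ ∞ (slope φ a b) V := by
  have hd : ContDiffOn ℝ ∞ (fderiv ℝ φ) V := hφ.fderiv_of_isOpen hV (by simp)
  have h1 : ContDiffOn ℝ ∞ (dFst φ) V :=
    hd.clm_comp (contDiffOn_const (c := ContinuousLinearMap.inl ℝ E F))
  have h2 : ContDiffOn ℝ ∞ (dSnd φ) V :=
    hd.clm_comp (contDiffOn_const (c := ContinuousLinearMap.inr ℝ E F))
  have h3 : ContDiffOn ℝ ∞ (fun z => (dSnd φ z).inverse) V := by
    intro z hz
    obtain ⟨e, he⟩ := hinv z hz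
    have h4 := contDiffAt_map_inverse (𝕜 := ℝ) (n := ∞) e
    rw [he] at h4
    exact h4.comp_contDiffWithinAt z (h2 z hz)
  exact (h3.clm_comp h1).const_smul _

theorem slope_spec {φ : E × F → G} {z : E × F} (hinv : (dSnd φ z).IsInvertible) {a b : ℝ}
    (hb : b ≠ 0) (v : E × F) :
    v.2 = slope φ a b z v.1 ↔ a • fderiv ℝ φ z (v.1, 0) + b • fderiv ℝ φ z (0, v.2) = 0 := by
  obtain ⟨e, he⟩ := hinv
  have h1 : fderiv ℝ φ z (v.1, 0) = dFst φ z v.1 := rfl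
  have h2 : fderiv ℝ φ z (0, v.2) = e v.2 := DFunLike.congr_fun he.symm v.2
  rw [h1, h2, slope, ← he, ContinuousLinearMap.inverse_equiv]
  simp only [smul_apply, ContinuousLinearMap.comp_apply, ContinuousLinearEquiv.coe_coe]
  rw [← map_smul, ContinuousLinearEquiv.eq_symm_apply, ← sub_eq_zero, sub_eq_add_neg, ← neg_smul,
    neg_neg, ← smul_right_injective G hb |>.eq_iff, smul_zero, smul_add, smul_smul,
    mul_div_cancel₀ a hb, add_comm]

/-- The slope is a multiple of φ_y⁻¹ φ_x, so mixed symmetry kills the right-hand side of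
`dSnd_curvature` for all a and all b ≠ 0, and Frobenius' theorem applies. -/
theorem exists_firstIntegral_of_mixedSymmetric [FiniteDimensional ℝ E] [FiniteDimensional ℝ F]
    {φ : E × F → G} {V : Set (E × F)} (hV : IsOpen V) (hφ : ContDiffOn ℝ ∞ φ V)
    (hinv : ∀ z ∈ V, (dSnd φ z).IsInvertible) (hsym : ∀ z ∈ V, MixedSymmetricAt φ z) {a b : ℝ}
    (hb : b ≠ 0) {z₀ : E × F} (hz₀ : z₀ ∈ V) :
    ∃ (h : E × F → F) (S : Set (E × F)), IsOpen S ∧ z₀ ∈ S ∧ S ⊆ V ∧ ContDiffOn ℝ ∞ h S ∧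
      ∀ z ∈ S, Function.Surjective (fderiv ℝ h z) ∧
        ∀ v, fderiv ℝ h z v = 0 ↔ a • fderiv ℝ φ z (v.1, 0) + b • fderiv ℝ φ z (0, v.2) = 0 := by
  have := FiniteDimensional.complete ℝ E
  have := FiniteDimensional.complete ℝ F
  have hN := contDiffOn_slope hV hφ hinv a b
  suffices hint : ∀ z ∈ V, GraphIntegrableAt (slope φ a b) z by
    obtain ⟨h, S, hS, hz₀S, hSV, hh, hker⟩ := exists_firstIntegral hV hN hint hz₀
    exact ⟨h, S, hS, hz₀S, hSV, hh, fun z hz => ⟨(hker z hz).1, fun v =>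
      ((hker z hz).2 v).trans (slope_spec (hinv z (hSV hz)) hb v)⟩⟩
  intro z hz ξ η
  have hVz := hV.mem_nhds hz
  have hcurv := dSnd_curvature (a := a) (b := b)
    ((hN.contDiffAt hVz).differentiableAt (by simp)) (hφ.contDiffAt hVz)
    (Filter.eventually_of_mem hVz fun y hy ξ =>
      (slope_spec (hinv y hy) hb (ξ, slope φ a b y ξ)).1 rfl) ξ η
  obtain ⟨e, he⟩ := hinv z hz
  have hN1 : ∀ ζ, slope φ a b z ζ = (-(a / b)) • e.symm (dFst φ z ζ) := fun ζ => by
    rw [slope, ← he, ContinuousLinearMap.inverse_equiv]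
    rfl
  have hsymm := hsym z hz ξ η (e.symm (dFst φ z η)) (e.symm (dFst φ z ξ))
    (by rw [← he]; simp) (by rw [← he]; simp)
  have hz0 : ∀ (c : ℝ) (w : F), ((0 : E), c • w) = c • (0, w) := by simp
  rw [hN1 ξ, hN1 η, hz0, hz0, map_smul, map_smul, hsymm, sub_self, smul_zero, ← he,
    ← hN1, ← hN1] at hcurv
  exact sub_eq_zero.1 (e.map_eq_zero_iff.1 ((smul_eq_zero.1 hcurv).resolve_left hb))

/-- One integrable member suffices: a ≠ b allows cancelling the factor a - b in `dSnd_curvature`,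
and a ≠ 0 allows passing from the slope to φ_y⁻¹ φ_x. -/
theorem mixedSymmetricAt_of_firstIntegral [CompleteSpace F] {H : Type*}
    [NormedAddCommGroup H] [NormedSpace ℝ H] {φ : E × F → G} {h : E × F → H} {V : Set (E × F)} (hV : IsOpen V) (hφ : ContDiffOn ℝ ∞ φ V)
    (hinv : ∀ z ∈ V, (dSnd φ z).IsInvertible) {a b : ℝ} (ha : a ≠ 0) (hb : b ≠ 0) (hab : a ≠ b)
    {z : E × F} (hz : z ∈ V) (hh : ContDiffAt ℝ ∞ h z)
    (hker : ∀ᶠ y in 𝓝 z, ∀ v,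
      fderiv ℝ h y v = 0 ↔ a • fderiv ℝ φ y (v.1, 0) + b • fderiv ℝ φ y (0, v.2) = 0) :
    MixedSymmetricAt φ z := by
  intro ξ η w w' hw hw'
  have hVz := hV.mem_nhds hz
  have hN := ((contDiffOn_slope hV hφ hinv a b).contDiffAt hVz).differentiableAt (by simp)
  have hint : GraphIntegrableAt (slope φ a b) z := GraphIntegrableAt.of_ker hN hh (by
    filter_upwards [hker, hVz] with y hy hyV v
    exact (hy v).trans (slope_spec (hinv y hyV) hb v).symm)
  have hcurv := dSnd_curvature (a := a) (b := b) hN (hφ.contDiffAt hVz)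
    (Filter.eventually_of_mem hVz fun y hy ξ =>
      (slope_spec (hinv y hy) hb (ξ, slope φ a b y ξ)).1 rfl) ξ η
  rw [hint ξ η, sub_self, map_zero, smul_zero, eq_comm, smul_eq_zero,
    or_iff_right (sub_ne_zero.2 hab), sub_eq_zero] at hcurv
  have hN1 : ∀ ζ u, dSnd φ z u = dFst φ z ζ → slope φ a b z ζ = (-(a / b)) • u := by
    intro ζ u hu
    refine ((slope_spec (hinv z hz) hb (ζ, (-(a / b)) • u)).2 ?_).symm
    change a • dFst φ z ζ + b • dSnd φ z ((-(a / b)) • u) = 0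
    rw [map_smul, hu, smul_smul, ← add_smul]
    rw [show a + b * -(a / b) = 0 by field_simp; ring, zero_smul]
  have hz0 : ∀ (c : ℝ) (w : F), ((0 : E), c • w) = c • (0, w) := by simp
  rw [hN1 η w hw, hN1 ξ w' hw', hz0, hz0, map_smul, map_smul] at hcurv
  exact smul_right_injective G (neg_ne_zero.2 (div_ne_zero ha hb)) hcurv

end Pencil

/-! ### The splitting ℝ⁴ = ℝ² × ℝ² and derivatives in coordinates -/

section Coordinates

/-- `(u, w) ↦ (u₁, u₂, w₁, w₂)` as a linear isomorphism. -/
def joinL : (R2 × R2) ≃L[ℝ] R4 :=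
  LinearEquiv.toContinuousLinearEquiv
    { toFun := fun z => join z.1 z.2
      invFun := fun x => (firstPair x, lastPair x)
      map_add' := fun z w => by ext j; fin_cases j <;> simp [join]
      map_smul' := fun c z => by ext j; fin_cases j <;> simp [join]
      left_inv := fun z => by
        ext j <;> fin_cases j <;> simp [join, firstPair, lastPair]
      right_inv := fun x => by ext j; fin_cases j <;> simp [join, firstPair, lastPair] }

@[simp]
theorem joinL_apply (z : R2 × R2) : joinL z = join z.1 z.2 := rfl

@[simp] theorem join_zero (u w : R2) : join u w 0 = u 0 := rfl
@[simp] theorem join_one (u w : R2) : join u w 1 = u 1 := rfl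
@[simp] theorem join_two (u w : R2) : join u w 2 = w 0 := rfl
@[simp] theorem join_three (u w : R2) : join u w 3 = w 1 := rfl
@[simp] theorem firstPair_zero (x : R4) : firstPair x 0 = x 0 := rfl
@[simp] theorem firstPair_one (x : R4) : firstPair x 1 = x 1 := rfl
@[simp] theorem lastPair_zero (x : R4) : lastPair x 0 = x 2 := rfl
@[simp] theorem lastPair_one (x : R4) : lastPair x 1 = x 3 := rfl
@[simp] theorem values_apply (f : Fin 2 → R4 → ℝ) (x : R4) (i : Fin 2) : values f x i = f i x := by
  fin_cases i <;> rfl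

@[simp]
theorem join_pairs (x : R4) : join (firstPair x) (lastPair x) = x := joinL.apply_symm_apply x

theorem eq_sum_single (v : R4) : v = v 0 • EuclideanSpace.single 0 1
    + v 1 • EuclideanSpace.single 1 1 + v 2 • EuclideanSpace.single 2 1
    + v 3 • EuclideanSpace.single 3 (1 : ℝ) := by
  ext j
  fin_cases j <;> simp

theorem linear_apply_eq {G : Type*} [AddCommGroup G] [Module ℝ G] [TopologicalSpace G]
    (T : R4 →L[ℝ] G) (v : R4) : T v = v 0 • T (EuclideanSpace.single 0 1)
    + v 1 • T (EuclideanSpace.single 1 1) + v 2 • T (EuclideanSpace.single 2 1)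
    + v 3 • T (EuclideanSpace.single 3 1) := by
  conv_lhs => rw [eq_sum_single v]
  simp only [map_add, map_smul]

theorem fderiv_apply_eq (g : R4 → ℝ) (x v : R4) :
    fderiv ℝ g x v = pd 0 g x * v 0 + pd 1 g x * v 1 + pd 2 g x * v 2 + pd 3 g x * v 3 := by
  rw [linear_apply_eq]
  simp only [pd, smul_eq_mul]
  ring

theorem differentiableAt_fderiv {E F : Type*} [NormedAddCommGroup E] [NormedSpace ℝ E]
    [NormedAddCommGroup F] [NormedSpace ℝ F] {g : E → F} {x : E} (hg : ContDiffAt ℝ ∞ g x) :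
    DifferentiableAt ℝ (fderiv ℝ g) x :=
  (hg.fderiv_right (m := 1) (by norm_cast)).differentiableAt (by simp)

theorem fderiv_fderiv_single {g : R4 → ℝ} {x : R4} (hg : ContDiffAt ℝ ∞ g x) (j k : Fin 4) :
    fderiv ℝ (fderiv ℝ g) x (EuclideanSpace.single k 1) (EuclideanSpace.single j 1)
      = pd k (pd j g) x := by
  have h := (differentiableAt_fderiv hg).hasFDerivAt.clm_apply
    (hasFDerivAt_const (EuclideanSpace.single j (1 : ℝ)) x)
  unfold pd
  rw [h.fderiv]
  simp

theorem fderiv_fderiv_symm {E F : Type*} [NormedAddCommGroup E] [NormedSpace ℝ E]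
    [NormedAddCommGroup F] [NormedSpace ℝ F] {g : E → F} {x : E} (hg : ContDiffAt ℝ ∞ g x)
    (v w : E) : fderiv ℝ (fderiv ℝ g) x v w = fderiv ℝ (fderiv ℝ g) x w v :=
  (hg.isSymmSndFDerivAt (by simpa using two_le_infty)).eq v w

theorem fderiv_fderiv_join {g : R4 → ℝ} {x : R4} (hg : ContDiffAt ℝ ∞ g x) (ξ w : R2) :
    fderiv ℝ (fderiv ℝ g) x (join ξ 0) (join 0 w)
      = pd 2 (pd 0 g) x * (ξ 0 * w 0) + pd 3 (pd 0 g) x * (ξ 0 * w 1)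
        + pd 2 (pd 1 g) x * (ξ 1 * w 0) + pd 3 (pd 1 g) x * (ξ 1 * w 1) := by
  rw [fderiv_fderiv_symm hg, linear_apply_eq]
  rw [linear_apply_eq (fderiv ℝ (fderiv ℝ g) x) (join 0 w)]
  simp only [add_apply, smul_apply, join_zero, join_one, join_two, join_three,
    fderiv_fderiv_single hg, smul_eq_mul, PiLp.zero_apply]
  ring

theorem contDiffOn_values {f : Fin 2 → R4 → ℝ} {U : Set R4} {n : WithTop ℕ∞}
    (hf : ∀ i, ContDiffOn ℝ n (f i) U) : ContDiffOn ℝ n (values f) U := by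
  refine contDiffOn_euclidean.2 fun i => ?_
  simpa using hf i

theorem contDiffAt_values {f : Fin 2 → R4 → ℝ} {x : R4} {n : WithTop ℕ∞}
    (hf : ∀ i, ContDiffAt ℝ n (f i) x) : ContDiffAt ℝ n (values f) x := by
  refine contDiffAt_euclidean.2 fun i => ?_
  simpa using hf i

theorem fderiv_values_apply {f : Fin 2 → R4 → ℝ} {x : R4} (hf : ∀ i, DifferentiableAt ℝ (f i) x)
    (v : R4) (i : Fin 2) : fderiv ℝ (values f) x v i = fderiv ℝ (f i) x v := by
  have h : DifferentiableAt ℝ (values f) x :=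
    differentiableAt_euclidean.2 fun i => by simpa using hf i
  have h1 := (EuclideanSpace.proj i : R2 →L[ℝ] ℝ).hasFDerivAt.comp x
    h.hasFDerivAt
  have h2 : (⇑(EuclideanSpace.proj i : R2 →L[ℝ] ℝ) ∘ values f) = f i := by
    funext y
    simp
  rw [h2] at h1
  rw [h1.fderiv]
  rfl

/-- The pair `f` as a map on `ℝ² × ℝ²`. -/
def pairMap (f : Fin 2 → R4 → ℝ) (z : R2 × R2) : R2 := values f (joinL z)

theorem contDiffOn_pairMap {f : Fin 2 → R4 → ℝ} {U : Set R4}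
    (hf : ∀ i, ContDiffOn ℝ ∞ (f i) U) : ContDiffOn ℝ ∞ (pairMap f) (joinL ⁻¹' U) :=
  (contDiffOn_values hf).comp joinL.contDiff.contDiffOn fun _ hz => hz

theorem fderiv_pairMap_apply {f : Fin 2 → R4 → ℝ} {z : R2 × R2}
    (hf : ∀ i, DifferentiableAt ℝ (f i) (joinL z)) (v : R2 × R2) (i : Fin 2) :
    fderiv ℝ (pairMap f) z v i = fderiv ℝ (f i) (joinL z) (joinL v) := by
  have h : DifferentiableAt ℝ (values f) (joinL z) :=
    differentiableAt_euclidean.2 fun i => by simpa using hf i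
  have h1 := (h.hasFDerivAt.comp z joinL.hasFDerivAt).fderiv
  rw [← fderiv_values_apply hf]
  unfold pairMap
  simp only [Function.comp_def] at h1
  rw [h1]
  rfl

theorem fderiv_fderiv_pairMap_apply {f : Fin 2 → R4 → ℝ} {U : Set R4} (hU : IsOpen U)
    (hf : ∀ i, ContDiffOn ℝ ∞ (f i) U) {z : R2 × R2} (hz : joinL z ∈ U) (v w : R2 × R2)
    (i : Fin 2) : fderiv ℝ (fderiv ℝ (pairMap f)) z v w i
      = fderiv ℝ (fderiv ℝ (f i)) (joinL z) (joinL v) (joinL w) := by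
  have hat : ∀ y ∈ U, ∀ i, ContDiffAt ℝ ∞ (f i) y := fun y hy i =>
    (hf i).contDiffAt (hU.mem_nhds hy)
  have hopen : IsOpen (joinL ⁻¹' U) := hU.preimage joinL.continuous
  have h1 := ((differentiableAt_fderiv ((contDiffOn_pairMap hf).contDiffAt
    (hopen.mem_nhds hz))).hasFDerivAt.clm_apply (hasFDerivAt_const w z))
  have h2 := (EuclideanSpace.proj i : R2 →L[ℝ] ℝ).hasFDerivAt.comp z h1
  have h3 := ((differentiableAt_fderiv (hat _ hz i)).hasFDerivAt.comp z
    joinL.hasFDerivAt).clm_apply (hasFDerivAt_const (joinL w) z)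
  have h4 : (⇑(EuclideanSpace.proj i : R2 →L[ℝ] ℝ)
      ∘ fun y => fderiv ℝ (pairMap f) y w)
      =ᶠ[𝓝 z] fun y => (fderiv ℝ (f i) ∘ ⇑joinL) y (joinL w) := by
    filter_upwards [hopen.mem_nhds hz] with y hy
    exact fderiv_pairMap_apply (fun i => (hat _ hy i).differentiableAt (by simp)) w i
  have h5 := DFunLike.congr_fun (h2.unique (h3.congr_of_eventuallyEq h4)) v
  simpa using h5

end Coordinates

/-! ### The system (H) as mixed symmetry -/

section System

theorem minor_one (f : Fin 2 → R4 → ℝ) (j k : Fin 4) (x : R4) :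
    minor f 1 j k x = -minor f 0 j k x := by
  simp [minor]

theorem dFst_pairMap_apply {f : Fin 2 → R4 → ℝ} {z : R2 × R2}
    (hf : ∀ i, DifferentiableAt ℝ (f i) (joinL z)) (ξ : R2) (i : Fin 2) :
    dFst (pairMap f) z ξ i = pd 0 (f i) (joinL z) * ξ 0 + pd 1 (f i) (joinL z) * ξ 1 := by
  change fderiv ℝ (pairMap f) z (ξ, 0) i = _
  rw [fderiv_pairMap_apply hf, fderiv_apply_eq]
  simp

theorem dSnd_pairMap_apply {f : Fin 2 → R4 → ℝ} {z : R2 × R2}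
    (hf : ∀ i, DifferentiableAt ℝ (f i) (joinL z)) (w : R2) (i : Fin 2) :
    dSnd (pairMap f) z w i = pd 2 (f i) (joinL z) * w 0 + pd 3 (f i) (joinL z) * w 1 := by
  change fderiv ℝ (pairMap f) z (0, w) i = _
  rw [fderiv_pairMap_apply hf, fderiv_apply_eq]
  simp

theorem isInvertible_of_ker_eq_bot (T : R2 →L[ℝ] R2) (hT : ∀ w, T w = 0 → w = 0) :
    T.IsInvertible := by
  have hinj : Function.Injective (T : R2 →ₗ[ℝ] R2) := (injective_iff_map_eq_zero _).2 hT
  exact ⟨(LinearEquiv.ofInjectiveEndo _ hinj).toContinuousLinearEquiv, by ext1 w; rfl⟩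

theorem eq_zero_of_det_ne_zero {a b c d x y : ℝ} (hdet : a * d - c * b ≠ 0)
    (h1 : a * x + b * y = 0) (h2 : c * x + d * y = 0) : x = 0 ∧ y = 0 := by
  constructor
  · refine (mul_eq_zero.1 ?_).resolve_left hdet
    linear_combination d * h1 - b * h2
  · refine (mul_eq_zero.1 ?_).resolve_left hdet
    linear_combination a * h2 - c * h1

theorem dSnd_pairMap_isInvertible {f : Fin 2 → R4 → ℝ} {z : R2 × R2}
    (hf : ∀ i, DifferentiableAt ℝ (f i) (joinL z)) (hJ : minor f 0 2 3 (joinL z) ≠ 0) :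
    (dSnd (pairMap f) z).IsInvertible := by
  refine isInvertible_of_ker_eq_bot _ fun w hw => ?_
  have h0 : dSnd (pairMap f) z w 0 = 0 := by rw [hw]; rfl
  have h1 : dSnd (pairMap f) z w 1 = 0 := by rw [hw]; rfl
  rw [dSnd_pairMap_apply hf] at h0 h1
  simp only [minor, sub_zero] at hJ
  obtain ⟨h2, h3⟩ := eq_zero_of_det_ne_zero hJ h0 h1
  ext i
  fin_cases i
  exacts [h2, h3]

/-- With J = φ_y⁻¹ φ_x, the expression φ_xy(ξ, Jη) - φ_xy(η, Jξ) is alternating on a plane, so it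
vanishes once it does on the standard basis. There Cramer's rule writes the entries of J as 2 × 2
minors, and (H) appears after multiplication by D(f¹, f²)/D(x₃, x₄). -/
theorem mixedSymmetricAt_pairMap_iff {f : Fin 2 → R4 → ℝ} {U : Set R4} (hU : IsOpen U)
    (hf : ∀ i, ContDiffOn ℝ ∞ (f i) U) {z : R2 × R2} (hz : joinL z ∈ U)
    (hJ : minor f 0 2 3 (joinL z) ≠ 0) :
    MixedSymmetricAt (pairMap f) z ↔ SolvesAt f (joinL z) := by
  have hat : ∀ i, ContDiffAt ℝ ∞ (f i) (joinL z) := fun i => (hf i).contDiffAt (hU.mem_nhds hz)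
  have hd : ∀ i, DifferentiableAt ℝ (f i) (joinL z) := fun i => (hat i).differentiableAt (by simp)
  have hsnd : ∀ (ξ w : R2) (i : Fin 2), fderiv ℝ (fderiv ℝ (pairMap f)) z (ξ, 0) (0, w) i
      = pd 2 (pd 0 (f i)) (joinL z) * (ξ 0 * w 0) + pd 3 (pd 0 (f i)) (joinL z) * (ξ 0 * w 1)
        + pd 2 (pd 1 (f i)) (joinL z) * (ξ 1 * w 0)
        + pd 3 (pd 1 (f i)) (joinL z) * (ξ 1 * w 1) := fun ξ w i => by
    rw [fderiv_fderiv_pairMap_apply hU hf hz]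
    exact fderiv_fderiv_join (hat i) ξ w
  have heq : ∀ w η : R2, dSnd (pairMap f) z w = dFst (pairMap f) z η ↔ ∀ i : Fin 2,
      pd 2 (f i) (joinL z) * w 0 + pd 3 (f i) (joinL z) * w 1
        = pd 0 (f i) (joinL z) * η 0 + pd 1 (f i) (joinL z) * η 1 := fun w η => by
    rw [PiLp.ext_iff]
    simp only [dSnd_pairMap_apply hd, dFst_pairMap_apply hd]
  have hm : ∀ j k, minor f 0 j k (joinL z) = pd j (f 0) (joinL z) * pd k (f 1) (joinL z)
      - pd j (f 1) (joinL z) * pd k (f 0) (joinL z) := fun j k => by simp [minor]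
  have hsol : SolvesAt f (joinL z) ↔ ∀ i, pd 2 (pd 0 (f i)) (joinL z) * minor f 0 1 3 (joinL z)
      - pd 3 (pd 0 (f i)) (joinL z) * minor f 0 1 2 (joinL z)
      - pd 2 (pd 1 (f i)) (joinL z) * minor f 0 0 3 (joinL z)
      + pd 3 (pd 1 (f i)) (joinL z) * minor f 0 0 2 (joinL z) = 0 := by
    unfold SolvesAt
    simp only [Fin.forall_fin_two, minor_one]
    refine and_congr_right fun _ => ⟨fun h => ?_, fun h => ?_⟩ <;> linear_combination -h
  rw [hsol]
  constructor
  · intro h i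
    -- The last two vectors are J e₂ and J e₁ by Cramer's rule.
    have h1 := h !₂[1, 0] !₂[0, 1]
      !₂[minor f 0 1 3 (joinL z) / minor f 0 2 3 (joinL z),
        -minor f 0 1 2 (joinL z) / minor f 0 2 3 (joinL z)]
      !₂[minor f 0 0 3 (joinL z) / minor f 0 2 3 (joinL z),
        -minor f 0 0 2 (joinL z) / minor f 0 2 3 (joinL z)]
      ((heq _ _).2 fun i => by
        simp only [Matrix.cons_val_zero, Matrix.cons_val_one]
        field_simp
        simp only [hm]
        fin_cases i <;> simp <;> ring)
      ((heq _ _).2 fun i => by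
        simp only [Matrix.cons_val_zero, Matrix.cons_val_one]
        field_simp
        simp only [hm]
        fin_cases i <;> simp <;> ring)
    have h2 := congrArg (fun u : R2 => u i) h1
    simp only [hsnd] at h2
    simp only [Matrix.cons_val_zero, Matrix.cons_val_one] at h2
    field_simp at h2
    linear_combination h2
  · intro h ξ η w w' hw hw'
    rw [heq] at hw hw'
    ext i
    rw [hsnd, hsnd]
    have hi := h i
    have hw0 := hw 0
    have hw1 := hw 1
    have hw0' := hw' 0
    have hw1' := hw' 1
    -- Multiplied by the determinant, `w` and `w'` are eliminated by Cramer's rule; what remains is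
    -- ξ₁η₂ - ξ₂η₁ times the i-th equation.
    refine mul_left_cancel₀ hJ ?_
    rw [hm] at hi ⊢
    simp only [hm] at hi
    generalize pd 2 (pd 0 (f i)) (joinL z) = q02 at *
    generalize pd 3 (pd 0 (f i)) (joinL z) = q03 at *
    generalize pd 2 (pd 1 (f i)) (joinL z) = q12 at *
    generalize pd 3 (pd 1 (f i)) (joinL z) = q13 at *
    generalize pd 0 (f 0) (joinL z) = p00 at *
    generalize pd 1 (f 0) (joinL z) = p01 at *
    generalize pd 2 (f 0) (joinL z) = p02 at *
    generalize pd 3 (f 0) (joinL z) = p03 at *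
    generalize pd 0 (f 1) (joinL z) = p10 at *
    generalize pd 1 (f 1) (joinL z) = p11 at *
    generalize pd 2 (f 1) (joinL z) = p12 at *
    generalize pd 3 (f 1) (joinL z) = p13 at *
    linear_combination (q02 * ξ 0 + q12 * ξ 1) * (p13 * hw0 - p03 * hw1)
      + (q03 * ξ 0 + q13 * ξ 1) * (p02 * hw1 - p12 * hw0)
      - (q02 * η 0 + q12 * η 1) * (p13 * hw0' - p03 * hw1')
      - (q03 * η 0 + q13 * η 1) * (p02 * hw1' - p12 * hw0')
      + (ξ 0 * η 1 - ξ 1 * η 0) * hi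

end System

/-! ### The distributions of the forms (W): transversality and integrability -/

section FormWeb

/-- The coefficient `s - c` of the forms of the web, with leading coefficient `1` at `s = ∞`. -/
def coeff (c : ℝ) : OnePoint ℝ → ℝ
  | OnePoint.infty => 1
  | OnePoint.some s => s - c

@[simp] theorem coeff_infty (c : ℝ) : coeff c OnePoint.infty = 1 := rfl
@[simp] theorem coeff_coe (c s : ℝ) : coeff c (s : OnePoint ℝ) = s - c := rfl

/-- For finite parameters the determinant is (a - b)(s - t). Nonvanishing means that two different
members of a form web together annihilate the x-part and the y-part of each df^i separately. -/
theorem coeff_det_ne_zero {a b : ℝ} (hab : a ≠ b) {s t : OnePoint ℝ} (hst : s ≠ t) :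
    coeff a s * coeff b t - coeff a t * coeff b s ≠ 0 := by
  have hab' := sub_ne_zero.2 hab
  induction s using OnePoint.rec with
  | infty =>
    induction t using OnePoint.rec with
    | infty => exact absurd rfl hst
    | coe t =>
      simp only [coeff_infty, coeff_coe]
      intro h
      exact hab' (by linear_combination h)
  | coe s =>
    induction t using OnePoint.rec with
    | infty =>
      simp only [coeff_infty, coeff_coe]
      intro h
      exact hab' (by linear_combination -h)
    | coe t =>
      simp only [coeff_coe]
      have hst' : s - t ≠ 0 := sub_ne_zero.2 fun h => hst (by rw [h])
      intro h
      exact mul_ne_zero hab' hst' (by linear_combination h)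

/-- The factor does not depend on `c`, so both coefficients of a form can be passed to homogeneous
parameters at once without changing its kernel. -/
theorem exists_coeff_ratio {s₁ s₂ : ℝ} (hs : (s₁, s₂) ≠ (0, 0)) :
    ∃ k : ℝ, k ≠ 0 ∧ ∀ c, s₁ - c * s₂ = k * coeff c (ratio s₁ s₂) := by
  by_cases h : s₂ = 0
  · subst h
    refine ⟨s₁, fun h => hs (by rw [h]), fun c => ?_⟩
    simp [ratio]
  · refine ⟨s₂, h, fun c => ?_⟩
    simp only [ratio, if_neg h, coeff_coe]
    field_simp

theorem mem_formWeb {lam₁ lam₃ : ℝ} {f : Fin 2 → R4 → ℝ} {s : OnePoint ℝ} {x v : R4} :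
    v ∈ formWeb lam₁ lam₃ f s x ↔ ∀ i,
      coeff lam₃ s * (pd 0 (f i) x * v 0 + pd 1 (f i) x * v 1)
        + coeff lam₁ s * (pd 2 (f i) x * v 2 + pd 3 (f i) x * v 3) = 0 := by
  change (∀ i, webForm lam₁ lam₃ f i s x v = 0) ↔ _
  refine forall_congr' fun i => ?_
  induction s using OnePoint.rec with
  | infty => simp [webForm, dx]
  | coe s =>
    simp only [webForm, dx, add_apply, smul_apply, smul_eq_mul, EuclideanSpace.coe_proj, coeff_coe]

theorem mem_formWeb_ratio {lam₁ lam₃ : ℝ} {f : Fin 2 → R4 → ℝ} {s₁ s₂ : ℝ}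
    (hs : (s₁, s₂) ≠ (0, 0)) {x v : R4} :
    v ∈ formWeb lam₁ lam₃ f (ratio s₁ s₂) x ↔ ∀ i,
      (s₁ - lam₃ * s₂) * (pd 0 (f i) x * v 0 + pd 1 (f i) x * v 1)
        + (s₁ - lam₁ * s₂) * (pd 2 (f i) x * v 2 + pd 3 (f i) x * v 3) = 0 := by
  obtain ⟨k, hk, hc⟩ := exists_coeff_ratio hs
  rw [mem_formWeb]
  refine forall_congr' fun i => ?_
  rw [hc, hc, mul_assoc, mul_assoc, ← mul_add, mul_eq_zero, or_iff_right hk]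

theorem pairMap_ker_iff {lam₁ lam₃ : ℝ} {f : Fin 2 → R4 → ℝ} {s : OnePoint ℝ} {z v : R2 × R2}
    (hf : ∀ i, DifferentiableAt ℝ (f i) (joinL z)) :
    joinL v ∈ formWeb lam₁ lam₃ f s (joinL z) ↔ coeff lam₃ s • fderiv ℝ (pairMap f) z (v.1, 0)
      + coeff lam₁ s • fderiv ℝ (pairMap f) z (0, v.2) = 0 := by
  rw [mem_formWeb, PiLp.ext_iff]
  refine forall_congr' fun i => ?_
  have h1 : fderiv ℝ (pairMap f) z (v.1, 0) i = _ := dFst_pairMap_apply hf v.1 i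
  have h2 : fderiv ℝ (pairMap f) z (0, v.2) i = _ := dSnd_pairMap_apply hf v.2 i
  rw [PiLp.add_apply, PiLp.smul_apply, PiLp.smul_apply, h1, h2]
  rfl

theorem disjoint_formWeb {lam₁ lam₃ : ℝ} (hlam : lam₁ ≠ lam₃) {f : Fin 2 → R4 → ℝ} {x : R4}
    (hJ : JacobiansAt f x) {s t : OnePoint ℝ} (hst : s ≠ t) :
    Disjoint (formWeb lam₁ lam₃ f s x) (formWeb lam₁ lam₃ f t x) := by
  rw [Submodule.disjoint_def]
  intro v hs ht
  have hs := mem_formWeb.1 hs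
  have ht := mem_formWeb.1 ht
  have hdet := coeff_det_ne_zero hlam.symm hst
  have h := fun i => eq_zero_of_det_ne_zero hdet (hs i) (ht i)
  obtain ⟨hA, hB⟩ := hJ
  simp only [minor, sub_zero] at hA hB
  obtain ⟨h0, h1⟩ := eq_zero_of_det_ne_zero hA (h 0).1 (h 1).1
  obtain ⟨h2, h3⟩ := eq_zero_of_det_ne_zero hB (h 0).2 (h 1).2
  refine PiLp.ext (α := fun _ : Fin 4 => ℝ) (p := 2) fun j => ?_
  fin_cases j
  exacts [h0, h1, h2, h3]

theorem straightAt_formWeb {lam₁ lam₃ : ℝ} (hlam : lam₁ ≠ lam₃) {f : Fin 2 → R4 → ℝ} {x : R4}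
    (hJ : JacobiansAt f x) : StraightAt lam₁ lam₃ (formWeb lam₁ lam₃ f) x := by
  obtain ⟨hA, hB⟩ := hJ
  simp only [minor, sub_zero] at hA hB
  constructor
  · intro v
    rw [mem_formWeb]
    simp only [coeff_coe, sub_self, zero_mul, add_zero, mul_eq_zero,
      or_iff_right (sub_ne_zero.2 hlam)]
    refine ⟨fun h => eq_zero_of_det_ne_zero hA (h 0) (h 1), fun h i => ?_⟩
    have h0 : v 0 = 0 := h.1
    have h1 : v 1 = 0 := h.2
    rw [h0, h1, mul_zero, mul_zero, add_zero]
  · intro v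
    rw [mem_formWeb]
    simp only [coeff_coe, sub_self, zero_mul, zero_add, mul_eq_zero,
      or_iff_right (sub_ne_zero.2 hlam.symm)]
    refine ⟨fun h => eq_zero_of_det_ne_zero hB (h 0) (h 1), fun h i => ?_⟩
    have h0 : v 2 = 0 := h.1
    have h1 : v 3 = 0 := h.2
    rw [h0, h1, mul_zero, mul_zero, add_zero]

theorem inftyLevelAt_formWeb (lam₁ lam₃ : ℝ) (f : Fin 2 → R4 → ℝ) (x : R4) :
    InftyLevelAt f (formWeb lam₁ lam₃ f) x := by
  intro v
  rw [mem_formWeb]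
  refine forall_congr' fun i => ?_
  rw [fderiv_apply_eq, coeff_infty, one_mul, coeff_infty, one_mul, ← add_assoc]

theorem finrank_of_isFoliationOn {E : Type*} [NormedAddCommGroup E] [NormedSpace ℝ E]
    [FiniteDimensional ℝ E] {M : Type*} [TopologicalSpace M] [ChartedSpace E M] {q : ℕ}
    {D : ∀ x : M, Submodule ℝ (TangentSpace 𝓘(ℝ, E) x)} {U : Set M} (h : IsFoliationOn q D U)
    {x : M} (hx : x ∈ U) : q + Module.finrank ℝ (D x) = Module.finrank ℝ E := by
  obtain ⟨V, -, hxV, -, h, -, hV⟩ := h x hx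
  obtain ⟨hsurj, hker⟩ := hV x hxV
  let T : E →ₗ[ℝ] EuclideanSpace ℝ (Fin q) :=
    (mfderiv 𝓘(ℝ, E) 𝓘(ℝ, EuclideanSpace ℝ (Fin q)) h x).toLinearMap
  have hD : D x = LinearMap.ker T := Submodule.ext fun v => hker v
  have hT : LinearMap.range T = ⊤ := LinearMap.range_eq_top.2 hsurj
  have := T.finrank_range_add_finrank_ker
  rw [hT, finrank_top, finrank_euclideanSpace_fin] at this
  rw [hD]
  exact this

theorem isFoliationOn_of_fderiv {D : ∀ x : R4, Submodule ℝ (TangentSpace 𝓘(ℝ, R4) x)}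
    {U : Set R4} (h : ∀ p ∈ U, ∃ V : Set R4, IsOpen V ∧ p ∈ V ∧ V ⊆ U ∧ ∃ h : R4 → R2,
      ContDiffOn ℝ ∞ h V ∧ ∀ x ∈ V, Function.Surjective (fderiv ℝ h x) ∧
        ∀ v : R4, v ∈ D x ↔ fderiv ℝ h x v = 0) : IsFoliationOn 2 D U := by
  intro p hp
  obtain ⟨V, hV, hpV, hVU, h, hh, hD⟩ := h p hp
  refine ⟨V, hV, hpV, hVU, h, contMDiffOn_iff_contDiffOn.2 hh, fun x hx => ?_⟩
  rw [mfderiv_eq_fderiv]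
  exact hD x hx

theorem isFoliationOn_formWeb {lam₁ lam₃ : ℝ} (hlam : lam₁ ≠ lam₃) {U : Set R4}
    {f : Fin 2 → R4 → ℝ} (hU : IsOpen U) (hf : ∀ i, ContDiffOn ℝ ∞ (f i) U)
    (hsol : ∀ x ∈ U, SolvesAt f x) (hJ : ∀ x ∈ U, JacobiansAt f x) (s : OnePoint ℝ) :
    IsFoliationOn 2 (formWeb lam₁ lam₃ f s) U := by
  have hd : ∀ x ∈ U, ∀ i, DifferentiableAt ℝ (f i) x := fun x hx i =>
    ((hf i).contDiffAt (hU.mem_nhds hx)).differentiableAt (by simp)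
  refine isFoliationOn_of_fderiv fun p hp => ?_
  -- Only s = λ₁ has b = 0, where the distribution is vertical and not a graph over the first
  -- factor; (x₁, x₂) is then a first integral. The parameters λ₃ and ∞ need no special treatment.
  by_cases hb : coeff lam₁ s = 0
  · have hs : s = (lam₁ : OnePoint ℝ) := by
      induction s using OnePoint.rec with
      | infty => simp at hb
      | coe s => rw [sub_eq_zero.1 hb]
    let T : R4 →L[ℝ] R2 := (ContinuousLinearMap.fst ℝ R2 R2).comp joinL.symm.toContinuousLinearMap
    refine ⟨U, hU, hp, le_rfl, T, T.contDiff.contDiffOn, fun x hx => ?_⟩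
    rw [T.fderiv, hs]
    refine ⟨fun u => ⟨joinL (u, 0), congrArg Prod.fst (joinL.symm_apply_apply (u, 0))⟩, fun v => ?_⟩
    rw [(straightAt_formWeb hlam (hJ x hx)).1 v, PiLp.ext_iff, Fin.forall_fin_two]
    rfl
  · have hopen : IsOpen (joinL ⁻¹' U) := hU.preimage joinL.continuous
    have hp' : joinL.symm p ∈ joinL ⁻¹' U := by
      change joinL (joinL.symm p) ∈ U
      rwa [joinL.apply_symm_apply]
    obtain ⟨h, S, hS, hpS, hSU, hh, hker⟩ := exists_firstIntegral_of_mixedSymmetric hopen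
      (contDiffOn_pairMap hf)
      (fun z hz => dSnd_pairMap_isInvertible (hd _ hz) (hJ _ hz).2)
      (fun z hz => (mixedSymmetricAt_pairMap_iff hU hf hz (hJ _ hz).2).2 (hsol _ hz))
      (a := coeff lam₃ s) hb hp'
    refine ⟨joinL.symm ⁻¹' S, hS.preimage joinL.symm.continuous, hpS, fun x hx => ?_,
      h ∘ joinL.symm, hh.comp joinL.symm.contDiff.contDiffOn fun x hx => hx, fun x hx => ?_⟩
    · simpa using hSU hx
    · obtain ⟨h1, h2⟩ := hker _ hx
      rw [ContinuousLinearEquiv.comp_right_fderiv]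
      refine ⟨h1.comp joinL.symm.surjective, fun v => ?_⟩
      obtain ⟨w, rfl⟩ := joinL.surjective v
      obtain ⟨z, rfl⟩ := joinL.surjective x
      rw [pairMap_ker_iff (hd _ (by simpa using hSU hx))]
      simp only [ContinuousLinearMap.comp_apply, ContinuousLinearEquiv.coe_coe,
        ContinuousLinearEquiv.symm_apply_apply] at h2 ⊢
      exact (h2 w).symm

theorem isCompl_of_isFoliationOn {D D' : ∀ x : R4, Submodule ℝ (TangentSpace 𝓘(ℝ, R4) x)}
    {U : Set R4} (h : IsFoliationOn 2 D U) (h' : IsFoliationOn 2 D' U) {x : R4} (hx : x ∈ U)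
    (hd : Disjoint (D x) (D' x)) : IsCompl (D x) (D' x) := by
  have : FiniteDimensional ℝ (TangentSpace 𝓘(ℝ, R4) x) := inferInstanceAs (FiniteDimensional ℝ R4)
  refine ⟨hd, codisjoint_iff.2 (Submodule.eq_top_of_disjoint _ _ ?_ hd)⟩
  have h1 := finrank_of_isFoliationOn (E := R4) h hx
  have h2 := finrank_of_isFoliationOn (E := R4) h' hx
  have h3 : Module.finrank ℝ (TangentSpace 𝓘(ℝ, R4) x) = 4 := finrank_euclideanSpace_fin
  rw [finrank_euclideanSpace_fin] at h1 h2
  omega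

/-- A frame of the foliation at infinity, with coordinates polynomial in the derivatives. -/
def inftyFrame (f : Fin 2 → R4 → ℝ) (a : Fin 2) (x : R4) : R4 :=
  join
    (minor f 0 2 3 x • (if a = 0 then !₂[pd 1 (f 1) x, -pd 0 (f 1) x]
      else !₂[-pd 1 (f 0) x, pd 0 (f 0) x]))
    (minor f 0 0 1 x • (if a = 0 then !₂[-pd 3 (f 1) x, pd 2 (f 1) x]
      else !₂[pd 3 (f 0) x, -pd 2 (f 0) x]))

/-- The companion of `inftyFrame`, a frame of the foliation at `0`. -/
def zeroFrame (lam₁ lam₃ : ℝ) (f : Fin 2 → R4 → ℝ) (a : Fin 2) (x : R4) : R4 :=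
  join (-lam₁ • firstPair (inftyFrame f a x)) (-lam₃ • lastPair (inftyFrame f a x))

theorem contDiffOn_pd {g : R4 → ℝ} {U : Set R4} (hU : IsOpen U) (hg : ContDiffOn ℝ ∞ g U)
    (j : Fin 4) : ContDiffOn ℝ ∞ (pd j g) U :=
  (hg.fderiv_of_isOpen hU (by simp)).clm_apply contDiffOn_const

theorem contDiffOn_minor {f : Fin 2 → R4 → ℝ} {U : Set R4} (hU : IsOpen U)
    (hf : ∀ i, ContDiffOn ℝ ∞ (f i) U) (i : Fin 2) (j k : Fin 4) :
    ContDiffOn ℝ ∞ (minor f i j k) U :=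
  ((contDiffOn_pd hU (hf _) j).mul (contDiffOn_pd hU (hf _) k)).sub
    ((contDiffOn_pd hU (hf _) j).mul (contDiffOn_pd hU (hf _) k))

theorem contDiffOn_inftyFrame {f : Fin 2 → R4 → ℝ} {U : Set R4} (hU : IsOpen U)
    (hf : ∀ i, ContDiffOn ℝ ∞ (f i) U) (a : Fin 2) : ContDiffOn ℝ ∞ (inftyFrame f a) U := by
  have hp := fun i j => contDiffOn_pd hU (hf i) j
  have hm := fun j k => contDiffOn_minor hU hf 0 j k
  refine contDiffOn_euclidean.2 fun j => ?_
  fin_cases j <;> fin_cases a <;> simp [inftyFrame]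
  exacts [(hm 2 3).mul (hp 1 1), ((hm 2 3).mul (hp 0 1)).neg, ((hm 2 3).mul (hp 1 0)).neg,
    (hm 2 3).mul (hp 0 0), ((hm 0 1).mul (hp 1 3)).neg, (hm 0 1).mul (hp 0 3),
    (hm 0 1).mul (hp 1 2), ((hm 0 1).mul (hp 0 2)).neg]

theorem contDiffOn_zeroFrame (lam₁ lam₃ : ℝ) {f : Fin 2 → R4 → ℝ} {U : Set R4} (hU : IsOpen U)
    (hf : ∀ i, ContDiffOn ℝ ∞ (f i) U) (a : Fin 2) :
    ContDiffOn ℝ ∞ (zeroFrame lam₁ lam₃ f a) U := by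
  have h := contDiffOn_euclidean.1 (contDiffOn_inftyFrame hU hf a)
  refine contDiffOn_euclidean.2 fun j => ?_
  fin_cases j
  exacts [(h 0).const_smul (-lam₁), (h 1).const_smul (-lam₁), (h 2).const_smul (-lam₃),
    (h 3).const_smul (-lam₃)]

end FormWeb

/-! ### The Kronecker pencil of a form web -/

section FormWebPencil

variable {lam₁ lam₃ : ℝ} {f : Fin 2 → R4 → ℝ} {x : R4}

/-- The frame is built from the adjugates of the two Jacobian blocks, each multiplied by the
determinant of the other. It is thus dual, up to the common factor δ, to the x-parts of the df^i,
and up to -δ to their y-parts. -/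
theorem inftyFrame_first (f : Fin 2 → R4 → ℝ) (x : R4) (i a : Fin 2) :
    pd 0 (f i) x * inftyFrame f a x 0 + pd 1 (f i) x * inftyFrame f a x 1
      = if i = a then minor f 0 0 1 x * minor f 0 2 3 x else 0 := by
  fin_cases i <;> fin_cases a <;> simp [inftyFrame, minor] <;> ring

theorem inftyFrame_last (f : Fin 2 → R4 → ℝ) (x : R4) (i a : Fin 2) :
    pd 2 (f i) x * inftyFrame f a x 2 + pd 3 (f i) x * inftyFrame f a x 3
      = -(if i = a then minor f 0 0 1 x * minor f 0 2 3 x else 0) := by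
  fin_cases i <;> fin_cases a <;> simp [inftyFrame, minor] <;> ring

theorem zeroFrame_apply (lam₁ lam₃ : ℝ) (f : Fin 2 → R4 → ℝ) (a : Fin 2) (x : R4) (j : Fin 4) :
    zeroFrame lam₁ lam₃ f a x j
      = (if j = 0 ∨ j = 1 then -lam₁ else -lam₃) * inftyFrame f a x j := by
  fin_cases j <;> simp [zeroFrame]

/-- On the vector with coefficients c the x-part of df^i is (s₁ - λ₁s₂) δ c_i and the y-part is -(s₁
- λ₃s₂) δ c_i, so the two terms of the form cancel. Conversely c can be read off from a block whose
factor is nonzero. -/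
theorem formWeb_frame (hJ : JacobiansAt f x) (hlam : lam₁ ≠ lam₃) {s₁ s₂ : ℝ}
    (hs : (s₁, s₂) ≠ (0, 0)) (v : R4) :
    v ∈ formWeb lam₁ lam₃ f (ratio s₁ s₂) x ↔ ∃ c : Fin 2 → ℝ,
      v = ∑ a, c a • (s₁ • inftyFrame f a x + s₂ • zeroFrame lam₁ lam₃ f a x) := by
  rw [mem_formWeb_ratio hs]
  set δ := minor f 0 0 1 x * minor f 0 2 3 x with hδ
  have hδ0 : δ ≠ 0 := mul_ne_zero hJ.1 hJ.2
  have hfirst := fun i a => (inftyFrame_first f x i a)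
  have hlast := fun i a => (inftyFrame_last f x i a)
  have hdual : ∀ w : R4, (∀ i, pd 0 (f i) x * w 0 + pd 1 (f i) x * w 1 = 0) →
      (∀ i, pd 2 (f i) x * w 2 + pd 3 (f i) x * w 3 = 0) → w = 0 := by
    intro w h h'
    obtain ⟨hA, hB⟩ := hJ
    simp only [minor, sub_zero] at hA hB
    obtain ⟨h0, h1⟩ := eq_zero_of_det_ne_zero hA (h 0) (h 1)
    obtain ⟨h2, h3⟩ := eq_zero_of_det_ne_zero hB (h' 0) (h' 1)
    ext j
    fin_cases j
    exacts [h0, h1, h2, h3]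
  have hF : ∀ (c : Fin 2 → ℝ) (i : Fin 2),
      pd 0 (f i) x * (∑ a, c a • (s₁ • inftyFrame f a x + s₂ • zeroFrame lam₁ lam₃ f a x)) 0
        + pd 1 (f i) x * (∑ a, c a • (s₁ • inftyFrame f a x + s₂ • zeroFrame lam₁ lam₃ f a x)) 1
        = (s₁ - lam₁ * s₂) * δ * c i := by
    intro c i
    have h0 := hfirst i 0
    have h1 := hfirst i 1
    simp only [Fin.sum_univ_two, PiLp.add_apply, PiLp.smul_apply, zeroFrame_apply, smul_eq_mul]
    rw [← hδ] at h0 h1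
    norm_num
    fin_cases i
    · simp at h0 h1 ⊢
      linear_combination (s₁ - lam₁ * s₂) * (c 0 * h0 + c 1 * h1)
    · simp at h0 h1 ⊢
      linear_combination (s₁ - lam₁ * s₂) * (c 0 * h0 + c 1 * h1)
  have hL : ∀ (c : Fin 2 → ℝ) (i : Fin 2),
      pd 2 (f i) x * (∑ a, c a • (s₁ • inftyFrame f a x + s₂ • zeroFrame lam₁ lam₃ f a x)) 2
        + pd 3 (f i) x * (∑ a, c a • (s₁ • inftyFrame f a x + s₂ • zeroFrame lam₁ lam₃ f a x)) 3
        = -((s₁ - lam₃ * s₂) * δ * c i) := by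
    intro c i
    have h0 := hlast i 0
    have h1 := hlast i 1
    simp only [Fin.sum_univ_two, PiLp.add_apply, PiLp.smul_apply, zeroFrame_apply, smul_eq_mul]
    rw [← hδ] at h0 h1
    norm_num
    fin_cases i
    · simp at h0 h1 ⊢
      linear_combination (s₁ - lam₃ * s₂) * (c 0 * h0 + c 1 * h1)
    · simp at h0 h1 ⊢
      linear_combination (s₁ - lam₃ * s₂) * (c 0 * h0 + c 1 * h1)
  constructor
  · intro hv
    -- Both factors vanish together only at (0, 0), because λ₁ ≠ λ₃.
    have hpr : s₁ - lam₁ * s₂ ≠ 0 ∨ s₁ - lam₃ * s₂ ≠ 0 := by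
      by_contra! h
      have h2 : s₂ = 0 := by
        refine (mul_eq_zero.1 ?_).resolve_left (sub_ne_zero.2 hlam)
        linear_combination h.2 - h.1
      refine hs ?_
      have h1 := h.1
      rw [h2, mul_zero, sub_zero] at h1
      rw [h1, h2]
    rcases hpr with hp | hp
    · refine ⟨fun i => (pd 0 (f i) x * v 0 + pd 1 (f i) x * v 1) / ((s₁ - lam₁ * s₂) * δ), ?_⟩
      rw [← sub_eq_zero]
      refine hdual _ (fun i => ?_) (fun i => ?_)
      · have := hF (fun i => (pd 0 (f i) x * v 0 + pd 1 (f i) x * v 1)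
          / ((s₁ - lam₁ * s₂) * δ)) i
        rw [mul_div_cancel₀ _ (mul_ne_zero hp hδ0)] at this
        simp only [PiLp.sub_apply]
        linear_combination -this
      · have := hL (fun i => (pd 0 (f i) x * v 0 + pd 1 (f i) x * v 1)
          / ((s₁ - lam₁ * s₂) * δ)) i
        simp only [PiLp.sub_apply]
        have h3 : (s₁ - lam₃ * s₂) * δ * ((pd 0 (f i) x * v 0 + pd 1 (f i) x * v 1)
            / ((s₁ - lam₁ * s₂) * δ)) = -(pd 2 (f i) x * v 2 + pd 3 (f i) x * v 3) := by
          rw [mul_div_assoc', div_eq_iff (mul_ne_zero hp hδ0)]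
          linear_combination δ * hv i
        rw [h3] at this
        linear_combination -this
    · refine ⟨fun i => -(pd 2 (f i) x * v 2 + pd 3 (f i) x * v 3) / ((s₁ - lam₃ * s₂) * δ), ?_⟩
      rw [← sub_eq_zero]
      refine hdual _ (fun i => ?_) (fun i => ?_)
      · have := hF (fun i => -(pd 2 (f i) x * v 2 + pd 3 (f i) x * v 3)
          / ((s₁ - lam₃ * s₂) * δ)) i
        simp only [PiLp.sub_apply]
        have h3 : (s₁ - lam₁ * s₂) * δ * (-(pd 2 (f i) x * v 2 + pd 3 (f i) x * v 3)
            / ((s₁ - lam₃ * s₂) * δ)) = pd 0 (f i) x * v 0 + pd 1 (f i) x * v 1 := by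
          rw [mul_div_assoc', div_eq_iff (mul_ne_zero hp hδ0)]
          linear_combination -δ * hv i
        rw [h3] at this
        linear_combination -this
      · have := hL (fun i => -(pd 2 (f i) x * v 2 + pd 3 (f i) x * v 3)
          / ((s₁ - lam₃ * s₂) * δ)) i
        rw [mul_div_cancel₀ _ (mul_ne_zero hp hδ0)] at this
        simp only [PiLp.sub_apply]
        linear_combination -this
  · rintro ⟨c, rfl⟩ i
    rw [hF, hL]
    ring

/-- The two blocks diagonalise the pencil with factors z₁ - λ₁z₂ and z₁ - λ₃z₂, not both zero even
for complex parameters. A multiple of the dual covectors in a block with nonzero factor attains the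
prescribed values. -/
theorem exists_complex_covector (hJ : JacobiansAt f x) (hlam : lam₁ ≠ lam₃) {z₁ z₂ : ℂ}
    (hz : (z₁, z₂) ≠ (0, 0)) (c : Fin 2 → ℂ) : ∃ β : R4 →L[ℝ] ℂ, ∀ a,
      z₁ * β (inftyFrame f a x) + z₂ * β (zeroFrame lam₁ lam₃ f a x) = c a := by
  set δ := minor f 0 0 1 x * minor f 0 2 3 x with hδ
  have hδ0 : (δ : ℂ) ≠ 0 := Complex.ofReal_ne_zero.2 (mul_ne_zero hJ.1 hJ.2)
  have hfirst := fun i a => (inftyFrame_first f x i a)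
  have hlast := fun i a => (inftyFrame_last f x i a)
  rw [← hδ] at hfirst hlast
  have hpr : z₁ - lam₁ * z₂ ≠ 0 ∨ z₁ - lam₃ * z₂ ≠ 0 := by
    by_contra! h
    have h2 : z₂ = 0 := by
      refine (mul_eq_zero.1 ?_).resolve_left (sub_ne_zero.2 (Complex.ofReal_injective.ne hlam))
      linear_combination h.2 - h.1
    refine hz ?_
    have h1 := h.1
    rw [h2, mul_zero, sub_zero] at h1
    rw [h1, h2]
  rcases hpr with hp | hp
  · refine ⟨∑ i, (pd 0 (f i) x • dx 0 + pd 1 (f i) x • dx 1).smulRight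
      (c i / ((z₁ - lam₁ * z₂) * δ)), fun a => ?_⟩
    have h1 : ∀ i, (pd 0 (f i) x • dx 0 + pd 1 (f i) x • dx 1) (inftyFrame f a x)
        = if i = a then δ else 0 := fun i => hfirst i a
    have h2 : ∀ i, (pd 0 (f i) x • dx 0 + pd 1 (f i) x • dx 1) (zeroFrame lam₁ lam₃ f a x)
        = -lam₁ * if i = a then δ else 0 := fun i => by
      rw [← hfirst i a]
      simp [dx, zeroFrame_apply]
      ring
    simp only [sum_apply, ContinuousLinearMap.smulRight_apply, h1, h2]
    fin_cases a <;> simp <;> field_simp <;> ring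
  · refine ⟨∑ i, (pd 2 (f i) x • dx 2 + pd 3 (f i) x • dx 3).smulRight
      (-c i / ((z₁ - lam₃ * z₂) * δ)), fun a => ?_⟩
    have h1 : ∀ i, (pd 2 (f i) x • dx 2 + pd 3 (f i) x • dx 3) (inftyFrame f a x)
        = -if i = a then δ else 0 := fun i => hlast i a
    have h2 : ∀ i, (pd 2 (f i) x • dx 2 + pd 3 (f i) x • dx 3) (zeroFrame lam₁ lam₃ f a x)
        = -lam₃ * -if i = a then δ else 0 := fun i => by
      rw [← hlast i a]
      simp [dx, zeroFrame_apply]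
      ring
    simp only [sum_apply, ContinuousLinearMap.smulRight_apply, h1, h2]
    fin_cases a <;> simp <;> field_simp <;> ring

theorem isThreeWebTypeOn_formWeb (hlam : lam₁ ≠ lam₃) {U : Set R4} (hU : IsOpen U)
    (hf : ∀ i, ContDiffOn ℝ ∞ (f i) U) (hsol : ∀ x ∈ U, SolvesAt f x)
    (hJ : ∀ x ∈ U, JacobiansAt f x) : IsThreeWebTypeOn (formWeb lam₁ lam₃ f) U := by
  have hfol := isFoliationOn_formWeb hlam hU hf hsol hJ
  have hcompl : ∀ s t : OnePoint ℝ, s ≠ t → ∀ x ∈ U,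
      IsCompl (formWeb lam₁ lam₃ f s x) (formWeb lam₁ lam₃ f t x) := fun s t hst x hx =>
    isCompl_of_isFoliationOn (hfol s) (hfol t) hx (disjoint_formWeb hlam (hJ x hx) hst)
  refine ⟨⟨hfol, fun p hp => ⟨U, hU, hp, le_rfl, 2, fun a x => inftyFrame f a x,
    fun a x => zeroFrame lam₁ lam₃ f a x,
    fun a => contMDiffOn_vectorSpace_iff_contDiffOn.2 (contDiffOn_inftyFrame hU hf a),
    fun a => contMDiffOn_vectorSpace_iff_contDiffOn.2 (contDiffOn_zeroFrame lam₁ lam₃ hU hf a),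
    fun x hx => ⟨fun s₁ s₂ hs α => ?_,
      fun z₁ z₂ hz c => exists_complex_covector (hJ x hx) hlam hz c⟩⟩⟩,
    hcompl _ _ (OnePoint.infty_ne_coe 0), hcompl _ _ (OnePoint.infty_ne_coe 1),
    hcompl _ _ (OnePoint.coe_injective.ne zero_ne_one)⟩
  constructor
  · intro h v hv
    obtain ⟨c, hc⟩ := (formWeb_frame (hJ x hx) hlam hs v).1 hv
    let α' : R4 →L[ℝ] ℝ := α
    have h' : ∀ a, s₁ * α' (inftyFrame f a x) + s₂ * α' (zeroFrame lam₁ lam₃ f a x) = 0 := h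
    change α' v = 0
    rw [hc, map_sum]
    refine Finset.sum_eq_zero fun a _ => ?_
    rw [map_smul, map_add, map_smul, map_smul, smul_eq_mul s₁, smul_eq_mul s₂, h' a, smul_zero]
  · intro h a
    let α' : R4 →L[ℝ] ℝ := α
    have h1 : α' (s₁ • inftyFrame f a x + s₂ • zeroFrame lam₁ lam₃ f a x) = 0 := by
      refine h _ ((formWeb_frame (hJ x hx) hlam hs _).2 ⟨Pi.single a 1, ?_⟩)
      rw [Finset.sum_eq_single a (fun b _ hb => by simp [Pi.single_eq_of_ne hb])
        (fun h => absurd (Finset.mem_univ a) h), Pi.single_eq_same, one_smul]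
    rw [map_add, map_smul, map_smul] at h1
    exact h1

end FormWebPencil

/-! ### Linear algebra of Kronecker pencils at a point -/

section LinearWebs

theorem exists_ratio (s : OnePoint ℝ) : ∃ s₁ s₂ : ℝ, (s₁, s₂) ≠ (0, 0) ∧ ratio s₁ s₂ = s := by
  induction s using OnePoint.rec with
  | infty => exact ⟨1, 0, by simp, by simp [ratio]⟩
  | coe s => exact ⟨s, 1, by simp, by simp [ratio]⟩

theorem det_ne_zero_of_ratio_ne {s₁ s₂ t₁ t₂ : ℝ} (hs : (s₁, s₂) ≠ (0, 0))
    (ht : (t₁, t₂) ≠ (0, 0)) (hst : ratio s₁ s₂ ≠ ratio t₁ t₂) : s₁ * t₂ - t₁ * s₂ ≠ 0 := by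
  intro h
  refine hst ?_
  unfold ratio
  by_cases hs₂ : s₂ = 0
  · have hs₁ : s₁ ≠ 0 := fun h => hs (by rw [h, hs₂])
    have ht₂ : t₂ = 0 := by
      rw [hs₂, mul_zero, sub_zero] at h
      exact (mul_eq_zero.1 h).resolve_left hs₁
    rw [if_pos hs₂, if_pos ht₂]
  · have ht₂ : t₂ ≠ 0 := by
      rintro rfl
      rw [mul_zero, zero_sub, neg_eq_zero] at h
      exact ht (by rw [(mul_eq_zero.1 h).resolve_right hs₂])
    rw [if_neg hs₂, if_neg ht₂]
    congr 1
    field_simp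
    linear_combination h

/-- The condition on a Kronecker web at a point: the distributions are annihilated by the kernels
of a pencil of linear maps without complex singular members. -/
def IsLinearWeb (F : OnePoint ℝ → Submodule ℝ R4) : Prop :=
  ∃ (k : ℕ) (X₁ X₂ : Fin k → R4),
    (∀ s₁ s₂ : ℝ, (s₁, s₂) ≠ (0, 0) → ∀ α : R4 →L[ℝ] ℝ,
      (∀ a, s₁ * α (X₁ a) + s₂ * α (X₂ a) = 0) ↔ ∀ v ∈ F (ratio s₁ s₂), α v = 0) ∧
    (∀ z₁ z₂ : ℂ, (z₁, z₂) ≠ (0, 0) → ∀ c : Fin k → ℂ,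
      ∃ β : R4 →L[ℝ] ℂ, ∀ a, z₁ * β (X₁ a) + z₂ * β (X₂ a) = c a)

/-- Used to read a web on a manifold in a chart. Only the pointwise condition is transported, so the
smoothness of the pencil fields need not be followed through the chart. -/
theorem IsLinearWeb.comap {F : OnePoint ℝ → Submodule ℝ R4} (hF : IsLinearWeb F)
    (e : R4 ≃L[ℝ] R4) : IsLinearWeb fun s => (F s).comap (e : R4 →ₗ[ℝ] R4) := by
  obtain ⟨k, X₁, X₂, hreal, hcomplex⟩ := hF
  refine ⟨k, fun a => e.symm (X₁ a), fun a => e.symm (X₂ a), fun s₁ s₂ hs α => ?_,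
    fun z₁ z₂ hz c => ?_⟩
  · refine (hreal s₁ s₂ hs (α.comp (e.symm : R4 →L[ℝ] R4))).trans
      ⟨fun h v hv => ?_, fun h v hv => ?_⟩
    · simpa using h (e v) hv
    · exact h (e.symm v) (by simpa using hv)
  · obtain ⟨β, hβ⟩ := hcomplex z₁ z₂ hz c
    exact ⟨β.comp (e : R4 →L[ℝ] R4), fun a => by simpa using hβ a⟩

theorem eq_of_annihilators_eq {V W : Submodule ℝ R4}
    (h : ∀ α : R4 →L[ℝ] ℝ, (∀ v ∈ V, α v = 0) ↔ ∀ v ∈ W, α v = 0) : V = W := by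
  have key : ∀ V W : Submodule ℝ R4,
      (∀ α : R4 →L[ℝ] ℝ, (∀ v ∈ V, α v = 0) → ∀ v ∈ W, α v = 0) → W ≤ V := by
    intro V W h v hv
    by_contra hvV
    obtain ⟨g, hg, hgV⟩ := Submodule.exists_le_ker_of_notMem hvV
    exact hg (h g.toContinuousLinearMap (fun u hu => hgV hu) v hv)
  exact le_antisymm (key W V fun α => (h α).2) (key V W fun α => (h α).1)

/-- A subspace is determined by its annihilator; this dualises the kernel condition into explicit
spanning vectors. -/
theorem span_pencil {F : OnePoint ℝ → Submodule ℝ R4} {k : ℕ} {X₁ X₂ : Fin k → R4} {s₁ s₂ : ℝ}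
    (h : ∀ α : R4 →L[ℝ] ℝ, (∀ a, s₁ * α (X₁ a) + s₂ * α (X₂ a) = 0) ↔
      ∀ v ∈ F (ratio s₁ s₂), α v = 0) :
    F (ratio s₁ s₂) = Submodule.span ℝ (Set.range fun a => s₁ • X₁ a + s₂ • X₂ a) := by
  refine eq_of_annihilators_eq fun α => (h α).symm.trans ⟨fun hα => ?_, fun hα a => ?_⟩
  · have : Submodule.span ℝ (Set.range fun a => s₁ • X₁ a + s₂ • X₂ a)
        ≤ LinearMap.ker (α : R4 →ₗ[ℝ] ℝ) := by
      rw [Submodule.span_le]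
      rintro _ ⟨a, rfl⟩
      simpa using hα a
    exact fun v hv => this hv
  · simpa using hα _ (Submodule.subset_span ⟨a, rfl⟩)

/-- Surjectivity of the pencil makes each of the families X₁ and X₂ linearly independent.
Transversality at ∞ and 0 makes the two together independent, and a nonzero 2 × 2 determinant of
parameters then separates any two members. -/
theorem IsLinearWeb.disjoint {F : OnePoint ℝ → Submodule ℝ R4} (hF : IsLinearWeb F)
    (h0 : Disjoint (F OnePoint.infty) (F ((0 : ℝ) : OnePoint ℝ))) {s t : OnePoint ℝ}
    (hst : s ≠ t) : Disjoint (F s) (F t) := by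
  obtain ⟨k, X₁, X₂, hreal, hcomplex⟩ := hF
  obtain ⟨s₁, s₂, hs, rfl⟩ := exists_ratio s
  obtain ⟨t₁, t₂, ht, rfl⟩ := exists_ratio t
  have hdet := det_ne_zero_of_ratio_ne hs ht hst
  have hinf : ratio 1 0 = OnePoint.infty := by simp [ratio]
  have hzero : ratio 0 1 = ((0 : ℝ) : OnePoint ℝ) := by simp [ratio]
  have hspan := fun s₁ s₂ hs => span_pencil (hreal s₁ s₂ hs)
  have hmem1 : ∀ c : Fin k → ℝ, ∑ a, c a • X₁ a ∈ F OnePoint.infty := fun c => by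
    rw [← hinf, hspan 1 0 (by simp)]
    exact Submodule.sum_mem _ fun a _ => Submodule.smul_mem _ _
      (Submodule.subset_span ⟨a, by simp⟩)
  have hmem2 : ∀ c : Fin k → ℝ, ∑ a, c a • X₂ a ∈ F ((0 : ℝ) : OnePoint ℝ) := fun c => by
    rw [← hzero, hspan 0 1 (by simp)]
    exact Submodule.sum_mem _ fun a _ => Submodule.smul_mem _ _
      (Submodule.subset_span ⟨a, by simp⟩)
  have hindep : ∀ z₁ z₂ : ℝ, (z₁, z₂) ≠ (0, 0) → ∀ c : Fin k → ℝ,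
      z₁ • ∑ a, c a • X₁ a + z₂ • ∑ a, c a • X₂ a = 0 → c = 0 := by
    intro z₁ z₂ hz c hc
    funext b
    obtain ⟨β, hβ⟩ := hcomplex z₁ z₂ (by simpa using hz) (Pi.single b 1)
    have h1 := congrArg β hc
    rw [map_zero, map_add, map_smul, map_smul, map_sum, map_sum, Finset.smul_sum,
      Finset.smul_sum, ← Finset.sum_add_distrib, Finset.sum_eq_single b] at h1
    · have h2 := hβ b
      rw [Pi.single_eq_same] at h2
      simp only [map_smul, Complex.real_smul] at h1
      have h3 : (c b : ℂ) = 0 := by linear_combination h1 - c b * h2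
      exact_mod_cast h3
    · intro a _ hab
      have h2 := hβ a
      rw [Pi.single_eq_of_ne hab] at h2
      simp only [map_smul, Complex.real_smul]
      linear_combination c a * h2
    · exact fun h => absurd (Finset.mem_univ b) h
  rw [Submodule.disjoint_def]
  intro v hvs hvt
  rw [hspan s₁ s₂ hs, Submodule.mem_span_range_iff_exists_fun] at hvs
  rw [hspan t₁ t₂ ht, Submodule.mem_span_range_iff_exists_fun] at hvt
  obtain ⟨c, rfl⟩ := hvs
  obtain ⟨d, hd⟩ := hvt
  have hsum : ∀ (u₁ u₂ : ℝ) (c : Fin k → ℝ), ∑ a, c a • (u₁ • X₁ a + u₂ • X₂ a)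
      = u₁ • ∑ a, c a • X₁ a + u₂ • ∑ a, c a • X₂ a := fun u₁ u₂ c => by
    simp only [Finset.smul_sum, ← Finset.sum_add_distrib]
    exact Finset.sum_congr rfl fun a _ => by module
  rw [hsum] at hd ⊢
  rw [hsum] at hd
  -- The two representations of the common vector are rearranged so that one side lies in the member
  -- at ∞ and the other in the member at 0; hence both sides vanish.
  have h1 : ∑ a, (s₁ • c - t₁ • d) a • X₁ a = ∑ a, (t₂ • d - s₂ • c) a • X₂ a := by
    have e1 : ∑ a, (s₁ • c - t₁ • d) a • X₁ a
        = s₁ • ∑ a, c a • X₁ a - t₁ • ∑ a, d a • X₁ a := by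
      simp only [Finset.smul_sum, ← Finset.sum_sub_distrib]
      exact Finset.sum_congr rfl fun a _ => by
        simp only [Pi.sub_apply, Pi.smul_apply, smul_eq_mul]
        module
    have e2 : ∑ a, (t₂ • d - s₂ • c) a • X₂ a
        = t₂ • ∑ a, d a • X₂ a - s₂ • ∑ a, c a • X₂ a := by
      simp only [Finset.smul_sum, ← Finset.sum_sub_distrib]
      exact Finset.sum_congr rfl fun a _ => by
        simp only [Pi.sub_apply, Pi.smul_apply, smul_eq_mul]
        module
    rw [e1, e2, sub_eq_sub_iff_add_eq_add, ← hd, add_comm]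
  have h2 : ∑ a, (s₁ • c - t₁ • d) a • X₁ a = 0 :=
    Submodule.disjoint_def.1 h0 _ (hmem1 _) (h1 ▸ hmem2 _)
  have h3 := hindep 1 0 (by simp) (s₁ • c - t₁ • d) (by rw [h2]; simp)
  have h4 := hindep 0 1 (by simp) (t₂ • d - s₂ • c) (by rw [← h1, h2]; simp)
  have h5 : c = 0 := by
    funext a
    have h6 := congrFun h3 a
    have h7 := congrFun h4 a
    simp only [Pi.sub_apply, Pi.smul_apply, smul_eq_mul, Pi.zero_apply] at h6 h7
    refine (mul_eq_zero.1 ?_).resolve_left hdet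
    linear_combination t₂ * h6 + t₁ * h7
  rw [h5]
  simp

/-- On the generators, the conditions at λ₁ and λ₃ give Ω(X₂) = -λ₁Ω(X₁) and Ω'(X₂) = -λ₃Ω'(X₁). On
s₁X₁ + s₂X₂ the combined form is therefore (s₁ - λ₃s₂)(s₁ - λ₁s₂)(Ω + Ω')(X₁), up to a nonzero
factor, which vanishes by the condition at ∞. -/
theorem IsLinearWeb.le_ker {F : OnePoint ℝ → Submodule ℝ R4} (hF : IsLinearWeb F)
    {lam₁ lam₃ : ℝ} {Ω Ω' : R4 →L[ℝ] ℝ}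
    (h₁ : ∀ v ∈ F (lam₁ : OnePoint ℝ), Ω v = 0) (h₃ : ∀ v ∈ F (lam₃ : OnePoint ℝ), Ω' v = 0)
    (hinf : ∀ v ∈ F OnePoint.infty, Ω v + Ω' v = 0) (s : OnePoint ℝ) :
    ∀ v ∈ F s, coeff lam₃ s * Ω v + coeff lam₁ s * Ω' v = 0 := by
  obtain ⟨k, X₁, X₂, hreal, -⟩ := hF
  have hspan := fun s₁ s₂ hs => span_pencil (hreal s₁ s₂ hs)
  have hmem : ∀ s₁ s₂, (s₁, s₂) ≠ (0, 0) → ∀ a, s₁ • X₁ a + s₂ • X₂ a ∈ F (ratio s₁ s₂) :=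
    fun s₁ s₂ hs a => by
      rw [hspan s₁ s₂ hs]
      exact Submodule.subset_span ⟨a, rfl⟩
  have hX : ∀ a, Ω (X₁ a) + Ω' (X₁ a) = 0 := fun a => hinf _ (by
    have := hmem 1 0 (by simp) a
    simpa [ratio] using this)
  have hX₁ : ∀ a, lam₁ * Ω (X₁ a) + Ω (X₂ a) = 0 := fun a => by
    have := h₁ _ (by
      have := hmem lam₁ 1 (by simp) a
      simpa [ratio] using this)
    simpa using this
  have hX₃ : ∀ a, lam₃ * Ω' (X₁ a) + Ω' (X₂ a) = 0 := fun a => by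
    have := h₃ _ (by
      have := hmem lam₃ 1 (by simp) a
      simpa [ratio] using this)
    simpa using this
  obtain ⟨s₁, s₂, hs, rfl⟩ := exists_ratio s
  obtain ⟨c, hc, hcoeff⟩ := exists_coeff_ratio hs
  have hle : F (ratio s₁ s₂) ≤ LinearMap.ker
      ((coeff lam₃ (ratio s₁ s₂) • Ω + coeff lam₁ (ratio s₁ s₂) • Ω' : R4 →L[ℝ] ℝ) :
        R4 →ₗ[ℝ] ℝ) := by
    rw [hspan s₁ s₂ hs, Submodule.span_le]
    rintro _ ⟨a, rfl⟩
    change coeff lam₃ (ratio s₁ s₂) * Ω _ + coeff lam₁ (ratio s₁ s₂) * Ω' _ = 0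
    simp only [map_add, map_smul, smul_eq_mul]
    refine (mul_eq_zero.1 ?_).resolve_left hc
    rw [mul_add, ← mul_assoc, ← mul_assoc, ← hcoeff, ← hcoeff]
    linear_combination (s₁ - lam₃ * s₂) * (s₁ - lam₁ * s₂) * hX a
      + (s₁ - lam₃ * s₂) * s₂ * hX₁ a + (s₁ - lam₁ * s₂) * s₂ * hX₃ a
  exact fun v hv => hle hv

end LinearWebs

/-! ### A web is determined by its members at λ₁, λ₃ and ∞ -/

section Recognition

/-- If the determinant vanished, the columns of the adjugate would be kernel vectors; all entries
would then be zero, and (1, 0) would be in the kernel. -/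
theorem det_ne_zero_of_forall {a b c d : ℝ}
    (h : ∀ u w, a * u + b * w = 0 → c * u + d * w = 0 → u = 0 ∧ w = 0) : a * d - c * b ≠ 0 := by
  intro hdet
  obtain ⟨hd, hc⟩ := h d (-c) (by linear_combination hdet) (by ring)
  obtain ⟨hb, ha⟩ := h b (-a) (by ring) (by linear_combination -hdet)
  exact one_ne_zero (h 1 0 (by linear_combination -ha) (by linear_combination -hc)).1

/-- A kernel vector of the x-block lies in the members at ∞ and λ₃, one of the y-block in those at ∞
and λ₁. -/
theorem jacobiansAt_of_disjoint {lam₁ lam₃ : ℝ}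
    {F : OnePoint ℝ → ∀ x : R4, Submodule ℝ (TangentSpace 𝓘(ℝ, R4) x)} {f : Fin 2 → R4 → ℝ}
    {x : R4} (hstraight : StraightAt lam₁ lam₃ F x) (hlevel : InftyLevelAt f F x)
    (h₁ : Disjoint (F OnePoint.infty x) (F (lam₁ : OnePoint ℝ) x))
    (h₃ : Disjoint (F OnePoint.infty x) (F (lam₃ : OnePoint ℝ) x)) : JacobiansAt f x := by
  have hinf : ∀ v : R4, v ∈ F OnePoint.infty x ↔ ∀ i,
      pd 0 (f i) x * v 0 + pd 1 (f i) x * v 1 + pd 2 (f i) x * v 2 + pd 3 (f i) x * v 3 = 0 :=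
    fun v => (hlevel v).trans (forall_congr' fun i => by rw [fderiv_apply_eq])
  constructor
  · refine det_ne_zero_of_forall fun u w hu hw => ?_
    have h := Submodule.disjoint_def.1 h₃ (join !₂[u, w] 0)
      ((hinf _).2 fun i => by
        fin_cases i
        · simpa using hu
        · simpa using hw)
      ((hstraight.2 _).2 ⟨rfl, rfl⟩)
    exact ⟨congrArg (fun v : R4 => v 0) h, congrArg (fun v : R4 => v 1) h⟩
  · refine det_ne_zero_of_forall fun u w hu hw => ?_
    have h := Submodule.disjoint_def.1 h₁ (join 0 !₂[u, w])
      ((hinf _).2 fun i => by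
        fin_cases i
        · simpa using hu
        · simpa using hw)
      ((hstraight.1 _).2 ⟨rfl, rfl⟩)
    exact ⟨congrArg (fun v : R4 => v 2) h, congrArg (fun v : R4 => v 3) h⟩

/-- The web lies in the form web by `IsLinearWeb.le_ker` and equals it by transversality;
integrability of one further member then yields (H). Only the pointwise Kronecker condition is
assumed, so the result also applies to webs read in a chart. -/
theorem recognition {lam₁ lam₃ : ℝ} (hlam : lam₁ ≠ lam₃) {U : Set R4} {f : Fin 2 → R4 → ℝ}
    {F : OnePoint ℝ → ∀ x : R4, Submodule ℝ (TangentSpace 𝓘(ℝ, R4) x)} (hU : IsOpen U)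
    (hf : ∀ i, ContDiffOn ℝ ∞ (f i) U) (hfol : ∀ s, IsFoliationOn 2 (F s) U)
    (hlin : ∀ x ∈ U, IsLinearWeb fun s => F s x)
    (hdis : ∀ x ∈ U, Disjoint (F OnePoint.infty x) (F ((0 : ℝ) : OnePoint ℝ) x))
    (hstraight : ∀ x ∈ U, StraightAt lam₁ lam₃ F x) (hlevel : ∀ x ∈ U, InftyLevelAt f F x) :
    ∀ x ∈ U, SolvesAt f x ∧ JacobiansAt f x ∧ ∀ s, F s x = formWeb lam₁ lam₃ f s x := by
  have hdisj : ∀ x ∈ U, ∀ s t, s ≠ t → Disjoint (F s x) (F t x) := fun x hx s t hst =>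
    (hlin x hx).disjoint (hdis x hx) hst
  have hJ : ∀ x ∈ U, JacobiansAt f x := fun x hx =>
    jacobiansAt_of_disjoint (hstraight x hx) (hlevel x hx)
      (hdisj x hx _ _ (OnePoint.infty_ne_coe _)) (hdisj x hx _ _ (OnePoint.infty_ne_coe _))
  have hle : ∀ x ∈ U, ∀ s, F s x ≤ formWeb lam₁ lam₃ f s x := by
    intro x hx s v hv
    refine mem_formWeb.2 fun i => ?_
    refine (hlin x hx).le_ker (Ω := pd 0 (f i) x • dx 0 + pd 1 (f i) x • dx 1)
      (Ω' := pd 2 (f i) x • dx 2 + pd 3 (f i) x • dx 3) (fun v hv => ?_) (fun v hv => ?_)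
      (fun v hv => ?_) s v hv
    · obtain ⟨h0, h1⟩ := ((hstraight x hx).1 v).1 hv
      simp [h0, h1]
    · obtain ⟨h0, h1⟩ := ((hstraight x hx).2 v).1 hv
      simp [h0, h1]
    · have := (hlevel x hx v).1 hv i
      rw [fderiv_apply_eq] at this
      simp only [add_apply, smul_apply, smul_eq_mul, dx, EuclideanSpace.coe_proj]
      linear_combination this
  have heq : ∀ x ∈ U, ∀ s, F s x = formWeb lam₁ lam₃ f s x := by
    intro x hx s
    -- Equality in a modular lattice: the member at t spans the whole space together with the
    -- smaller subspace, and it meets the larger one trivially.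
    obtain ⟨t, hts⟩ := exists_ne s
    refine eq_of_le_of_inf_le_of_sup_le (hle x hx s) (z := F t x) ?_ ?_
    · have := (disjoint_formWeb hlam (hJ x hx) hts.symm).mono_right (hle x hx t)
      rw [this.eq_bot]
      exact bot_le
    · rw [(isCompl_of_isFoliationOn (hfol s) (hfol t) hx (hdisj x hx s t hts.symm)).sup_eq_top]
      exact le_top
  refine fun x hx => ⟨?_, hJ x hx, heq x hx⟩
  -- For finite s different from λ₁ and λ₃ the coefficients s - λ₃ and s - λ₁ are nonzero and
  -- distinct, as `mixedSymmetricAt_of_firstIntegral` requires.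
  obtain ⟨s, hs⟩ := Set.Infinite.exists_notMem_finset (s := (Set.univ : Set ℝ)) Set.infinite_univ
    {lam₁, lam₃}
  simp only [Set.mem_univ, Finset.mem_insert, Finset.mem_singleton, not_or, true_and] at hs
  obtain ⟨V, hV, hxV, hVU, h, hh, hker⟩ := hfol (s : OnePoint ℝ) x hx
  rw [contMDiffOn_iff_contDiffOn] at hh
  have hd : ∀ x ∈ U, ∀ i, DifferentiableAt ℝ (f i) x := fun x hx i =>
    ((hf i).contDiffAt (hU.mem_nhds hx)).differentiableAt (by simp)
  obtain ⟨z, rfl⟩ := joinL.surjective x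
  refine (mixedSymmetricAt_pairMap_iff hU hf hx (hJ _ hx).2).1 ?_
  refine mixedSymmetricAt_of_firstIntegral (hU.preimage joinL.continuous) (contDiffOn_pairMap hf)
    (fun z hz => dSnd_pairMap_isInvertible (hd _ hz) (hJ _ hz).2) (sub_ne_zero.2 hs.2)
    (sub_ne_zero.2 hs.1) (fun h => hlam (sub_right_injective h).symm) hx (h := h ∘ joinL)
    ((hh.contDiffAt (hV.mem_nhds hxV)).comp z joinL.contDiff.contDiffAt) ?_
  filter_upwards [(hV.preimage joinL.continuous).mem_nhds hxV] with y hy v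
  have h1 := (hker _ hy).2 (joinL v)
  rw [mfderiv_eq_fderiv, heq _ (hVU hy)] at h1
  rw [ContinuousLinearEquiv.comp_right_fderiv]
  exact h1.symm.trans (pairMap_ker_iff (hd _ (hVU hy)))

theorem IsThreeWebTypeOn.isLinearWeb {M : Type*} [TopologicalSpace M] [ChartedSpace R4 M]
    [IsManifold 𝓘(ℝ, R4) ∞ M]
    {F : OnePoint ℝ → ∀ x : M, Submodule ℝ (TangentSpace 𝓘(ℝ, R4) x)} {U : Set M}
    (h : IsThreeWebTypeOn F U) {x : M} (hx : x ∈ U) : IsLinearWeb fun s => F s x := by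
  obtain ⟨V, -, hxV, -, k, X₁, X₂, -, -, hV⟩ := h.kronecker.pencil x hx
  exact ⟨k, fun a => X₁ a x, fun a => X₂ a x, (hV x hxV).1, (hV x hxV).2⟩

end Recognition

/-! ### Adapted charts on a manifold -/

section AdaptedCharts

variable {M : Type*} [TopologicalSpace M] [ChartedSpace R4 M]

theorem covector_comp_proj {q : ℕ} {h : M → EuclideanSpace ℝ (Fin q)} {x : M} {i : Fin q}
    {k : M → ℝ} (hh : MDifferentiableAt 𝓘(ℝ, R4) 𝓘(ℝ, EuclideanSpace ℝ (Fin q)) h x)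
    (hk : k =ᶠ[𝓝 x] fun y => h y i) (v : TangentSpace 𝓘(ℝ, R4) x) :
    covector k x v
      = (EuclideanSpace.proj i : EuclideanSpace ℝ (Fin q) →L[ℝ] ℝ)
        (mfderiv 𝓘(ℝ, R4) 𝓘(ℝ, EuclideanSpace ℝ (Fin q)) h x v) := by
  have h1 := mfderiv_comp x (I'' := 𝓘(ℝ, ℝ))
    ((EuclideanSpace.proj i : EuclideanSpace ℝ (Fin q) →L[ℝ] ℝ).mdifferentiableAt) hh
  unfold covector
  rw [hk.mfderiv_eq]
  refine (congrArg (fun T => T v) h1).trans ?_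
  rw [ContinuousLinearMap.mfderiv_eq]
  rfl

/-- One inclusion is the definition; the common kernel of two independent covectors and the leaf
tangent space both have codimension two. -/
theorem AreFirstIntegralsOn.mem_iff {F : ∀ x : M, Submodule ℝ (TangentSpace 𝓘(ℝ, R4) x)}
    {f : Fin 2 → M → ℝ} {V U : Set M} (hf : AreFirstIntegralsOn f F V) (hF : IsFoliationOn 2 F U)
    {x : M} (hx : x ∈ V) (hxU : x ∈ U) (v : TangentSpace 𝓘(ℝ, R4) x) :
    v ∈ F x ↔ ∀ i, covector (f i) x v = 0 := by
  obtain ⟨hker, hind⟩ := hf.2 x hx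
  let b : Fin 2 → Module.Dual ℝ R4 := fun i => (covector (f i) x : R4 →L[ℝ] ℝ).toLinearMap
  have hb : LinearIndependent ℝ b :=
    hind.map' (ContinuousLinearMap.coeLM ℝ : (R4 →L[ℝ] ℝ) →ₗ[ℝ] R4 →ₗ[ℝ] ℝ)
      (LinearMap.ker_eq_bot.2 ContinuousLinearMap.coe_injective)
  let W : Subspace ℝ (Module.Dual ℝ R4) := Submodule.span ℝ (Set.range b)
  have hW : Module.finrank ℝ W = 2 := by simpa using finrank_span_eq_card hb
  have hsum := Subspace.finrank_add_finrank_dualCoannihilator_eq W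
  have hF' := finrank_of_isFoliationOn (E := R4) hF hxU
  rw [finrank_euclideanSpace_fin] at hsum hF'
  have hmem : ∀ v : R4, v ∈ W.dualCoannihilator ↔ ∀ i, b i v = 0 := by
    intro v
    rw [Submodule.mem_dualCoannihilator]
    refine ⟨fun h i => h _ (Submodule.subset_span ⟨i, rfl⟩), fun h α hα => ?_⟩
    have : W ≤ LinearMap.ker (Module.Dual.eval ℝ R4 v) := by
      rw [Submodule.span_le]
      rintro _ ⟨i, rfl⟩
      exact h i
    exact this hα
  let D : Submodule ℝ R4 := F x
  have hD : D = W.dualCoannihilator := by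
    refine Submodule.eq_of_le_of_finrank_eq (fun v hv => (hmem v).2 fun i => hker i v hv) ?_
    have : Module.finrank ℝ D = Module.finrank ℝ (F x) := rfl
    omega
  change v ∈ D ↔ _
  rw [hD]
  exact hmem v

theorem IsFoliationOn.comap_symm {q : ℕ} {D : ∀ x : M, Submodule ℝ (TangentSpace 𝓘(ℝ, R4) x)}
    {U W : Set M} (hD : IsFoliationOn q D U) (hW : IsOpen W) (hWU : W ⊆ U)
    {c : OpenPartialHomeomorph M R4} (hc : c ∈ IsManifold.maximalAtlas 𝓘(ℝ, R4) ∞ M) :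
    IsFoliationOn q (fun y : R4 => (D (c.symm y)).comap
      (mfderiv 𝓘(ℝ, R4) 𝓘(ℝ, R4) c.symm y).toLinearMap) (c.target ∩ c.symm ⁻¹' W) := by
  rintro y ⟨hy, hyW⟩
  have hcd : c.MDifferentiable 𝓘(ℝ, R4) 𝓘(ℝ, R4) :=
    ⟨(contMDiffOn_of_mem_maximalAtlas hc).mdifferentiableOn (by simp),
      (contMDiffOn_symm_of_mem_maximalAtlas hc).mdifferentiableOn (by simp)⟩
  obtain ⟨V, hV, hyV, -, h, hh, hker⟩ := hD _ (hWU hyW)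
  refine ⟨c.target ∩ c.symm ⁻¹' (V ∩ W), c.symm.isOpen_inter_preimage (hV.inter hW),
    ⟨hy, hyV, hyW⟩, fun z hz => ⟨hz.1, hz.2.2⟩, h ∘ c.symm,
    hh.comp ((contMDiffOn_symm_of_mem_maximalAtlas hc).mono Set.inter_subset_left)
      fun z hz => hz.2.1, fun z hz => ?_⟩
  rw [mfderiv_comp z ((hh.contMDiffAt (hV.mem_nhds hz.2.1)).mdifferentiableAt (by simp))
    (hcd.mdifferentiableAt_symm hz.1)]
  exact ⟨(hker _ hz.2.1).1.comp (hcd.symm.mfderiv_surjective hz.1),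
    fun v => (hker _ hz.2.1).2 _⟩

variable [IsManifold 𝓘(ℝ, R4) ∞ M]

/-- The inverse function theorem in a chart; the composite stays in the maximal atlas since it is
smooth in both directions. -/
theorem exists_chart_of_injective {g : M → R4} {V : Set M} (hV : IsOpen V)
    (hg : ContMDiffOn 𝓘(ℝ, R4) 𝓘(ℝ, R4) ∞ g V)
    (hinj : ∀ x ∈ V, Function.Injective (mfderiv 𝓘(ℝ, R4) 𝓘(ℝ, R4) g x)) {p : M} (hp : p ∈ V) :
    ∃ c ∈ IsManifold.maximalAtlas 𝓘(ℝ, R4) ∞ M, p ∈ c.source ∧ c.source ⊆ V ∧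
      ∀ x ∈ c.source, c x = g x := by
  let φ := chartAt R4 p
  have hφ : φ.MDifferentiable 𝓘(ℝ, R4) 𝓘(ℝ, R4) := mdifferentiable_chart p
  have hT : IsOpen (φ.target ∩ φ.symm ⁻¹' V) := φ.symm.isOpen_inter_preimage hV
  have hpT : φ p ∈ φ.target ∩ φ.symm ⁻¹' V :=
    ⟨φ.map_source (mem_chart_source R4 p), by
      rw [Set.mem_preimage, φ.left_inv (mem_chart_source R4 p)]; exact hp⟩
  have hgT : ContDiffOn ℝ ∞ (g ∘ φ.symm) (φ.target ∩ φ.symm ⁻¹' V) := by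
    rw [← contMDiffOn_iff_contDiffOn]
    exact hg.comp ((contMDiffOn_chart_symm (I := 𝓘(ℝ, R4)) (x := p)).mono Set.inter_subset_left)
      fun x hx => hx.2
  have hd : MDifferentiableAt 𝓘(ℝ, R4) 𝓘(ℝ, R4) g (φ.symm (φ p)) :=
    (hg.contMDiffAt (hV.mem_nhds hpT.2)).mdifferentiableAt (by simp)
  have hcomp := mfderiv_comp (φ p) hd (hφ.mdifferentiableAt_symm hpT.1)
  rw [mfderiv_eq_fderiv] at hcomp
  have hi : Function.Injective (fderiv ℝ (g ∘ φ.symm) (φ p)) := by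
    rw [hcomp]
    exact (hinj _ hpT.2).comp (hφ.symm.mfderiv_injective hpT.1)
  let L : R4 ≃L[ℝ] R4 := (LinearEquiv.ofInjectiveEndo
    (fderiv ℝ (g ∘ φ.symm) (φ p) : R4 →ₗ[ℝ] R4) hi).toContinuousLinearEquiv
  have hL : HasFDerivAt (g ∘ φ.symm) (L : R4 →L[ℝ] R4) (φ p) :=
    ((hgT.contDiffAt (hT.mem_nhds hpT)).differentiableAt (by simp)).hasFDerivAt
  obtain ⟨e, hpe, heT, hecoe, hesymm, -⟩ :=
    exists_openPartialHomeomorph_contDiffOn_symm hT hgT hpT L hL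
  have heq : ∀ x ∈ (φ ≫ₕ e).source, (φ ≫ₕ e) x = g x := by
    intro x hx
    rw [OpenPartialHomeomorph.trans_source] at hx
    rw [OpenPartialHomeomorph.coe_trans, hecoe, Function.comp_apply, Function.comp_apply,
      φ.left_inv hx.1]
  have hsub : (φ ≫ₕ e).source ⊆ V := by
    intro x hx
    rw [OpenPartialHomeomorph.trans_source] at hx
    have := (heT hx.2).2
    rwa [Set.mem_preimage, φ.left_inv hx.1] at this
  refine ⟨φ ≫ₕ e, OpenPartialHomeomorph.mem_maximalAtlas_of_contMDiffOn _
    ((hg.mono hsub).congr heq) ?_, ?_, hsub, heq⟩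
  · rw [OpenPartialHomeomorph.trans_target, OpenPartialHomeomorph.trans_symm_eq_symm_trans_symm,
      OpenPartialHomeomorph.coe_trans]
    exact (contMDiffOn_chart_symm (I := 𝓘(ℝ, R4)) (x := p)).comp
      ((contMDiffOn_iff_contDiffOn.2 hesymm).mono Set.inter_subset_left) fun x hx => hx.2
  · rw [OpenPartialHomeomorph.trans_source]
    exact ⟨mem_chart_source R4 p, hpe⟩

theorem exists_adapted_chart {lam₁ lam₃ : ℝ} (hlam : lam₁ ≠ lam₃)
    {F : OnePoint ℝ → ∀ x : M, Submodule ℝ (TangentSpace 𝓘(ℝ, R4) x)}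
    (hF : IsThreeWebTypeOn F Set.univ) (p : M) :
    ∃ c ∈ IsManifold.maximalAtlas 𝓘(ℝ, R4) ∞ M, p ∈ c.source ∧
      ∀ x ∈ c.source, ∀ v : TangentSpace 𝓘(ℝ, R4) x,
        (v ∈ F (lam₁ : OnePoint ℝ) x ↔
          covector (fun y => c y 0) x v = 0 ∧ covector (fun y => c y 1) x v = 0) ∧
        (v ∈ F (lam₃ : OnePoint ℝ) x ↔
          covector (fun y => c y 2) x v = 0 ∧ covector (fun y => c y 3) x v = 0) := by
  obtain ⟨V₁, hV₁, hp₁, -, h₁, hh₁, hk₁⟩ := hF.kronecker.foliation (lam₁ : OnePoint ℝ) p trivial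
  obtain ⟨V₃, hV₃, hp₃, -, h₃, hh₃, hk₃⟩ := hF.kronecker.foliation (lam₃ : OnePoint ℝ) p trivial
  let g : M → R4 := fun x => joinL (h₁ x, h₃ x)
  have hV := hV₁.inter hV₃
  have hd₁ : ∀ x ∈ V₁ ∩ V₃, MDifferentiableAt 𝓘(ℝ, R4) 𝓘(ℝ, R2) h₁ x := fun x hx =>
    (hh₁.contMDiffAt (hV₁.mem_nhds hx.1)).mdifferentiableAt (by simp)
  have hd₃ : ∀ x ∈ V₁ ∩ V₃, MDifferentiableAt 𝓘(ℝ, R4) 𝓘(ℝ, R2) h₃ x := fun x hx =>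
    (hh₃.contMDiffAt (hV₃.mem_nhds hx.2)).mdifferentiableAt (by simp)
  have hg : ContMDiffOn 𝓘(ℝ, R4) 𝓘(ℝ, R4) ∞ g (V₁ ∩ V₃) :=
    (joinL : (R2 × R2) →L[ℝ] R4).contMDiff.comp_contMDiffOn
      ((hh₁.mono Set.inter_subset_left).prodMk_space (hh₃.mono Set.inter_subset_right))
  have hdg : ∀ x ∈ V₁ ∩ V₃, MDifferentiableAt 𝓘(ℝ, R4) 𝓘(ℝ, R4) g x := fun x hx =>
    (hg.contMDiffAt (hV.mem_nhds hx)).mdifferentiableAt (by simp)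
  have hcov : ∀ x ∈ V₁ ∩ V₃, ∀ c : M → R4, c =ᶠ[𝓝 x] g → ∀ v : TangentSpace 𝓘(ℝ, R4) x,
      (v ∈ F (lam₁ : OnePoint ℝ) x ↔
        covector (fun y => c y 0) x v = 0 ∧ covector (fun y => c y 1) x v = 0) ∧
      (v ∈ F (lam₃ : OnePoint ℝ) x ↔
        covector (fun y => c y 2) x v = 0 ∧ covector (fun y => c y 3) x v = 0) := by
    intro x hx c hc v
    have hpair : ∀ w : R2, w = 0 ↔ w 0 = 0 ∧ w 1 = 0 := fun w =>
      ⟨fun h => by simp [h], fun h => by ext j; fin_cases j; exacts [h.1, h.2]⟩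
    have e0 := covector_comp_proj (i := 0) (hd₁ x hx) (hc.fun_comp fun y : R4 => y 0) v
    have e1 := covector_comp_proj (i := 1) (hd₁ x hx) (hc.fun_comp fun y : R4 => y 1) v
    have e2 := covector_comp_proj (i := 0) (hd₃ x hx) (hc.fun_comp fun y : R4 => y 2) v
    have e3 := covector_comp_proj (i := 1) (hd₃ x hx) (hc.fun_comp fun y : R4 => y 3) v
    constructor
    · exact ((hk₁ x hx.1).2 v).trans ((hpair _).trans
        (and_congr (Eq.congr_left e0.symm) (Eq.congr_left e1.symm)))
    · exact ((hk₃ x hx.2).2 v).trans ((hpair _).trans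
        (and_congr (Eq.congr_left e2.symm) (Eq.congr_left e3.symm)))
  have hinj : ∀ x ∈ V₁ ∩ V₃, Function.Injective (mfderiv 𝓘(ℝ, R4) 𝓘(ℝ, R4) g x) := by
    intro x hx
    rw [injective_iff_map_eq_zero]
    intro v hv
    have hz : ∀ j, covector (fun y => g y j) x v = 0 := fun j => by
      rw [covector_comp_proj (hdg x hx) Filter.EventuallyEq.rfl v, hv]
      rfl
    -- Transversality is assumed only at ∞, 0 and 1; at λ₁ and λ₃ it comes from the pencil. It makes
    -- the two submersions together a local coordinate system.
    have hdis := (hF.isLinearWeb (Set.mem_univ x)).disjoint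
      (hF.compl_infty_zero x trivial).disjoint (s := lam₁) (t := lam₃)
      (OnePoint.coe_injective.ne hlam)
    have hm := hcov x hx g Filter.EventuallyEq.rfl v
    exact Submodule.disjoint_def.1 hdis v (hm.1.2 ⟨hz 0, hz 1⟩) (hm.2.2 ⟨hz 2, hz 3⟩)
  obtain ⟨c, hc, hpc, hcV, hcg⟩ := exists_chart_of_injective hV hg hinj ⟨hp₁, hp₃⟩
  exact ⟨c, hc, hpc, fun x hx => hcov x (hcV hx) c
    (Filter.mem_of_superset (c.open_source.mem_nhds hx) hcg)⟩

/-- The web is pulled back to ℝ⁴ by the inverse chart, where the chart coordinates become the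
standard ones and `recognition` applies. -/
theorem solvesAt_of_adapted_chart {lam₁ lam₃ : ℝ} (hlam : lam₁ ≠ lam₃)
    {F : OnePoint ℝ → ∀ x : M, Submodule ℝ (TangentSpace 𝓘(ℝ, R4) x)}
    (hF : IsThreeWebTypeOn F Set.univ) {c : OpenPartialHomeomorph M R4}
    (hc : c ∈ IsManifold.maximalAtlas 𝓘(ℝ, R4) ∞ M)
    (hadapted : ∀ x ∈ c.source, ∀ v : TangentSpace 𝓘(ℝ, R4) x,
        (v ∈ F (lam₁ : OnePoint ℝ) x ↔
          covector (fun y => c y 0) x v = 0 ∧ covector (fun y => c y 1) x v = 0) ∧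
        (v ∈ F (lam₃ : OnePoint ℝ) x ↔
          covector (fun y => c y 2) x v = 0 ∧ covector (fun y => c y 3) x v = 0))
    {V : Set M} {f : Fin 2 → M → ℝ} (hV : IsOpen V) (hVc : V ⊆ c.source)
    (hf : AreFirstIntegralsOn f (F OnePoint.infty) V) {x : M} (hx : x ∈ V) :
    SolvesAt (fun i => f i ∘ c.symm) (c x) ∧ JacobiansAt (fun i => f i ∘ c.symm) (c x) := by
  have hcd : c.MDifferentiable 𝓘(ℝ, R4) 𝓘(ℝ, R4) :=
    ⟨(contMDiffOn_of_mem_maximalAtlas hc).mdifferentiableOn (by simp),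
      (contMDiffOn_symm_of_mem_maximalAtlas hc).mdifferentiableOn (by simp)⟩
  have hcomp : ∀ y ∈ c.target, ∀ k : M → ℝ, MDifferentiableAt 𝓘(ℝ, R4) 𝓘(ℝ, ℝ) k (c.symm y) →
      ∀ v : R4, fderiv ℝ (k ∘ c.symm) y v
        = covector k (c.symm y) (mfderiv 𝓘(ℝ, R4) 𝓘(ℝ, R4) c.symm y v) := by
    intro y hy k hk v
    have := mfderiv_comp y hk (hcd.mdifferentiableAt_symm hy)
    rw [mfderiv_eq_fderiv] at this
    exact congrArg (fun T : R4 →L[ℝ] ℝ => T v) this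
  let F' : OnePoint ℝ → ∀ y : R4, Submodule ℝ (TangentSpace 𝓘(ℝ, R4) y) := fun s y =>
    (F s (c.symm y)).comap (mfderiv 𝓘(ℝ, R4) 𝓘(ℝ, R4) c.symm y).toLinearMap
  have hU : IsOpen (c.target ∩ c.symm ⁻¹' V) := c.symm.isOpen_inter_preimage hV
  have hlin : ∀ y ∈ c.target ∩ c.symm ⁻¹' V, IsLinearWeb fun s => F' s y := fun y hy =>
    (hF.isLinearWeb (Set.mem_univ (c.symm y))).comap (hcd.symm.mfderiv hy.1 : R4 ≃L[ℝ] R4)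
  have hcoord : ∀ y ∈ c.target, ∀ (j : Fin 4) (v : R4),
      covector (fun z => c z j) (c.symm y) (mfderiv 𝓘(ℝ, R4) 𝓘(ℝ, R4) c.symm y v) = v j := by
    intro y hy j v
    have hd := hcd.mdifferentiableAt (c.map_target hy)
    rw [covector_comp_proj hd Filter.EventuallyEq.rfl]
    exact congrArg (fun T : R4 →L[ℝ] R4 => T v j) (hcd.comp_symm_deriv hy)
  refine (fun h => ⟨h.1, h.2.1⟩) (recognition (F := F') hlam hU
    (fun i => ?_) (fun s => ?_) hlin (fun y hy => ?_) (fun y hy => ⟨fun v => ?_, fun v => ?_⟩)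
    (fun y hy v => ?_) (c x) ⟨c.map_source (hVc hx), ?_⟩)
  · rw [← contMDiffOn_iff_contDiffOn]
    exact (hf.1 i).comp ((contMDiffOn_symm_of_mem_maximalAtlas hc).mono Set.inter_subset_left)
      fun y hy => hy.2
  · exact (hF.kronecker.foliation s).comap_symm hV (Set.subset_univ V) hc
  · have hinj := hcd.symm.mfderiv_injective hy.1
    rw [Submodule.disjoint_def]
    intro v h1 h2
    refine hinj ((Submodule.disjoint_def.1 (hF.compl_infty_zero _ trivial).disjoint _ h1 h2).trans
      (map_zero _).symm)
  · exact ((hadapted _ (c.map_target hy.1) _).1).trans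
      (and_congr (Eq.congr_left (hcoord y hy.1 0 v)) (Eq.congr_left (hcoord y hy.1 1 v)))
  · exact ((hadapted _ (c.map_target hy.1) _).2).trans
      (and_congr (Eq.congr_left (hcoord y hy.1 2 v)) (Eq.congr_left (hcoord y hy.1 3 v)))
  · refine (hf.mem_iff (hF.kronecker.foliation _) hy.2 trivial _).trans (forall_congr' fun i => ?_)
    rw [hcomp y hy.1 _ (((hf.1 i).contMDiffAt (hV.mem_nhds hy.2)).mdifferentiableAt (by simp))]
    rfl
  · rw [Set.mem_preimage, c.left_inv (hVc hx)]
    exact hx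

end AdaptedCharts

/-! ### Local diffeomorphisms and factorization through submersions -/

section LocalDiffeomorphisms

variable {E F G : Type*} [NormedAddCommGroup E] [NormedSpace ℝ E] [NormedAddCommGroup F]
  [NormedSpace ℝ F] [NormedAddCommGroup G] [NormedSpace ℝ G]

theorem exists_nhd_of_isLocalDiffeomorphAt {f : E → F} {a : E}
    (hf : IsLocalDiffeomorphAt 𝓘(ℝ, E) 𝓘(ℝ, F) ∞ f a) :
    ∃ V, IsOpen V ∧ a ∈ V ∧ ContDiffOn ℝ ∞ f V ∧
      ∀ x ∈ V, IsLocalDiffeomorphAt 𝓘(ℝ, E) 𝓘(ℝ, F) ∞ f x := by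
  obtain ⟨Φ, ha, heq⟩ := hf
  exact ⟨Φ.source, Φ.open_source, ha,
    (contMDiffOn_iff_contDiffOn.1 Φ.contMDiffOn_toFun).congr heq, fun x hx => ⟨Φ, hx, heq⟩⟩

theorem eventually_isLocalDiffeomorphAt {f : E → F} {a : E}
    (hf : IsLocalDiffeomorphAt 𝓘(ℝ, E) 𝓘(ℝ, F) ∞ f a) :
    ∀ᶠ x in 𝓝 a, IsLocalDiffeomorphAt 𝓘(ℝ, E) 𝓘(ℝ, F) ∞ f x := by
  obtain ⟨V, hV, haV, -, h⟩ := exists_nhd_of_isLocalDiffeomorphAt hf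
  exact Filter.mem_of_superset (hV.mem_nhds haV) h

theorem _root_.IsLocalDiffeomorphAt.contDiffAt {f : E → F} {a : E}
    (hf : IsLocalDiffeomorphAt 𝓘(ℝ, E) 𝓘(ℝ, F) ∞ f a) : ContDiffAt ℝ ∞ f a :=
  contMDiffAt_iff_contDiffAt.1 hf.contMDiffAt

theorem _root_.IsLocalDiffeomorphAt.differentiableAt {f : E → F} {a : E}
    (hf : IsLocalDiffeomorphAt 𝓘(ℝ, E) 𝓘(ℝ, F) ∞ f a) : DifferentiableAt ℝ f a :=
  hf.contDiffAt.differentiableAt (by simp)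

/-- Reduces a property near the image point to points of the form `f x` with `x` near `a`. -/
theorem _root_.IsLocalDiffeomorphAt.map_nhds_eq {f : E → F} {a : E}
    (hf : IsLocalDiffeomorphAt 𝓘(ℝ, E) 𝓘(ℝ, F) ∞ f a) : Filter.map f (𝓝 a) = 𝓝 (f a) := by
  obtain ⟨Φ, ha, heq⟩ := hf
  rw [Filter.map_congr (Filter.eventuallyEq_of_mem (Φ.open_source.mem_nhds ha) heq), heq ha]
  exact Φ.toOpenPartialHomeomorph.map_nhds_eq ha

theorem _root_.IsLocalDiffeomorphAt.fderiv_localInverse_comp {f : E → F} {a : E}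
    (hf : IsLocalDiffeomorphAt 𝓘(ℝ, E) 𝓘(ℝ, F) ∞ f a) (v : E) :
    fderiv ℝ hf.localInverse (f a) (fderiv ℝ f a v) = v := by
  have h := hf.localInverse_isLocalDiffeomorphAt.differentiableAt.hasFDerivAt.comp a
      hf.differentiableAt.hasFDerivAt
  have h' := (hasFDerivAt_id (𝕜 := ℝ) a).congr_of_eventuallyEq hf.localInverse_eventuallyEq_left
  exact DFunLike.congr_fun (h.unique h') v

theorem _root_.IsLocalDiffeomorphAt.fderiv_injective {f : E → F} {a : E}
    (hf : IsLocalDiffeomorphAt 𝓘(ℝ, E) 𝓘(ℝ, F) ∞ f a) : Function.Injective (fderiv ℝ f a) :=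
  Function.LeftInverse.injective hf.fderiv_localInverse_comp

theorem isLocalDiffeomorphAt_of_fderiv [CompleteSpace E] {f : E → F} {V : Set E} (hV : IsOpen V)
    (hf : ContDiffOn ℝ ∞ f V) {a : E} (ha : a ∈ V) (f' : E ≃L[ℝ] F)
    (hf' : fderiv ℝ f a = (f' : E →L[ℝ] F)) :
    IsLocalDiffeomorphAt 𝓘(ℝ, E) 𝓘(ℝ, F) ∞ f a := by
  have hd := ((hf.contDiffAt (hV.mem_nhds ha)).differentiableAt (by simp)).hasFDerivAt
  rw [hf'] at hd
  obtain ⟨e, hae, heV, hef, he, -⟩ :=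
    exists_openPartialHomeomorph_contDiffOn_symm hV hf ha f' hd
  refine ⟨⟨e.toPartialEquiv, e.open_source, e.open_target, ?_, contMDiffOn_iff_contDiffOn.2 he⟩,
    hae, fun x _ => ?_⟩
  · rw [contMDiffOn_iff_contDiffOn]
    exact (hf.mono heV).congr fun x _ => congrFun hef x
  · exact (congrFun hef x).symm

theorem isLocalDiffeomorphAt_of_injective [FiniteDimensional ℝ E] {f : E → E} {V : Set E}
    (hV : IsOpen V) (hf : ContDiffOn ℝ ∞ f V) {a : E} (ha : a ∈ V)
    (hinj : Function.Injective (fderiv ℝ f a)) :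
    IsLocalDiffeomorphAt 𝓘(ℝ, E) 𝓘(ℝ, E) ∞ f a := by
  have : CompleteSpace E := FiniteDimensional.complete ℝ E
  exact isLocalDiffeomorphAt_of_fderiv hV hf ha (LinearEquiv.ofInjectiveEndo
    (fderiv ℝ f a : E →ₗ[ℝ] E) hinj).toContinuousLinearEquiv (by ext1 v; rfl)

theorem isLocalDiffeomorphAt_id (a : E) : IsLocalDiffeomorphAt 𝓘(ℝ, E) 𝓘(ℝ, E) ∞ id a :=
  (Diffeomorph.refl 𝓘(ℝ, E) E ∞).isLocalDiffeomorph a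

/-- A smooth map whose derivative vanishes on the kernels of the derivative of a submersion
factors through the submersion. -/
theorem exists_factorization [CompleteSpace E] [FiniteDimensional ℝ F] {g : E → F} {h : E → G}
    {V : Set E} (hV : IsOpen V) (hg : ContDiffOn ℝ ∞ g V) (hh : ContDiffOn ℝ ∞ h V) {p : E}
    (hp : p ∈ V) (hsurj : Function.Surjective (fderiv ℝ g p))
    (hker : ∀ x ∈ V, ∀ v, fderiv ℝ g x v = 0 → fderiv ℝ h x v = 0) :
    ∃ (ψ : F → G) (W : Set F), IsOpen W ∧ g p ∈ W ∧ ContDiffOn ℝ ∞ ψ W ∧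
      ∀ᶠ x in 𝓝 p, h x = ψ (g x) := by
  have : CompleteSpace F := FiniteDimensional.complete ℝ F
  let L := fderiv ℝ g p
  obtain ⟨π, hπ⟩ := L.ker_closedComplemented_of_finiteDimensional_range
  have hclosed : IsClosed (L.ker : Set E) := L.isClosed_ker
  have : CompleteSpace L.ker := hclosed.completeSpace_coe
  let e₀ : E ≃L[ℝ] F × L.ker := L.equivProdOfSurjectiveOfIsCompl π
    (LinearMap.range_eq_top.2 hsurj)
    (LinearMap.range_eq_top.2 fun y => ⟨y, hπ y⟩)
    (LinearMap.isCompl_of_proj (f := (π : E →ₗ[ℝ] L.ker)) hπ)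
  -- Completed by a projection onto the kernel of its derivative, `g` becomes the first coordinate
  -- of a local chart, in which `h` has zero derivative along the second coordinate.
  let κ : E → F × L.ker := fun x => (g x, π x)
  have hκ : ContDiffOn ℝ ∞ κ V := hg.prodMk π.contDiff.contDiffOn
  have hdg : ∀ x ∈ V, HasFDerivAt g (fderiv ℝ g x) x := fun x hx =>
    ((hg.contDiffAt (hV.mem_nhds hx)).differentiableAt (by simp)).hasFDerivAt
  have hdκ : ∀ x ∈ V, HasFDerivAt κ ((fderiv ℝ g x).prod π) x := fun x hx =>
    (hdg x hx).prodMk π.hasFDerivAt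
  obtain ⟨e, hpe, heV, heκ, he, -⟩ :=
    exists_openPartialHomeomorph_contDiffOn_symm hV hκ hp e₀ (hdκ p hp)
  have hmem : ∀ z ∈ e.target, e.symm z ∈ V := fun z hz => heV (e.map_target hz)
  have hhe : ContDiffOn ℝ ∞ (h ∘ e.symm) e.target := hh.comp he hmem
  have hde : ∀ z ∈ e.target, DifferentiableAt ℝ e.symm z := fun z hz =>
    (he.contDiffAt (e.open_target.mem_nhds hz)).differentiableAt (by simp)
  have hvert : ∀ z ∈ e.target, ∀ k, fderiv ℝ (h ∘ e.symm) z (0, k) = 0 := by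
    intro z hz k
    have h1 := ((hdκ _ (hmem z hz)).comp z (hde z hz).hasFDerivAt).unique
      ((hasFDerivAt_id (𝕜 := ℝ) z).congr_of_eventuallyEq (by
        filter_upwards [e.open_target.mem_nhds hz] with y hy
        rw [Function.comp_apply, ← heκ, e.right_inv hy, id_eq]))
    have h2 := congrArg Prod.fst (DFunLike.congr_fun h1 (0, k))
    have h3 := (((hh.contDiffAt (hV.mem_nhds (hmem z hz))).differentiableAt
      (by simp)).hasFDerivAt.comp z (hde z hz).hasFDerivAt).fderiv
    rw [h3]
    exact hker _ (hmem z hz) _ h2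
  have hpt : e p ∈ e.target := e.map_source hpe
  obtain ⟨r, hr, hball⟩ := Metric.isOpen_iff.1 e.open_target _ hpt
  rw [heκ] at hball
  -- On a product of balls the fibres are convex, so zero vertical derivative makes `h` constant on
  -- each fibre, and its value on the slice at `π p` serves as ψ.
  rw [← ball_prod_same] at hball
  refine ⟨fun a => h (e.symm (a, π p)), Metric.ball (g p) r, Metric.isOpen_ball,
    Metric.mem_ball_self hr, ?_, ?_⟩
  · exact hhe.comp (contDiff_id.prodMk contDiff_const).contDiffOn
      fun a ha => hball ⟨ha, Metric.mem_ball_self hr⟩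
  · have hsrc := e.open_source.mem_nhds hpe
    have hpre : e ⁻¹' (Metric.ball (g p) r ×ˢ Metric.ball (π p) r) ∈ 𝓝 p := by
      refine (e.continuousAt hpe).preimage_mem_nhds ?_
      rw [heκ]
      exact prod_mem_nhds (Metric.ball_mem_nhds _ hr) (Metric.ball_mem_nhds _ hr)
    filter_upwards [hsrc, hpre] with x hx hx'
    rw [heκ] at hx'
    have hgx : g x ∈ Metric.ball (g p) r := hx'.1
    have hπx : π x ∈ Metric.ball (π p) r := hx'.2
    have hk' : ∀ k ∈ Metric.ball (π p) r, DifferentiableAt ℝ (h ∘ e.symm) (g x, k) := fun k hk =>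
      (hhe.contDiffAt (e.open_target.mem_nhds (hball ⟨hgx, hk⟩))).differentiableAt (by simp)
    have hd : ∀ k : L.ker, HasFDerivAt (fun k : L.ker => (g x, k))
        (ContinuousLinearMap.inr ℝ F L.ker) k := fun k => hasFDerivAt_prodMk_right (g x) k
    have hconst := Metric.isOpen_ball.is_const_of_fderiv_eq_zero (𝕜 := ℝ)
      (f := fun k => (h ∘ e.symm) (g x, k)) (convex_ball (π p) r).isPreconnected
      (fun k hk => ((hk' k hk).hasFDerivAt.comp k
        (hd k)).differentiableAt.differentiableWithinAt)
      (fun k hk => ?_) hπx (Metric.mem_ball_self hr)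
    · have h1 : e.symm (g x, π x) = x := by
        have := e.left_inv hx
        rwa [heκ] at this
      have h2 : h (e.symm (g x, π x)) = h (e.symm (g x, π p)) := hconst
      rw [← h2, h1]
    · ext1 w
      exact (DFunLike.congr_fun ((hk' k hk).hasFDerivAt.comp k (hd k)).fderiv w).trans
        (hvert _ (hball ⟨hgx, hk⟩) w)

/-- As the derivative of `h` is surjective, so is that of ψ; it is an endomorphism of a
finite-dimensional space, hence injective. -/
theorem exists_isLocalDiffeomorphAt_factorization [CompleteSpace E] [FiniteDimensional ℝ F]
    {g h : E → F} {V : Set E} (hV : IsOpen V) (hg : ContDiffOn ℝ ∞ g V) (hh : ContDiffOn ℝ ∞ h V)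
    {p : E} (hp : p ∈ V) (hgs : Function.Surjective (fderiv ℝ g p))
    (hhs : Function.Surjective (fderiv ℝ h p))
    (hker : ∀ x ∈ V, ∀ v, fderiv ℝ g x v = 0 → fderiv ℝ h x v = 0) :
    ∃ ψ : F → F, IsLocalDiffeomorphAt 𝓘(ℝ, F) 𝓘(ℝ, F) ∞ ψ (g p) ∧
      ∀ᶠ x in 𝓝 p, h x = ψ (g x) := by
  obtain ⟨ψ, W, hW, hpW, hψ, heq⟩ := exists_factorization hV hg hh hp hgs hker
  refine ⟨ψ, isLocalDiffeomorphAt_of_injective hW hψ hpW ?_, heq⟩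
  have h1 := ((hψ.contDiffAt (hW.mem_nhds hpW)).differentiableAt (by simp)).hasFDerivAt.comp p
    ((hg.contDiffAt (hV.mem_nhds hp)).differentiableAt (by simp)).hasFDerivAt
  have h2 := (h1.congr_of_eventuallyEq heq).fderiv
  have h3 : Function.Surjective (fderiv ℝ ψ (g p) : F →ₗ[ℝ] F) := fun y => by
    obtain ⟨v, hv⟩ := hhs y
    rw [h2] at hv
    exact ⟨_, hv⟩
  exact LinearMap.injective_iff_surjective.2 h3

end LocalDiffeomorphisms

/-! ### Product maps φ × ζ -/

section ProductMaps

/-- The product map `φ × ζ` on `ℝ⁴ = ℝ² × ℝ²`. -/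
def productMap (φ ζ : R2 → R2) (x : R4) : R4 := join (φ (firstPair x)) (ζ (lastPair x))

/-- The projection `firstPair` as a continuous linear map. -/
def firstL : R4 →L[ℝ] R2 := (ContinuousLinearMap.fst ℝ R2 R2).comp (joinL.symm : R4 →L[ℝ] R2 × R2)

/-- The projection `lastPair` as a continuous linear map. -/
def lastL : R4 →L[ℝ] R2 := (ContinuousLinearMap.snd ℝ R2 R2).comp (joinL.symm : R4 →L[ℝ] R2 × R2)

@[simp] theorem firstL_apply (x : R4) : firstL x = firstPair x := rfl
@[simp] theorem lastL_apply (x : R4) : lastL x = lastPair x := rfl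
@[simp] theorem firstPair_join (u w : R2) : firstPair (join u w) = u :=
  congrArg Prod.fst (joinL.symm_apply_apply (u, w))
@[simp] theorem lastPair_join (u w : R2) : lastPair (join u w) = w :=
  congrArg Prod.snd (joinL.symm_apply_apply (u, w))

variable {φ ζ : R2 → R2} {x : R4}

theorem hasFDerivAt_productMap (hφ : DifferentiableAt ℝ φ (firstPair x))
    (hζ : DifferentiableAt ℝ ζ (lastPair x)) :
    HasFDerivAt (productMap φ ζ) ((joinL : R2 × R2 →L[ℝ] R4).comp
      (((fderiv ℝ φ (firstPair x)).comp firstL).prod ((fderiv ℝ ζ (lastPair x)).comp lastL))) x :=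
  joinL.hasFDerivAt.comp x
    ((hφ.hasFDerivAt.comp x (f := fun y => firstPair y) firstL.hasFDerivAt).prodMk
      (hζ.hasFDerivAt.comp x (f := fun y => lastPair y) lastL.hasFDerivAt))

theorem fderiv_productMap_apply (hφ : DifferentiableAt ℝ φ (firstPair x))
    (hζ : DifferentiableAt ℝ ζ (lastPair x)) (v : R4) : fderiv ℝ (productMap φ ζ) x v
      = join (fderiv ℝ φ (firstPair x) (firstPair v)) (fderiv ℝ ζ (lastPair x) (lastPair v)) := by
  rw [(hasFDerivAt_productMap hφ hζ).fderiv]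
  rfl

theorem isLocalDiffeomorphAt_productMap
    (hφ : IsLocalDiffeomorphAt 𝓘(ℝ, R2) 𝓘(ℝ, R2) ∞ φ (firstPair x))
    (hζ : IsLocalDiffeomorphAt 𝓘(ℝ, R2) 𝓘(ℝ, R2) ∞ ζ (lastPair x)) :
    IsLocalDiffeomorphAt 𝓘(ℝ, R4) 𝓘(ℝ, R4) ∞ (productMap φ ζ) x := by
  obtain ⟨V, hV, hxV, hφV, -⟩ := exists_nhd_of_isLocalDiffeomorphAt hφ
  obtain ⟨W, hW, hxW, hζW, -⟩ := exists_nhd_of_isLocalDiffeomorphAt hζ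
  refine isLocalDiffeomorphAt_of_injective (V := firstL ⁻¹' V ∩ lastL ⁻¹' W)
    ((hV.preimage firstL.continuous).inter (hW.preimage lastL.continuous)) ?_ ⟨hxV, hxW⟩ ?_
  · exact joinL.contDiff.comp_contDiffOn
      ((hφV.comp firstL.contDiff.contDiffOn fun y hy => hy.1).prodMk
        (hζW.comp lastL.contDiff.contDiffOn fun y hy => hy.2))
  · rw [injective_iff_map_eq_zero]
    intro v hv
    rw [fderiv_productMap_apply hφ.differentiableAt hζ.differentiableAt] at hv
    have h1 := congrArg firstPair hv
    have h2 := congrArg lastPair hv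
    rw [firstPair_join, ← firstL_apply 0, map_zero] at h1
    rw [lastPair_join, ← lastL_apply 0, map_zero] at h2
    have h3 := (injective_iff_map_eq_zero _).1 hφ.fderiv_injective _ h1
    have h4 := (injective_iff_map_eq_zero _).1 hζ.fderiv_injective _ h2
    rw [← join_pairs v, h3, h4]
    exact joinL.map_zero

end ProductMaps

/-! ### Chain rules for first and mixed second derivatives -/

section PartialDerivatives

variable {φ ζ : R2 → R2} {x : R4}

theorem pd_congr {g h : R4 → ℝ} (hgh : g =ᶠ[𝓝 x] h) (j : Fin 4) : pd j g =ᶠ[𝓝 x] pd j h := by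
  filter_upwards [hgh.eventuallyEq_nhds] with y hy
  rw [pd, pd, hy.fderiv_eq]

theorem differentiableAt_pd {g : R4 → ℝ} (hg : ContDiffAt ℝ ∞ g x) (j : Fin 4) :
    DifferentiableAt ℝ (pd j g) x :=
  (differentiableAt_fderiv hg).clm_apply (differentiableAt_const _)

theorem pd_mul_add_mul {a b c d : R4 → ℝ} (ha : DifferentiableAt ℝ a x)
    (hb : DifferentiableAt ℝ b x) (hc : DifferentiableAt ℝ c x) (hd : DifferentiableAt ℝ d x)
    (j : Fin 4) : pd j (fun y => a y * b y + c y * d y) x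
      = pd j a x * b x + a x * pd j b x + (pd j c x * d x + c x * pd j d x) := by
  have h := ((ha.hasFDerivAt.mul hb.hasFDerivAt).add (hc.hasFDerivAt.mul hd.hasFDerivAt)).fderiv
  refine (DFunLike.congr_fun h (EuclideanSpace.single j 1)).trans ?_
  simp only [add_apply, smul_apply, smul_eq_mul, pd]
  ring

theorem eventually_differentiableAt {E F : Type*} [NormedAddCommGroup E] [NormedSpace ℝ E]
    [NormedAddCommGroup F] [NormedSpace ℝ F] {g : E → F} {a : E} (hg : ContDiffAt ℝ ∞ g a) :
    ∀ᶠ y in 𝓝 a, DifferentiableAt ℝ g y :=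
  ((hg.of_le (m := 1) (by norm_cast)).eventually (by simp)).mono fun y hy =>
    hy.differentiableAt (by simp)

theorem pd_comp_productMap {g : R4 → ℝ} (hg : DifferentiableAt ℝ g (productMap φ ζ x))
    (hφ : DifferentiableAt ℝ φ (firstPair x)) (hζ : DifferentiableAt ℝ ζ (lastPair x))
    (j : Fin 4) : pd j (g ∘ productMap φ ζ) x
      = pd 0 g (productMap φ ζ x)
          * fderiv ℝ φ (firstPair x) (firstPair (EuclideanSpace.single j 1)) 0
        + pd 1 g (productMap φ ζ x)
          * fderiv ℝ φ (firstPair x) (firstPair (EuclideanSpace.single j 1)) 1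
        + pd 2 g (productMap φ ζ x)
          * fderiv ℝ ζ (lastPair x) (lastPair (EuclideanSpace.single j 1)) 0
        + pd 3 g (productMap φ ζ x)
          * fderiv ℝ ζ (lastPair x) (lastPair (EuclideanSpace.single j 1)) 1 := by
  have h := (hg.hasFDerivAt.comp x (hasFDerivAt_productMap hφ hζ).differentiableAt.hasFDerivAt)
  rw [pd, h.fderiv, ContinuousLinearMap.comp_apply, fderiv_productMap_apply hφ hζ,
    fderiv_apply_eq]
  simp

/-- With one derivative from each block no second derivatives of φ or ζ occur, since each depends on
its own block only. -/
theorem pd_pd_comp_productMap {g : R4 → ℝ} (hg : ContDiffAt ℝ ∞ g (productMap φ ζ x))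
    (hφ : ContDiffAt ℝ ∞ φ (firstPair x)) (hζ : ContDiffAt ℝ ∞ ζ (lastPair x)) {j k : Fin 4}
    (hj : lastPair (EuclideanSpace.single j 1) = 0)
    (hk : firstPair (EuclideanSpace.single k 1) = 0) :
    pd k (pd j (g ∘ productMap φ ζ)) x
      = (pd 2 (pd 0 g) (productMap φ ζ x)
          * fderiv ℝ ζ (lastPair x) (lastPair (EuclideanSpace.single k 1)) 0
        + pd 3 (pd 0 g) (productMap φ ζ x)
          * fderiv ℝ ζ (lastPair x) (lastPair (EuclideanSpace.single k 1)) 1)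
          * fderiv ℝ φ (firstPair x) (firstPair (EuclideanSpace.single j 1)) 0
        + (pd 2 (pd 1 g) (productMap φ ζ x)
          * fderiv ℝ ζ (lastPair x) (lastPair (EuclideanSpace.single k 1)) 0
        + pd 3 (pd 1 g) (productMap φ ζ x)
          * fderiv ℝ ζ (lastPair x) (lastPair (EuclideanSpace.single k 1)) 1)
          * fderiv ℝ φ (firstPair x) (firstPair (EuclideanSpace.single j 1)) 1 := by
  have hφ₁ := hφ.differentiableAt (n := ∞) (by simp)
  have hζ₁ := hζ.differentiableAt (n := ∞) (by simp)
  have hΘ := (hasFDerivAt_productMap hφ₁ hζ₁).differentiableAt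
  have hcoef : ∀ c : Fin 2, HasFDerivAt (fun y : R4 =>
      fderiv ℝ φ (firstPair y) (firstPair (EuclideanSpace.single j 1)) c)
      (((EuclideanSpace.proj c : R2 →L[ℝ] ℝ).comp ((fderiv ℝ (fderiv ℝ φ) (firstPair x)).flip
        (firstPair (EuclideanSpace.single j 1)))).comp firstL) x := by
    intro c
    have h1 := ((differentiableAt_fderiv hφ).hasFDerivAt.clm_apply
      (hasFDerivAt_const (firstPair (EuclideanSpace.single j 1)) (firstPair x)))
    have h2 := ((EuclideanSpace.proj c : R2 →L[ℝ] ℝ).hasFDerivAt.comp _ h1).comp x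
      (f := fun y => firstPair y) firstL.hasFDerivAt
    refine h2.congr_fderiv ?_
    ext v
    simp
  have heq : pd j (g ∘ productMap φ ζ) =ᶠ[𝓝 x] fun y =>
      (pd 0 g ∘ productMap φ ζ) y
          * fderiv ℝ φ (firstPair y) (firstPair (EuclideanSpace.single j 1)) 0
        + (pd 1 g ∘ productMap φ ζ) y
          * fderiv ℝ φ (firstPair y) (firstPair (EuclideanSpace.single j 1)) 1 := by
    filter_upwards [hΘ.continuousAt.eventually (eventually_differentiableAt hg),
      firstL.continuous.continuousAt.eventually (eventually_differentiableAt hφ),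
      lastL.continuous.continuousAt.eventually (eventually_differentiableAt hζ)] with y h1 h2 h3
    rw [pd_comp_productMap h1 h2 h3, hj, map_zero]
    simp
  have hz : ∀ c : Fin 2, pd k (fun y : R4 =>
      fderiv ℝ φ (firstPair y) (firstPair (EuclideanSpace.single j 1)) c) x = 0 := fun c => by
    rw [pd, (hcoef c).fderiv]
    simp [hk]
  have hd : ∀ c, DifferentiableAt ℝ (pd c g ∘ productMap φ ζ) x := fun c =>
    (differentiableAt_pd hg c).comp x hΘ
  rw [pd, heq.fderiv_eq, ← pd, pd_mul_add_mul (hd 0) (hcoef 0).differentiableAt (hd 1)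
    (hcoef 1).differentiableAt, hz, hz,
    pd_comp_productMap (differentiableAt_pd hg 0) hφ₁ hζ₁,
    pd_comp_productMap (differentiableAt_pd hg 1) hφ₁ hζ₁, hk, map_zero]
  simp

theorem pd_comp_values {Ψ : R2 → ℝ} {g : Fin 2 → R4 → ℝ}
    (hΨ : DifferentiableAt ℝ Ψ (values g x)) (hg : ∀ i, DifferentiableAt ℝ (g i) x) (j : Fin 4) :
    pd j (Ψ ∘ values g) x
      = fderiv ℝ Ψ (values g x) (EuclideanSpace.single 0 1) * pd j (g 0) x
        + fderiv ℝ Ψ (values g x) (EuclideanSpace.single 1 1) * pd j (g 1) x := by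
  have hv : DifferentiableAt ℝ (values g) x :=
    differentiableAt_euclidean.2 fun i => by simpa using hg i
  have h1 : fderiv ℝ (values g) x (EuclideanSpace.single j 1)
      = pd j (g 0) x • EuclideanSpace.single 0 1 + pd j (g 1) x • EuclideanSpace.single 1 1 := by
    ext i
    rw [fderiv_values_apply hg]
    fin_cases i <;> simp [pd]
  rw [pd, (hΨ.hasFDerivAt.comp x hv.hasFDerivAt).fderiv, ContinuousLinearMap.comp_apply, h1,
    map_add, map_smul, map_smul, smul_eq_mul, smul_eq_mul]
  ring

/-- The second derivatives of Ψ enter only through a quadratic form with symmetric coefficients,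
independent of j and k. Their values are irrelevant, as these terms cancel in the system. -/
theorem pd_pd_comp_values {Ψ : R2 → ℝ} {g : Fin 2 → R4 → ℝ}
    (hΨ : ContDiffAt ℝ ∞ Ψ (values g x)) (hg : ∀ i, ContDiffAt ℝ ∞ (g i) x) :
    ∃ s₀₀ s₀₁ s₁₁ : ℝ, ∀ j k : Fin 4, pd k (pd j (Ψ ∘ values g)) x
      = fderiv ℝ Ψ (values g x) (EuclideanSpace.single 0 1) * pd k (pd j (g 0)) x
        + fderiv ℝ Ψ (values g x) (EuclideanSpace.single 1 1) * pd k (pd j (g 1)) x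
        + (s₀₀ * pd j (g 0) x * pd k (g 0) x
          + s₀₁ * (pd j (g 0) x * pd k (g 1) x + pd j (g 1) x * pd k (g 0) x)
          + s₁₁ * pd j (g 1) x * pd k (g 1) x) := by
  have hd : ∀ i, DifferentiableAt ℝ (g i) x := fun i => (hg i).differentiableAt (by simp)
  have hv : ContDiffAt ℝ ∞ (values g) x := contDiffAt_values hg
  have hv₁ : DifferentiableAt ℝ (values g) x := hv.differentiableAt (by simp)
  have hcoef : ∀ a : R2, HasFDerivAt (fun u => fderiv ℝ Ψ u a)
      ((fderiv ℝ (fderiv ℝ Ψ) (values g x)).flip a) (values g x) := fun a => by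
    refine ((differentiableAt_fderiv hΨ).hasFDerivAt.clm_apply
      (hasFDerivAt_const a (values g x))).congr_fderiv ?_
    ext v
    simp
  refine ⟨fderiv ℝ (fderiv ℝ Ψ) (values g x) (EuclideanSpace.single 0 1)
      (EuclideanSpace.single 0 1),
    fderiv ℝ (fderiv ℝ Ψ) (values g x) (EuclideanSpace.single 0 1) (EuclideanSpace.single 1 1),
    fderiv ℝ (fderiv ℝ Ψ) (values g x) (EuclideanSpace.single 1 1) (EuclideanSpace.single 1 1),
    fun j k => ?_⟩
  have heq : pd j (Ψ ∘ values g) =ᶠ[𝓝 x] fun y =>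
      ((fun u => fderiv ℝ Ψ u (EuclideanSpace.single 0 1)) ∘ values g) y * pd j (g 0) y
        + ((fun u => fderiv ℝ Ψ u (EuclideanSpace.single 1 1)) ∘ values g) y
          * pd j (g 1) y := by
    filter_upwards [hv₁.continuousAt.eventually (eventually_differentiableAt hΨ),
      eventually_differentiableAt (hg 0), eventually_differentiableAt (hg 1)] with y h1 h2 h3
    exact pd_comp_values h1 (Fin.forall_fin_two.2 ⟨h2, h3⟩) j
  have hdc : ∀ a : R2, DifferentiableAt ℝ ((fun u => fderiv ℝ Ψ u a) ∘ values g) x := fun a =>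
    (hcoef a).differentiableAt.comp x hv₁
  rw [pd, heq.fderiv_eq, ← pd, pd_mul_add_mul (hdc _) (differentiableAt_pd (hg 0) j) (hdc _)
    (differentiableAt_pd (hg 1) j), pd_comp_values (hcoef _).differentiableAt hd,
    pd_comp_values (hcoef _).differentiableAt hd, (hcoef _).fderiv, (hcoef _).fderiv]
  simp only [ContinuousLinearMap.flip_apply, Function.comp_apply]
  rw [fderiv_fderiv_symm hΨ (EuclideanSpace.single 1 1) (EuclideanSpace.single 0 1)]
  ring

end PartialDerivatives

/-! ### Invariance of (H) and (J) under changes of variables -/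

section Invariance

/-- The left-hand side of the `i`-th equation, up to sign. -/
def systemExpr (f : Fin 2 → R4 → ℝ) (i : Fin 2) (x : R4) : ℝ :=
  pd 2 (pd 0 (f i)) x * minor f 0 1 3 x - pd 3 (pd 0 (f i)) x * minor f 0 1 2 x
    - pd 2 (pd 1 (f i)) x * minor f 0 0 3 x + pd 3 (pd 1 (f i)) x * minor f 0 0 2 x

theorem solvesAt_iff {f : Fin 2 → R4 → ℝ} {x : R4} :
    SolvesAt f x ↔ ∀ i, systemExpr f i x = 0 := by
  unfold SolvesAt systemExpr
  simp only [Fin.forall_fin_two, minor_one]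
  refine and_congr_right fun _ => ⟨fun h => ?_, fun h => ?_⟩ <;> linear_combination -h

variable {f g : Fin 2 → R4 → ℝ} {x : R4}

theorem minor_congr (h : ∀ i, f i =ᶠ[𝓝 x] g i) (i : Fin 2) (j k : Fin 4) :
    minor f i j k x = minor g i j k x := by
  unfold minor
  rw [(pd_congr (h i) j).eq_of_nhds, (pd_congr (h i) k).eq_of_nhds,
    (pd_congr (h (1 - i)) j).eq_of_nhds, (pd_congr (h (1 - i)) k).eq_of_nhds]

theorem systemExpr_congr (h : ∀ i, f i =ᶠ[𝓝 x] g i) (i : Fin 2) :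
    systemExpr f i x = systemExpr g i x := by
  have h2 : ∀ j k, pd k (pd j (f i)) x = pd k (pd j (g i)) x := fun j k =>
    (pd_congr (pd_congr (h i) j) k).eq_of_nhds
  unfold systemExpr
  simp only [minor_congr h, h2]

theorem minor_zero (f : Fin 2 → R4 → ℝ) (j k : Fin 4) (x : R4) :
    minor f 0 j k x = pd j (f 0) x * pd k (f 1) x - pd j (f 1) x * pd k (f 0) x := by
  simp [minor]

/-- The Jacobian determinant of a map of the plane. -/
def planeJacobian (φ : R2 → R2) (u : R2) : ℝ :=
  fderiv ℝ φ u (EuclideanSpace.single 0 1) 0 * fderiv ℝ φ u (EuclideanSpace.single 1 1) 1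
    - fderiv ℝ φ u (EuclideanSpace.single 0 1) 1 * fderiv ℝ φ u (EuclideanSpace.single 1 1) 0

theorem planeJacobian_ne_zero {φ : R2 → R2} {u : R2} (h : Function.Injective (fderiv ℝ φ u)) :
    planeJacobian φ u ≠ 0 := by
  have := det_ne_zero_of_forall (a := fderiv ℝ φ u (EuclideanSpace.single 0 1) 0)
    (b := fderiv ℝ φ u (EuclideanSpace.single 1 1) 0)
    (c := fderiv ℝ φ u (EuclideanSpace.single 0 1) 1)
    (d := fderiv ℝ φ u (EuclideanSpace.single 1 1) 1) fun s t h0 h1 => by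
    have h2 : fderiv ℝ φ u (s • EuclideanSpace.single 0 1 + t • EuclideanSpace.single 1 1) = 0 := by
      ext i
      rw [map_add, map_smul, map_smul]
      fin_cases i
      · simp only [Fin.zero_eta, PiLp.add_apply, PiLp.smul_apply, smul_eq_mul, PiLp.zero_apply]
        linear_combination h0
      · simp only [Fin.mk_one, PiLp.add_apply, PiLp.smul_apply, smul_eq_mul, PiLp.zero_apply]
        linear_combination h1
    have h3 := (injective_iff_map_eq_zero _).1 h _ h2
    have h4 := congrArg (fun v : R2 => v 0) h3
    have h5 := congrArg (fun v : R2 => v 1) h3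
    simp at h4 h5
    exact ⟨h4, h5⟩
  exact this

theorem firstPair_single_zero :
    firstPair (EuclideanSpace.single 0 1) = EuclideanSpace.single 0 1 := by
  ext i; fin_cases i <;> simp
theorem firstPair_single_one :
    firstPair (EuclideanSpace.single 1 1) = EuclideanSpace.single 1 1 := by
  ext i; fin_cases i <;> simp
theorem firstPair_single_two : firstPair (EuclideanSpace.single 2 1) = 0 := by
  ext i; fin_cases i <;> simp
theorem firstPair_single_three : firstPair (EuclideanSpace.single 3 1) = 0 := by
  ext i; fin_cases i <;> simp
theorem lastPair_single_zero : lastPair (EuclideanSpace.single 0 1) = 0 := by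
  ext i; fin_cases i <;> simp
theorem lastPair_single_one : lastPair (EuclideanSpace.single 1 1) = 0 := by
  ext i; fin_cases i <;> simp
theorem lastPair_single_two :
    lastPair (EuclideanSpace.single 2 1) = EuclideanSpace.single 0 1 := by
  ext i; fin_cases i <;> simp
theorem lastPair_single_three :
    lastPair (EuclideanSpace.single 3 1) = EuclideanSpace.single 1 1 := by
  ext i; fin_cases i <;> simp

variable {φ ζ : R2 → R2}

theorem minors_comp_productMap (hg : ∀ i, DifferentiableAt ℝ (g i) (productMap φ ζ x))
    (hφ : DifferentiableAt ℝ φ (firstPair x)) (hζ : DifferentiableAt ℝ ζ (lastPair x)) :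
    minor (fun i => g i ∘ productMap φ ζ) 0 0 1 x
        = planeJacobian φ (firstPair x) * minor g 0 0 1 (productMap φ ζ x) ∧
      minor (fun i => g i ∘ productMap φ ζ) 0 2 3 x
        = planeJacobian ζ (lastPair x) * minor g 0 2 3 (productMap φ ζ x) := by
  simp only [minor_zero, pd_comp_productMap (hg _) hφ hζ, planeJacobian, firstPair_single_zero,
    firstPair_single_one, firstPair_single_two, firstPair_single_three, lastPair_single_zero,
    lastPair_single_one, lastPair_single_two, lastPair_single_three, map_zero, PiLp.zero_apply]
  constructor <;> ring

theorem systemExpr_comp_productMap (hg : ∀ i, ContDiffAt ℝ ∞ (g i) (productMap φ ζ x))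
    (hφ : ContDiffAt ℝ ∞ φ (firstPair x)) (hζ : ContDiffAt ℝ ∞ ζ (lastPair x)) (i : Fin 2) :
    systemExpr (fun i => g i ∘ productMap φ ζ) i x
      = planeJacobian φ (firstPair x) * planeJacobian ζ (lastPair x)
        * systemExpr g i (productMap φ ζ x) := by
  have h1 := fun i j => pd_comp_productMap ((hg i).differentiableAt (by simp))
    (hφ.differentiableAt (by simp)) (hζ.differentiableAt (by simp)) j
  have e20 := pd_pd_comp_productMap (hg i) hφ hζ lastPair_single_zero firstPair_single_two
  have e30 := pd_pd_comp_productMap (hg i) hφ hζ lastPair_single_zero firstPair_single_three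
  have e21 := pd_pd_comp_productMap (hg i) hφ hζ lastPair_single_one firstPair_single_two
  have e31 := pd_pd_comp_productMap (hg i) hφ hζ lastPair_single_one firstPair_single_three
  simp only [systemExpr, minor_zero, e20, e30, e21, e31, h1, planeJacobian, firstPair_single_zero,
    firstPair_single_one, firstPair_single_two, firstPair_single_three, lastPair_single_zero,
    lastPair_single_one, lastPair_single_two, lastPair_single_three, map_zero, PiLp.zero_apply]
  ring

variable {ψ : R2 → R2}

theorem fderiv_coord_apply {u : R2} (hψ : DifferentiableAt ℝ ψ u) (i : Fin 2) (v : R2) :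
    fderiv ℝ (fun u => ψ u i) u v = fderiv ℝ ψ u v i := by
  have h := ((EuclideanSpace.proj i : R2 →L[ℝ] ℝ).hasFDerivAt.comp u hψ.hasFDerivAt).fderiv
  exact DFunLike.congr_fun h v

theorem minor_comp_values (hψ : DifferentiableAt ℝ ψ (values g x))
    (hg : ∀ i, DifferentiableAt ℝ (g i) x) (j k : Fin 4) :
    minor (fun i => (fun u => ψ u i) ∘ values g) 0 j k x
      = planeJacobian ψ (values g x) * minor g 0 j k x := by
  have hψi : ∀ i, DifferentiableAt ℝ (fun u => ψ u i) (values g x) :=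
    differentiableAt_euclidean.1 hψ
  simp only [minor_zero, pd_comp_values (hψi _) hg, fderiv_coord_apply hψ, planeJacobian]
  ring

/-- All minors acquire the factor det Dψ. The terms with second derivatives of ψ vanish identically
when contracted with the minors, so the two equations are mixed linearly by Dψ. -/
theorem systemExpr_comp_values (hψ : ContDiffAt ℝ ∞ ψ (values g x))
    (hg : ∀ i, ContDiffAt ℝ ∞ (g i) x) (i : Fin 2) :
    systemExpr (fun i => (fun u => ψ u i) ∘ values g) i x = planeJacobian ψ (values g x)
      * (fderiv ℝ ψ (values g x) (EuclideanSpace.single 0 1) i * systemExpr g 0 x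
        + fderiv ℝ ψ (values g x) (EuclideanSpace.single 1 1) i * systemExpr g 1 x) := by
  have hψ₁ : DifferentiableAt ℝ ψ (values g x) := hψ.differentiableAt (by simp)
  obtain ⟨s₀₀, s₀₁, s₁₁, h2⟩ := pd_pd_comp_values (contDiffAt_euclidean.1 hψ i) hg
  have hm := fun j k => minor_comp_values hψ₁ (fun i => (hg i).differentiableAt (by simp)) j k
  simp only [systemExpr, hm, h2, fderiv_coord_apply hψ₁]
  simp only [minor_zero]
  ring

/-- The pair of left-hand sides is multiplied by an invertible matrix, Dψ times three nonzero
Jacobians, so its vanishing passes from `f` to `g`. -/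
theorem solvesAt_and_jacobiansAt_of_comp (hfg : values f =ᶠ[𝓝 x] ψ ∘ values g ∘ productMap φ ζ)
    (hg : ∀ i, ContDiffAt ℝ ∞ (g i) (productMap φ ζ x))
    (hψ : IsLocalDiffeomorphAt 𝓘(ℝ, R2) 𝓘(ℝ, R2) ∞ ψ (values g (productMap φ ζ x)))
    (hφ : IsLocalDiffeomorphAt 𝓘(ℝ, R2) 𝓘(ℝ, R2) ∞ φ (firstPair x))
    (hζ : IsLocalDiffeomorphAt 𝓘(ℝ, R2) 𝓘(ℝ, R2) ∞ ζ (lastPair x)) :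
    (SolvesAt f x → SolvesAt g (productMap φ ζ x)) ∧
      (JacobiansAt f x → JacobiansAt g (productMap φ ζ x)) := by
  have hΘ : ContDiffAt ℝ ∞ (productMap φ ζ) x := (isLocalDiffeomorphAt_productMap hφ hζ).contDiffAt
  have hgΘ : ∀ i, ContDiffAt ℝ ∞ (g i ∘ productMap φ ζ) x := fun i => (hg i).comp x hΘ
  have hf : ∀ i, f i =ᶠ[𝓝 x] (fun u => ψ u i) ∘ values fun i => g i ∘ productMap φ ζ := fun i => by
    filter_upwards [hfg] with y hy
    rw [← values_apply f, hy]
    rfl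
  have hψ' : ContDiffAt ℝ ∞ ψ (values (fun i => g i ∘ productMap φ ζ) x) := hψ.contDiffAt
  have hdψ : planeJacobian ψ (values (fun i => g i ∘ productMap φ ζ) x) ≠ 0 :=
    planeJacobian_ne_zero hψ.fderiv_injective
  have hdφ := planeJacobian_ne_zero hφ.fderiv_injective
  have hdζ := planeJacobian_ne_zero hζ.fderiv_injective
  constructor
  · rw [solvesAt_iff, solvesAt_iff]
    intro h
    have h' := fun i => (systemExpr_congr hf i).symm.trans (h i)
    simp only [systemExpr_comp_values hψ' hgΘ, mul_eq_zero, hdψ, false_or] at h'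
    obtain ⟨h0, h1⟩ := eq_zero_of_det_ne_zero (by
      unfold planeJacobian at hdψ
      contrapose! hdψ
      linear_combination hdψ) (h' 0) (h' 1)
    rw [systemExpr_comp_productMap hg hφ.contDiffAt hζ.contDiffAt] at h0 h1
    have hne := mul_ne_zero hdφ hdζ
    exact Fin.forall_fin_two.2
      ⟨(mul_eq_zero.1 h0).resolve_left hne, (mul_eq_zero.1 h1).resolve_left hne⟩
  · unfold JacobiansAt
    have hd : ∀ i, DifferentiableAt ℝ (g i ∘ productMap φ ζ) x := fun i =>
      (hgΘ i).differentiableAt (by simp)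
    obtain ⟨e1, e2⟩ := minors_comp_productMap (fun i => (hg i).differentiableAt (by simp))
      hφ.differentiableAt hζ.differentiableAt
    rw [minor_congr hf, minor_congr hf, minor_comp_values (hψ'.differentiableAt (by simp)) hd,
      minor_comp_values (hψ'.differentiableAt (by simp)) hd, e1, e2]
    exact fun h => ⟨right_ne_zero_of_mul (right_ne_zero_of_mul h.1),
      right_ne_zero_of_mul (right_ne_zero_of_mul h.2)⟩

end Invariance

/-! ### The equivalence relation on germs of solutions -/

section GermEquivalence

theorem germEquiv_iff {f : Fin 2 → R4 → ℝ} {p : R4} {g : Fin 2 → R4 → ℝ} {p' : R4} :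
    GermEquiv f p g p' ↔ ∃ ψ φ ζ : R2 → R2,
      IsLocalDiffeomorphAt 𝓘(ℝ, R2) 𝓘(ℝ, R2) ∞ ψ (values g p') ∧
      IsLocalDiffeomorphAt 𝓘(ℝ, R2) 𝓘(ℝ, R2) ∞ φ (firstPair p) ∧
      IsLocalDiffeomorphAt 𝓘(ℝ, R2) 𝓘(ℝ, R2) ∞ ζ (lastPair p) ∧
      productMap φ ζ p = p' ∧ values f =ᶠ[𝓝 p] ψ ∘ values g ∘ productMap φ ζ :=
  Iff.rfl

theorem GermEquiv.eventually {f g : Fin 2 → R4 → ℝ} {p p' : R4} {U : Set R4}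
    (h : GermEquiv f p g p') (hU : IsOpen U) (hp : p' ∈ U) (hg : ∀ i, ContDiffOn ℝ ∞ (g i) U) :
    ((∀ᶠ x in 𝓝 p, SolvesAt f x) → ∀ᶠ x in 𝓝 p', SolvesAt g x) ∧
      ((∀ᶠ x in 𝓝 p, JacobiansAt f x) → ∀ᶠ x in 𝓝 p', JacobiansAt g x) := by
  obtain ⟨ψ, φ, ζ, hψ, hφ, hζ, rfl, heq⟩ := germEquiv_iff.1 h
  have hΘ := isLocalDiffeomorphAt_productMap hφ hζ
  have hgΘ : ContinuousAt (values g ∘ productMap φ ζ) p :=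
    ((contDiffOn_values hg).contDiffAt (hU.mem_nhds hp)).continuousAt.comp
      hΘ.differentiableAt.continuousAt
  have hkey : ∀ᶠ x in 𝓝 p, (SolvesAt f x → SolvesAt g (productMap φ ζ x)) ∧
      (JacobiansAt f x → JacobiansAt g (productMap φ ζ x)) := by
    filter_upwards [heq.eventuallyEq_nhds, hgΘ.eventually (eventually_isLocalDiffeomorphAt hψ),
      firstL.continuous.continuousAt.eventually (eventually_isLocalDiffeomorphAt hφ),
      lastL.continuous.continuousAt.eventually (eventually_isLocalDiffeomorphAt hζ),
      hΘ.differentiableAt.continuousAt (hU.mem_nhds hp)] with x h1 h2 h3 h4 h5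
    exact solvesAt_and_jacobiansAt_of_comp h1 (fun i => (hg i).contDiffAt (hU.mem_nhds h5)) h2 h3 h4
  rw [← hΘ.map_nhds_eq]
  exact ⟨fun h => Filter.mem_map.2 ((h.and hkey).mono fun x hx => hx.2.1 hx.1),
    fun h => Filter.mem_map.2 ((h.and hkey).mono fun x hx => hx.2.2 hx.1)⟩

theorem GermEquiv.refl (f : Fin 2 → R4 → ℝ) (p : R4) : GermEquiv f p f p :=
  germEquiv_iff.2 ⟨id, id, id, isLocalDiffeomorphAt_id _, isLocalDiffeomorphAt_id _,
    isLocalDiffeomorphAt_id _, join_pairs p, Filter.Eventually.of_forall fun x =>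
      (congrArg (values f) (join_pairs x)).symm⟩

/-- Continuity of `g` keeps its values in the domain where the local inverse of ψ is a left inverse.
-/
theorem GermEquiv.symm {f g : Fin 2 → R4 → ℝ} {p p' : R4} (h : GermEquiv f p g p')
    (hg : ContinuousAt (values g) p') : GermEquiv g p' f p := by
  obtain ⟨ψ, φ, ζ, hψ, hφ, hζ, rfl, heq⟩ := germEquiv_iff.1 h
  have hΘ := isLocalDiffeomorphAt_productMap hφ hζ
  have hinv : ∀ᶠ x in 𝓝 p,
      productMap hφ.localInverse hζ.localInverse (productMap φ ζ x) = x := by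
    filter_upwards [firstL.continuous.continuousAt.eventually hφ.localInverse_eventuallyEq_left,
      lastL.continuous.continuousAt.eventually hζ.localInverse_eventuallyEq_left] with x h1 h2
    unfold productMap
    rw [firstPair_join, lastPair_join]
    exact (congrArg₂ join h1 h2).trans (join_pairs x)
  refine germEquiv_iff.2 ⟨hψ.localInverse, hφ.localInverse, hζ.localInverse, ?_, ?_, ?_,
    hinv.self_of_nhds, ?_⟩
  · rw [heq.eq_of_nhds]
    exact hψ.localInverse_isLocalDiffeomorphAt
  · unfold productMap
    rw [firstPair_join]
    exact hφ.localInverse_isLocalDiffeomorphAt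
  · unfold productMap
    rw [lastPair_join]
    exact hζ.localInverse_isLocalDiffeomorphAt
  · rw [← hΘ.map_nhds_eq]
    refine Filter.mem_map.2 ?_
    filter_upwards [hinv, heq, (hg.comp hΘ.differentiableAt.continuousAt).eventually
      hψ.localInverse_eventuallyEq_left] with x h1 h2 h3
    rw [Set.mem_preimage, Set.mem_ofPred_eq, Function.comp_apply, Function.comp_apply, h1, h2]
    exact h3.symm

theorem GermEquiv.trans {f g h : Fin 2 → R4 → ℝ} {p p' p'' : R4} (hfg : GermEquiv f p g p')
    (hgh : GermEquiv g p' h p'') : GermEquiv f p h p'' := by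
  obtain ⟨ψ, φ, ζ, hψ, hφ, hζ, rfl, heq⟩ := germEquiv_iff.1 hfg
  obtain ⟨ψ', φ', ζ', hψ', hφ', hζ', rfl, heq'⟩ := germEquiv_iff.1 hgh
  have hΘ := isLocalDiffeomorphAt_productMap hφ hζ
  have hcomp : ∀ x, productMap (φ' ∘ φ) (ζ' ∘ ζ) x = productMap φ' ζ' (productMap φ ζ x) := by
    intro x
    unfold productMap
    rw [firstPair_join, lastPair_join]
    rfl
  refine germEquiv_iff.2 ⟨ψ ∘ ψ', φ' ∘ φ, ζ' ∘ ζ, hψ'.comp 𝓘(ℝ, R2) R2 ?_,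
    hφ.comp 𝓘(ℝ, R2) R2 ?_, hζ.comp 𝓘(ℝ, R2) R2 ?_, hcomp p, ?_⟩
  · rw [heq'.eq_of_nhds] at hψ
    exact hψ
  · unfold productMap at hφ'
    rwa [firstPair_join] at hφ'
  · unfold productMap at hζ'
    rwa [lastPair_join] at hζ'
  · filter_upwards [heq, hΘ.differentiableAt.continuousAt.eventually heq'] with x h1 h2
    rw [h1, Function.comp_apply, Function.comp_apply, h2]
    simp only [Function.comp_apply, hcomp]

theorem LocalSolution.contDiffAt_values (σ : LocalSolution) {x : R4} (hx : x ∈ σ.U) :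
    ContDiffAt ℝ ∞ (values σ.f) x :=
  (contDiffOn_values σ.smooth).contDiffAt (σ.isOpen.mem_nhds hx)

theorem equivalence_localSolution : Equivalence LocalSolution.Equiv where
  refl σ := GermEquiv.refl σ.f σ.p
  symm {_ τ} h := GermEquiv.symm h (τ.contDiffAt_values τ.mem).continuousAt
  trans h h' := GermEquiv.trans h h'

end GermEquivalence

/-! ### Isomorphism of local webs -/

section WebIsomorphisms

variable {lam₁ lam₃ : ℝ}

theorem LocalWeb.Iso.symm {W W' : LocalWeb lam₁ lam₃} (h : W.Iso W') : W'.Iso W := by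
  obtain ⟨Θ, hΘ, hp, hiso⟩ := h
  have hleft := hΘ.localInverse_eventuallyEq_left
  refine ⟨hΘ.localInverse, hp ▸ hΘ.localInverse_isLocalDiffeomorphAt, ?_, ?_⟩
  · rw [← hp]
    exact hleft.eq_of_nhds
  · rw [← hp, ← hΘ.map_nhds_eq]
    refine Filter.mem_map.2 ?_
    have hd := hΘ.differentiableAt.continuousAt.eventually
      (eventually_isLocalDiffeomorphAt hΘ.localInverse_isLocalDiffeomorphAt)
    filter_upwards [hiso, hleft.eventuallyEq_nhds, hd, eventually_isLocalDiffeomorphAt hΘ]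
      with x h1 h2 h3 h4
    intro s v
    have hx : hΘ.localInverse (Θ x) = x := h2.eq_of_nhds
    have hcomp : ∀ w, fderiv ℝ hΘ.localInverse (Θ x) (fderiv ℝ Θ x w) = w := fun w =>
      DFunLike.congr_fun ((h3.differentiableAt.hasFDerivAt.comp x
        h4.differentiableAt.hasFDerivAt).unique
          ((hasFDerivAt_id (𝕜 := ℝ) x).congr_of_eventuallyEq h2)) w
    obtain ⟨w, rfl⟩ : ∃ w, fderiv ℝ Θ x w = v :=
      (LinearMap.injective_iff_surjective (f := (fderiv ℝ Θ x : R4 →ₗ[ℝ] R4))).1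
        h4.fderiv_injective v
    rw [hcomp, hx]
    exact (h1 s w).symm

theorem equivalence_localWebIso :
    Equivalence (LocalWeb.Iso (lam₁ := lam₁) (lam₃ := lam₃)) where
  refl W := ⟨id, isLocalDiffeomorphAt_id _, rfl, Filter.Eventually.of_forall fun x s v => by
    rw [fderiv_id]; rfl⟩
  symm h := h.symm
  trans {W W' W''} h h' := by
    obtain ⟨Θ, hΘ, hp, hiso⟩ := h
    obtain ⟨Θ', hΘ', hp', hiso'⟩ := h'
    rw [← hp] at hΘ' hiso'
    refine ⟨Θ' ∘ Θ, hΘ.comp 𝓘(ℝ, R4) R4 hΘ', by rw [Function.comp_apply, hp, hp'], ?_⟩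
    have hc := hΘ.differentiableAt.continuousAt
    filter_upwards [hiso, hc.eventually hiso', eventually_isLocalDiffeomorphAt hΘ,
      hc.eventually (eventually_isLocalDiffeomorphAt hΘ')] with x h1 h2 h3 h4
    intro s v
    rw [(h4.differentiableAt.hasFDerivAt.comp x h3.differentiableAt.hasFDerivAt).fderiv]
    exact (h1 s v).trans (h2 s _)

end WebIsomorphisms

/-! ### The correspondence between classes -/

section Classification

variable {lam₁ lam₃ : ℝ}

/-- The local web of a local solution. -/
def LocalSolution.web (hlam : lam₁ ≠ lam₃) (σ : LocalSolution) : LocalWeb lam₁ lam₃ where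
  U := σ.U
  isOpen := σ.isOpen
  p := σ.p
  mem := σ.mem
  F := formWeb lam₁ lam₃ σ.f
  threeWebType := isThreeWebTypeOn_formWeb hlam σ.isOpen σ.smooth σ.solves σ.jacobians
  straight x hx := straightAt_formWeb hlam (σ.jacobians x hx)
  infty_level := ⟨σ.f, σ.smooth, fun x _ => inftyLevelAt_formWeb lam₁ lam₃ σ.f x⟩

theorem LocalSolution.web_definedBy (hlam : lam₁ ≠ lam₃) (σ : LocalSolution) :
    (σ.web hlam).DefinedBy σ :=
  ⟨rfl, Filter.Eventually.of_forall fun _ _ => rfl⟩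

/-- Moves the coefficients from the forms to the blocks of the vector. Block scaling commutes with
the derivative of a product map, which is why φ × ζ carries one form web to the other. -/
theorem mem_formWeb_iff_fderiv {f : Fin 2 → R4 → ℝ} {x : R4}
    (hf : ∀ i, DifferentiableAt ℝ (f i) x) {s : OnePoint ℝ} {v : R4} :
    v ∈ formWeb lam₁ lam₃ f s x ↔ fderiv ℝ (values f) x
      (join (coeff lam₃ s • firstPair v) (coeff lam₁ s • lastPair v)) = 0 := by
  rw [mem_formWeb, PiLp.ext_iff]
  refine forall_congr' fun i => ?_
  rw [fderiv_values_apply hf, fderiv_apply_eq]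
  simp only [join_zero, join_one, join_two, join_three, PiLp.smul_apply, firstPair_zero,
    firstPair_one, lastPair_zero, lastPair_one, smul_eq_mul, PiLp.zero_apply]
  refine Eq.congr_left ?_
  ring

/-- The isomorphism is φ × ζ, and the injective derivative of ψ does not affect kernels. The webs
are only required to be defined by the solutions near the base points, so the class does not depend
on this choice. -/
theorem LocalSolution.iso_of_equiv {σ τ : LocalSolution} (h : σ.Equiv τ)
    {W W' : LocalWeb lam₁ lam₃} (hW : W.DefinedBy σ) (hW' : W'.DefinedBy τ) : W.Iso W' := by
  obtain ⟨ψ, φ, ζ, hψ, hφ, hζ, hp, heq⟩ := germEquiv_iff.1 h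
  have hΘ := isLocalDiffeomorphAt_productMap hφ hζ
  have hc := hΘ.differentiableAt.continuousAt
  refine ⟨productMap φ ζ, hW.1 ▸ hΘ, by rw [hW.1, hp, hW'.1], ?_⟩
  rw [hW.1]
  have hτU : τ.U ∈ 𝓝 (productMap φ ζ σ.p) := hp ▸ τ.isOpen.mem_nhds τ.mem
  have hτW := hW'.2
  rw [← hp] at hτW hψ
  have hgΘ : ContinuousAt (values τ.f ∘ productMap φ ζ) σ.p :=
    (τ.contDiffAt_values (hp.symm ▸ τ.mem)).continuousAt.comp hc
  filter_upwards [hW.2, hc.eventually hτW, hc hτU, σ.isOpen.mem_nhds σ.mem,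
    firstL.continuous.continuousAt.eventually (eventually_isLocalDiffeomorphAt hφ),
    lastL.continuous.continuousAt.eventually (eventually_isLocalDiffeomorphAt hζ),
    hgΘ.eventually (eventually_isLocalDiffeomorphAt hψ), heq.eventuallyEq_nhds]
    with x h1 h2 hxτ hxσ h3 h4 h5 h6
  intro s v
  have hdτ : ∀ i, DifferentiableAt ℝ (τ.f i) (productMap φ ζ x) := fun i =>
    ((τ.smooth i).contDiffAt (τ.isOpen.mem_nhds hxτ)).differentiableAt (by simp)
  have hdσ : ∀ i, DifferentiableAt ℝ (σ.f i) x := fun i =>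
    ((σ.smooth i).contDiffAt (σ.isOpen.mem_nhds hxσ)).differentiableAt (by simp)
  have hcomp : ∀ w, fderiv ℝ (values σ.f) x w = fderiv ℝ ψ (values τ.f (productMap φ ζ x))
      (fderiv ℝ (values τ.f) (productMap φ ζ x) (fderiv ℝ (productMap φ ζ) x w)) := by
    intro w
    rw [h6.fderiv_eq, (h5.differentiableAt.hasFDerivAt.comp x
      (((τ.contDiffAt_values hxτ).differentiableAt (by simp)).hasFDerivAt.comp x
        (isLocalDiffeomorphAt_productMap h3 h4).differentiableAt.hasFDerivAt)).fderiv]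
    rfl
  rw [h1, h2, mem_formWeb_iff_fderiv hdσ, mem_formWeb_iff_fderiv hdτ, hcomp,
    fderiv_productMap_apply h3.differentiableAt h4.differentiableAt,
    fderiv_productMap_apply h3.differentiableAt h4.differentiableAt]
  simp only [firstPair_join, lastPair_join, map_smul]
  exact (injective_iff_map_eq_zero' _).1 h5.fderiv_injective _

theorem fderiv_values_surjective {f : Fin 2 → R4 → ℝ} {x : R4}
    (hf : ∀ i, DifferentiableAt ℝ (f i) x) (hJ : JacobiansAt f x) :
    Function.Surjective (fderiv ℝ (values f) x) := by
  have hv : DifferentiableAt ℝ (values f) x :=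
    differentiableAt_euclidean.2 fun i => by simpa using hf i
  obtain ⟨z, rfl⟩ := joinL.surjective x
  obtain ⟨T, hT⟩ := dSnd_pairMap_isInvertible hf hJ.2
  intro y
  obtain ⟨w, hw⟩ := T.surjective y
  refine ⟨joinL (0, w), ?_⟩
  rw [← hw]
  have h1 : dSnd (pairMap f) z w = fderiv ℝ (values f) (joinL z) (joinL (0, w)) := by
    change fderiv ℝ (values f ∘ joinL) z (0, w) = _
    rw [(hv.hasFDerivAt.comp z joinL.hasFDerivAt).fderiv]
    rfl
  rw [← h1, ← hT]
  rfl

theorem surjective_comp_fderiv {π : R4 →L[ℝ] R2} (hπ : Function.Surjective π) {Θ : R4 → R4}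
    {x : R4} (hΘ : IsLocalDiffeomorphAt 𝓘(ℝ, R4) 𝓘(ℝ, R4) ∞ Θ x) :
    Function.Surjective (π.comp (fderiv ℝ Θ x)) :=
  hπ.comp ((LinearMap.injective_iff_surjective (f := (fderiv ℝ Θ x : R4 →ₗ[ℝ] R4))).1
    hΘ.fderiv_injective)

theorem mem_formWeb_coe_left (hlam : lam₁ ≠ lam₃) {f : Fin 2 → R4 → ℝ} {x : R4}
    (hJ : JacobiansAt f x) (v : R4) :
    v ∈ formWeb lam₁ lam₃ f (lam₁ : OnePoint ℝ) x ↔ firstPair v = 0 := by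
  refine ((straightAt_formWeb hlam hJ).1 v).trans ⟨fun h => ?_, fun h => ?_⟩
  · ext i
    fin_cases i
    exacts [h.1, h.2]
  · exact ⟨congrArg (fun u : R2 => u 0) h, congrArg (fun u : R2 => u 1) h⟩

theorem mem_formWeb_coe_right (hlam : lam₁ ≠ lam₃) {f : Fin 2 → R4 → ℝ} {x : R4}
    (hJ : JacobiansAt f x) (v : R4) :
    v ∈ formWeb lam₁ lam₃ f (lam₃ : OnePoint ℝ) x ↔ lastPair v = 0 := by
  refine ((straightAt_formWeb hlam hJ).2 v).trans ⟨fun h => ?_, fun h => ?_⟩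
  · ext i
    fin_cases i
    exacts [h.1, h.2]
  · exact ⟨congrArg (fun u : R2 => u 0) h, congrArg (fun u : R2 => u 1) h⟩

theorem mem_formWeb_infty {f : Fin 2 → R4 → ℝ} {x : R4} (hf : ∀ i, DifferentiableAt ℝ (f i) x)
    (v : R4) :
    v ∈ formWeb lam₁ lam₃ f OnePoint.infty x ↔ fderiv ℝ (values f) x v = 0 := by
  rw [mem_formWeb_iff_fderiv hf]
  simp

/-- The isomorphism preserves the kernels of d(x₁, x₂), d(x₃, x₄) and df, so each of these
submersions composed with it factors through its counterpart. The first two factorizations show that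
the isomorphism is φ × ζ near the base point, and the third produces ψ. -/
theorem LocalSolution.equiv_of_iso (hlam : lam₁ ≠ lam₃) {σ τ : LocalSolution}
    {W W' : LocalWeb lam₁ lam₃} (hW : W.DefinedBy σ) (hW' : W'.DefinedBy τ) (h : W.Iso W') :
    σ.Equiv τ := by
  obtain ⟨Θ, hΘ, hp, hiso⟩ := h
  rw [hW.1] at hΘ hp hiso
  rw [hW'.1] at hp
  have hc := hΘ.differentiableAt.continuousAt
  obtain ⟨V₀, hV₀, hpV₀, hΘV₀, hdiff⟩ := exists_nhd_of_isLocalDiffeomorphAt hΘ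
  have hτW := hW'.2
  rw [← hp] at hτW
  obtain ⟨V₁, hV₁, hV₁o, hpV₁⟩ := mem_nhds_iff.1 (hiso.and (hW.2.and (hc.eventually hτW)))
  have hτU : τ.U ∈ 𝓝 (Θ σ.p) := hp ▸ τ.isOpen.mem_nhds τ.mem
  obtain ⟨V₂, hV₂, hV₂o, hpV₂⟩ := mem_nhds_iff.1 (hc hτU)
  let V := V₀ ∩ V₁ ∩ V₂ ∩ σ.U
  have hV : IsOpen V := ((hV₀.inter hV₁o).inter hV₂o).inter σ.isOpen
  have hpV : σ.p ∈ V := ⟨⟨⟨hpV₀, hpV₁⟩, hpV₂⟩, σ.mem⟩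
  have hsm : ContDiffOn ℝ ∞ Θ V := hΘV₀.mono fun x hx => hx.1.1.1
  have hmaps : ∀ x ∈ V, Θ x ∈ τ.U := fun x hx => hV₂ hx.1.2
  have hdΘ : ∀ x ∈ V, IsLocalDiffeomorphAt 𝓘(ℝ, R4) 𝓘(ℝ, R4) ∞ Θ x := fun x hx =>
    hdiff x hx.1.1.1
  have hdσ : ∀ x ∈ V, ∀ i, DifferentiableAt ℝ (σ.f i) x := fun x hx i =>
    ((σ.smooth i).contDiffAt (σ.isOpen.mem_nhds hx.2)).differentiableAt (by simp)
  have hdτ : ∀ x ∈ V, ∀ i, DifferentiableAt ℝ (τ.f i) (Θ x) := fun x hx i =>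
    ((τ.smooth i).contDiffAt (τ.isOpen.mem_nhds (hmaps x hx))).differentiableAt (by simp)
  have hmem : ∀ x ∈ V, ∀ s, ∀ v : R4, v ∈ formWeb lam₁ lam₃ σ.f s x ↔
      fderiv ℝ Θ x v ∈ formWeb lam₁ lam₃ τ.f s (Θ x) := by
    intro x hx s v
    obtain ⟨h1, h2, h3⟩ := hV₁ hx.1.1.2
    have := h1 s v
    rwa [h2, h3] at this
  have hcomp : ∀ (π : R4 →L[ℝ] R2) (x : R4), x ∈ V →
      fderiv ℝ (π ∘ Θ) x = π.comp (fderiv ℝ Θ x) := fun π x hx =>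
    (π.hasFDerivAt.comp x (hdΘ x hx).differentiableAt.hasFDerivAt).fderiv
  have hfirst : Function.Surjective firstL := fun u => ⟨join u 0, firstPair_join u 0⟩
  have hlast : Function.Surjective lastL := fun w => ⟨join 0 w, lastPair_join 0 w⟩
  obtain ⟨φ, hφ, hφeq⟩ := exists_isLocalDiffeomorphAt_factorization hV (g := firstL)
    (h := firstL ∘ Θ) firstL.contDiff.contDiffOn (firstL.contDiff.comp_contDiffOn hsm) hpV
    (by rw [ContinuousLinearMap.fderiv]; exact hfirst)
    (by rw [hcomp _ _ hpV]; exact surjective_comp_fderiv hfirst hΘ) (fun x hx v hv => by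
      rw [ContinuousLinearMap.fderiv, firstL_apply,
        ← mem_formWeb_coe_left hlam (σ.jacobians x hx.2), hmem x hx,
        mem_formWeb_coe_left hlam (τ.jacobians _ (hmaps x hx))] at hv
      rw [hcomp _ _ hx]
      exact hv)
  obtain ⟨ζ, hζ, hζeq⟩ := exists_isLocalDiffeomorphAt_factorization hV (g := lastL)
    (h := lastL ∘ Θ) lastL.contDiff.contDiffOn (lastL.contDiff.comp_contDiffOn hsm) hpV
    (by rw [ContinuousLinearMap.fderiv]; exact hlast)
    (by rw [hcomp _ _ hpV]; exact surjective_comp_fderiv hlast hΘ) (fun x hx v hv => by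
      rw [ContinuousLinearMap.fderiv, lastL_apply,
        ← mem_formWeb_coe_right hlam (σ.jacobians x hx.2), hmem x hx,
        mem_formWeb_coe_right hlam (τ.jacobians _ (hmaps x hx))] at hv
      rw [hcomp _ _ hx]
      exact hv)
  have hcompτ : ∀ x ∈ V, fderiv ℝ (values τ.f ∘ Θ) x
      = (fderiv ℝ (values τ.f) (Θ x)).comp (fderiv ℝ Θ x) := fun x hx =>
    (((τ.contDiffAt_values (hmaps x hx)).differentiableAt (by simp)).hasFDerivAt.comp x
      (hdΘ x hx).differentiableAt.hasFDerivAt).fderiv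
  -- Here `σ.f` is factored through `τ.f ∘ Θ`, the direction that `GermEquiv` asks for.
  obtain ⟨ψ, hψ, hψeq⟩ := exists_isLocalDiffeomorphAt_factorization hV (g := values τ.f ∘ Θ)
    (h := values σ.f) ((contDiffOn_values τ.smooth).comp hsm hmaps)
    ((contDiffOn_values σ.smooth).mono fun x hx => hx.2) hpV
    (by
      rw [hcompτ _ hpV]
      exact surjective_comp_fderiv (fderiv_values_surjective (hdτ _ hpV)
        (τ.jacobians _ (hmaps _ hpV))) hΘ)
    (fderiv_values_surjective (hdσ _ hpV) (σ.jacobians _ σ.mem)) (fun x hx v hv => by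
      rw [hcompτ x hx, ContinuousLinearMap.comp_apply,
        ← mem_formWeb_infty (lam₁ := lam₁) (lam₃ := lam₃) (hdτ x hx), ← hmem x hx,
        mem_formWeb_infty (hdσ x hx)] at hv
      exact hv)
  have hprod : productMap φ ζ =ᶠ[𝓝 σ.p] Θ := by
    filter_upwards [hφeq, hζeq] with x h1 h2
    exact (congrArg₂ join h1.symm h2.symm).trans (join_pairs (Θ x))
  refine germEquiv_iff.2 ⟨ψ, φ, ζ, ?_, hφ, hζ, hprod.eq_of_nhds.trans hp, ?_⟩
  · rw [← hp]
    exact hψ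
  · filter_upwards [hψeq, hprod] with x h1 h2
    rw [h1, Function.comp_apply, Function.comp_apply, Function.comp_apply, h2]

theorem LocalWeb.exists_definedBy (hlam : lam₁ ≠ lam₃) (W : LocalWeb lam₁ lam₃) :
    ∃ σ, W.DefinedBy σ := by
  obtain ⟨f, hf, hlevel⟩ := W.infty_level
  have h := recognition hlam W.isOpen hf W.threeWebType.kronecker.foliation
    (fun x hx => W.threeWebType.isLinearWeb hx)
    (fun x hx => (W.threeWebType.compl_infty_zero x hx).disjoint) W.straight hlevel
  exact ⟨⟨W.U, W.isOpen, W.p, W.mem, f, hf, fun x hx => (h x hx).1, fun x hx => (h x hx).2.1⟩,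
    rfl, Filter.mem_of_superset (W.isOpen.mem_nhds W.mem) fun x hx => (h x hx).2.2⟩

theorem exists_classification (hlam : lam₁ ≠ lam₃) :
    ∃ Φ : Quot LocalSolution.Equiv ≃ Quot (LocalWeb.Iso (lam₁ := lam₁) (lam₃ := lam₃)),
      ∀ (σ : LocalSolution) (W : LocalWeb lam₁ lam₃), W.DefinedBy σ →
        Φ (Quot.mk _ σ) = Quot.mk _ W := by
  let Ψ : Quot LocalSolution.Equiv → Quot (LocalWeb.Iso (lam₁ := lam₁) (lam₃ := lam₃)) :=
    Quot.map (fun σ => σ.web hlam) fun σ τ h =>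
      LocalSolution.iso_of_equiv h (σ.web_definedBy hlam) (τ.web_definedBy hlam)
  have hΨ : ∀ (σ : LocalSolution) (W : LocalWeb lam₁ lam₃), W.DefinedBy σ →
      Ψ (Quot.mk _ σ) = Quot.mk _ W := fun σ W hW =>
    -- Two webs defined by the same solution agree near the base point; the reflexive equivalence
    -- supplies the isomorphism.
    Quot.sound (LocalSolution.iso_of_equiv (equivalence_localSolution.refl σ)
      (σ.web_definedBy hlam) hW)
  refine ⟨Equiv.ofBijective Ψ ⟨?_, ?_⟩, hΨ⟩
  · rintro ⟨σ⟩ ⟨τ⟩ h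
    exact Quot.sound (LocalSolution.equiv_of_iso hlam (σ.web_definedBy hlam)
      (τ.web_definedBy hlam) ((equivalence_localWebIso.quot_mk_eq_iff _ _).1 h))
  · rintro ⟨W⟩
    obtain ⟨σ, hσ⟩ := W.exists_definedBy hlam
    exact ⟨Quot.mk _ σ, hΨ σ W hσ⟩

end Classification

end KroneckerWeb

end

theorem mainTheorem3 (lam₁ lam₃ : ℝ) (hlam : lam₁ ≠ lam₃) :
    -- Solutions define webs.
    (∀ (U : Set R4) (f : Fin 2 → R4 → ℝ), IsOpen U → (∀ i, ContDiffOn ℝ ∞ (f i) U) →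
      (∀ x ∈ U, SolvesAt f x) → (∀ x ∈ U, JacobiansAt f x) →
        IsThreeWebTypeOn (formWeb lam₁ lam₃ f) U ∧
        ∀ x ∈ U, StraightAt lam₁ lam₃ (formWeb lam₁ lam₃ f) x ∧
          InftyLevelAt f (formWeb lam₁ lam₃ f) x) ∧
    -- Every web has adapted local coordinates, in which first integrals are solutions.
    (∀ (M : Type*) [TopologicalSpace M] [ChartedSpace R4 M] [IsManifold 𝓘(ℝ, R4) ∞ M]
      (F : OnePoint ℝ → ∀ x : M, Submodule ℝ (TangentSpace 𝓘(ℝ, R4) x)),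
      IsThreeWebTypeOn F Set.univ → ∀ p : M,
        ∃ c ∈ IsManifold.maximalAtlas 𝓘(ℝ, R4) ∞ M, p ∈ c.source ∧
          (∀ x ∈ c.source, ∀ v : TangentSpace 𝓘(ℝ, R4) x,
            (v ∈ F (lam₁ : OnePoint ℝ) x ↔
              covector (fun y => c y 0) x v = 0 ∧ covector (fun y => c y 1) x v = 0) ∧
            (v ∈ F (lam₃ : OnePoint ℝ) x ↔
              covector (fun y => c y 2) x v = 0 ∧ covector (fun y => c y 3) x v = 0)) ∧
          ∀ (V : Set M) (f : Fin 2 → M → ℝ), IsOpen V → V ⊆ c.source →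
            AreFirstIntegralsOn f (F OnePoint.infty) V →
            ∀ x ∈ V, SolvesAt (fun i => f i ∘ c.symm) (c x) ∧
              JacobiansAt (fun i => f i ∘ c.symm) (c x)) ∧
    -- In coordinates with the prescribed foliations, the pair `f` solves the system
    -- and the web is the one defined by the forms of `f`.
    (∀ (U : Set R4) (f : Fin 2 → R4 → ℝ)
      (F : OnePoint ℝ → ∀ x : R4, Submodule ℝ (TangentSpace 𝓘(ℝ, R4) x)),
      IsOpen U → (∀ i, ContDiffOn ℝ ∞ (f i) U) → IsThreeWebTypeOn F U →
      (∀ x ∈ U, StraightAt lam₁ lam₃ F x ∧ InftyLevelAt f F x) →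
        ∀ x ∈ U, SolvesAt f x ∧ JacobiansAt f x ∧ ∀ s, F s x = formWeb lam₁ lam₃ f s x) ∧
    -- The equivalence of pairs of functions preserves the system and the Jacobian conditions.
    (∀ (U U' : Set R4) (p p' : R4) (f g : Fin 2 → R4 → ℝ), IsOpen U → p ∈ U → IsOpen U' → p' ∈ U' →
      (∀ i, ContDiffOn ℝ ∞ (f i) U) → (∀ i, ContDiffOn ℝ ∞ (g i) U') → GermEquiv f p g p' →
        ((∀ᶠ x in 𝓝 p, SolvesAt f x) → ∀ᶠ x in 𝓝 p', SolvesAt g x) ∧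
        ((∀ᶠ x in 𝓝 p, JacobiansAt f x) → ∀ᶠ x in 𝓝 p', JacobiansAt g x)) ∧
    -- The correspondence between classes of solutions and classes of webs is one-to-one.
    Equivalence LocalSolution.Equiv ∧
    Equivalence (LocalWeb.Iso (lam₁ := lam₁) (lam₃ := lam₃)) ∧
    (∀ σ : LocalSolution, ∃ W : LocalWeb lam₁ lam₃, W.DefinedBy σ) ∧
    ∃ Φ : Quot LocalSolution.Equiv ≃ Quot (LocalWeb.Iso (lam₁ := lam₁) (lam₃ := lam₃)),
      ∀ (σ : LocalSolution) (W : LocalWeb lam₁ lam₃), W.DefinedBy σ →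
        Φ (Quot.mk _ σ) = Quot.mk _ W := by
  refine ⟨fun U f hU hf hsol hJ => ⟨isThreeWebTypeOn_formWeb hlam hU hf hsol hJ, fun x hx =>
      ⟨straightAt_formWeb hlam (hJ x hx), inftyLevelAt_formWeb lam₁ lam₃ f x⟩⟩,
    fun M _ _ _ F hF p => ?_, fun U f F hU hf hF h => recognition hlam hU hf
      hF.kronecker.foliation (fun x hx => hF.isLinearWeb hx)
      (fun x hx => (hF.compl_infty_zero x hx).disjoint) (fun x hx => (h x hx).1)
      (fun x hx => (h x hx).2),
    fun U U' p p' f g _ _ hU' hp' _ hg h => h.eventually hU' hp' hg,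
    equivalence_localSolution, equivalence_localWebIso,
    fun σ => ⟨σ.web hlam, σ.web_definedBy hlam⟩, exists_classification hlam⟩
  obtain ⟨c, hc, hp, hadapted⟩ := exists_adapted_chart hlam hF p
  exact ⟨c, hc, hp, hadapted, fun V f hV hVc hf x hx =>
    solvesAt_of_adapted_chart hlam hF hc hadapted hV hVc hf hx⟩
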